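/- Let $q\in\mathbb{C}^\times$ not be a root of unity. For $n\in\{q,q^{-1}\}$ let $\mathcal{A}(n)$ denote the relations $$ad=da,\quad ab=n\,ba,\quad ca=n\,ac,\quad db=n\,bd,\quad cd=n\,dc,\quad bc-cb=(n^{-1}-n)\,ad$$ and let $\mathcal{F}(n)$ denote the relations (with $a,d$ even, $b,c$ odd, $b^2=c^2=0$) $$ad=da,\quad ab=n\,ba,\quad ca=n\,ac,\quad bd=n\,db,\quad dc=n\,cd,\quad bc+cb=(n-n^{-1})\,ad .$$ For every pair of parities $s,t\in\mathbb{Z}/2$ let $\mathcal{C}_{st}$ be a complex superalgebra with elements $a,b,c,d$, where $a,d$ are even and invertible, $b,c$ are non-zero of parity $s+t$, the matrix $X[\mathcal{C}_{st}]=\begin{pmatrix}a&b\\c&d\end{pmatrix}$ is invertible, $b^2=c^2=0$ if $s\ne t$, and $\mathcal{C}_{st}$ is generated by $a^{\pm1},b,c,d^{\pm1}$ and the entries of $X^{-1}$. Assume that $\mathcal{C}_{00}$ satisfies the relations $\mathcal{A}(q)$. Give three auxiliary lines $\alpha,\beta,\gamma$ parities $p_\alpha,p_\beta,p_\gamma\in\mathbb{Z}/2$,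 and put $\mathcal{C}_1=\mathcal{C}_{p_\alpha p_\beta}$, $\mathcal{C}_2=\mathcal{C}_{p_\alpha p_\gamma}$, $\mathcal{C}_3=\mathcal{C}_{p_\beta p_\gamma}$. Let $X_{\alpha\beta}[\mathcal{C}]$ be the $3\times3$ matrix equal to $X[\mathcal{C}]$ in the block $\alpha\oplus\beta$ and to the identity on $\gamma$, and similarly $X_{\alpha\gamma},X_{\beta\gamma}$. We say that the zero curvature equation $$X_{\alpha\beta}[\mathcal{C}_1]\,X_{\alpha\gamma}[\mathcal{C}_2]\,X_{\beta\gamma}[\mathcal{C}_3]=X_{\beta\gamma}[\mathcal{C}_3']\,X_{\alpha\gamma}[\mathcal{C}_2']\,X_{\alpha\beta}[\mathcal{C}_1']\qquad(*)$$ provides an automorphism for this parity pattern if there are a superalgebra $\mathcal{B}$ containing the graded tensor product $\mathcal{C}_1\otimes\mathcal{C}_2\otimes\mathcal{C}_3$ and a parity-preserving automorphism $\Phi$ of $\mathcal{B}$ such that $(*)$ holds with $x'=\Phi(x)$ for all coefficients $x$. Then $(*)$ provides automorphisms for all eight parity patterns if and only if $\mathcal{C}_{01}$ satisfies the relations $\mathcal{F}(q)$,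 $\mathcal{C}_{10}$ satisfies $\mathcal{F}(q^{-1})$ and $\mathcal{C}_{11}$ satisfies $\mathcal{A}(q^{-1})$. Moreover, in this case, for every parity pattern, $\mathcal{B}$ and $\Phi$ can be chosen so that $\Phi$ fixes the centers of $\mathcal{C}_1,\mathcal{C}_2,\mathcal{C}_3$. For every $\mathcal{B}$, a center-fixing automorphism solving $(*)$ is uniquely determined on $\mathcal{C}_1\otimes\mathcal{C}_2\otimes\mathcal{C}_3$ if the three parities are not all equal. In every pattern it is determined up to a sign, in the following sense: its values on $b_2$, $c_2$ and on all products of two of the elements $a_1,b_1,c_1,d_1,a_2,d_2,a_3,b_3,c_3,d_3$ are determined. -/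

import Mathlib

open scoped TensorProduct

universe u

namespace SuperTetra

/-- A local linear problem `ψ_α' = a ψ_α + b ψ_β`, `ψ_β' = c ψ_α + d ψ_β` with coefficients in a
superalgebra `C` over `ℂ` (`ℤ/2`-grading `𝒢`).  Here `s` is the sum of the parities of the lines
`α` and `β`: the diagonal coefficients are even, and `b`, `c` have parity `s`.
The coefficients `a`, `d` are invertible, the problem as a whole (the matrix `X`) is invertible,
`b`, `c` do not vanish, and they square to zero when they are odd.
`C` is generated by the coefficients and the inverses of `a`, `d`, `X`. -/
structure LinearProblem {C : Type u} [Ring C] [Algebra ℂ C] (𝒢 : ZMod 2 → Submodule ℂ C)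
    (s : ZMod 2) where
  a : C
  b : C
  c : C
  d : C
  a_mem : a ∈ 𝒢 0
  d_mem : d ∈ 𝒢 0
  b_mem : b ∈ 𝒢 s
  c_mem : c ∈ 𝒢 s
  isUnit_a : IsUnit a
  isUnit_d : IsUnit d
  isUnit_X : IsUnit (!![a, b; c, d] : Matrix (Fin 2) (Fin 2) C)
  b_ne_zero : b ≠ 0
  c_ne_zero : c ≠ 0
  odd_sq : s = 1 → b * b = 0 ∧ c * c = 0
  generates : Algebra.adjoin ℂ
    (({a, b, c, d, Ring.inverse a, Ring.inverse d} : Set C) ∪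
      Set.range fun ij : Fin 2 × Fin 2 =>
        Ring.inverse (!![a, b; c, d] : Matrix (Fin 2) (Fin 2) C) ij.1 ij.2) = ⊤

section Relations

variable {C : Type u} [Ring C] [Algebra ℂ C] {𝒢 : ZMod 2 → Submodule ℂ C} {s : ZMod 2}

/-- The coefficients satisfy the defining relations of the Bose algebra `𝒜(q)`. -/
structure LinearProblem.IsBose (L : LinearProblem 𝒢 s) (q : ℂ) : Prop where
  ad : L.a * L.d = L.d * L.a
  ab : L.a * L.b = q • (L.b * L.a)
  ca : L.c * L.a = q • (L.a * L.c)
  db : L.d * L.b = q • (L.b * L.d)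
  cd : L.c * L.d = q • (L.d * L.c)
  bc : L.b * L.c - L.c * L.b = (q⁻¹ - q) • (L.a * L.d)

/-- The coefficients satisfy the defining relations of the Fermi superalgebra `ℱ(q)`
(the relations `b² = c² = 0` are part of `LinearProblem`). -/
structure LinearProblem.IsFermi (L : LinearProblem 𝒢 s) (q : ℂ) : Prop where
  ad : L.a * L.d = L.d * L.a
  ab : L.a * L.b = q • (L.b * L.a)
  ca : L.c * L.a = q • (L.a * L.c)
  bd : L.b * L.d = q • (L.d * L.b)
  dc : L.d * L.c = q • (L.c * L.d)
  bc : L.b * L.c + L.c * L.b = (q - q⁻¹) • (L.a * L.d)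

end Relations

section Matrices

variable {C B : Type u} [Ring C] [Algebra ℂ C] [Ring B] [Algebra ℂ B]
  {𝒢 : ZMod 2 → Submodule ℂ C} {s : ZMod 2}

/-- `X_{αβ}`: the 2×2 matrix placed in the block `α ⊕ β`, the identity on `γ`; the entries are
transported to `B` by `f`. -/
def LinearProblem.Xαβ (L : LinearProblem 𝒢 s) (f : C →ₐ[ℂ] B) : Matrix (Fin 3) (Fin 3) B :=
  !![f L.a, f L.b, 0; f L.c, f L.d, 0; 0, 0, 1]

/-- `X_{αγ}`: the block `α ⊕ γ`, the identity on `β`. -/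
def LinearProblem.Xαγ (L : LinearProblem 𝒢 s) (f : C →ₐ[ℂ] B) : Matrix (Fin 3) (Fin 3) B :=
  !![f L.a, 0, f L.b; 0, 1, 0; f L.c, 0, f L.d]

/-- `X_{βγ}`: the block `β ⊕ γ`, the identity on `α`. -/
def LinearProblem.Xβγ (L : LinearProblem 𝒢 s) (f : C →ₐ[ℂ] B) : Matrix (Fin 3) (Fin 3) B :=
  !![1, 0, 0; 0, f L.a, f L.b; 0, f L.c, f L.d]

end Matrices

/-- `f` and `g` have supercommuting images: homogeneous elements commute up to the sign
`(-1)^{|x||y|}`. -/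
def SuperCommuting {C D B : Type u} [Ring C] [Algebra ℂ C] [Ring D] [Algebra ℂ D] [Ring B]
    [Algebra ℂ B] (𝒞 : ZMod 2 → Submodule ℂ C) (𝒟 : ZMod 2 → Submodule ℂ D)
    (f : C →ₐ[ℂ] B) (g : D →ₐ[ℂ] B) : Prop :=
  ∀ s t : ZMod 2, ∀ x ∈ 𝒞 s, ∀ y ∈ 𝒟 t,
    f x * g y = ((-1 : ℂ) ^ (s.val * t.val)) • (g y * f x)

/-- An embedding of the graded tensor product `C₁ ⊗ C₂ ⊗ C₃` of superalgebras into a superalgebra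
`B`: three parity-preserving homomorphisms whose images supercommute (which is the same as one
homomorphism of superalgebras on the graded tensor product) such that
`x ⊗ y ⊗ z ↦ i₁ x * i₂ y * i₃ z` is injective. -/
structure TensorEmbedding {C₁ C₂ C₃ B : Type u} [Ring C₁] [Algebra ℂ C₁] [Ring C₂] [Algebra ℂ C₂]
    [Ring C₃] [Algebra ℂ C₃] [Ring B] [Algebra ℂ B]
    (𝒢₁ : ZMod 2 → Submodule ℂ C₁) (𝒢₂ : ZMod 2 → Submodule ℂ C₂) (𝒢₃ : ZMod 2 → Submodule ℂ C₃)
    (ℬ : ZMod 2 → Submodule ℂ B) where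
  i₁ : C₁ →ₐ[ℂ] B
  i₂ : C₂ →ₐ[ℂ] B
  i₃ : C₃ →ₐ[ℂ] B
  map_mem₁ : ∀ s, ∀ x ∈ 𝒢₁ s, i₁ x ∈ ℬ s
  map_mem₂ : ∀ s, ∀ x ∈ 𝒢₂ s, i₂ x ∈ ℬ s
  map_mem₃ : ∀ s, ∀ x ∈ 𝒢₃ s, i₃ x ∈ ℬ s
  comm₁₂ : SuperCommuting 𝒢₁ 𝒢₂ i₁ i₂
  comm₁₃ : SuperCommuting 𝒢₁ 𝒢₃ i₁ i₃
  comm₂₃ : SuperCommuting 𝒢₂ 𝒢₃ i₂ i₃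
  injective : Function.Injective
    (LinearMap.mul' ℂ B ∘ₗ
      TensorProduct.map (LinearMap.mul' ℂ B ∘ₗ TensorProduct.map i₁.toLinearMap i₂.toLinearMap)
        i₃.toLinearMap)

section Evolution

variable {C₁ C₂ C₃ B : Type u} [Ring C₁] [Algebra ℂ C₁] [Ring C₂] [Algebra ℂ C₂]
  [Ring C₃] [Algebra ℂ C₃] [Ring B] [Algebra ℂ B]
  {𝒢₁ : ZMod 2 → Submodule ℂ C₁} {𝒢₂ : ZMod 2 → Submodule ℂ C₂} {𝒢₃ : ZMod 2 → Submodule ℂ C₃}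
  {ℬ : ZMod 2 → Submodule ℂ B} {s₁ s₂ s₃ : ZMod 2}

/-- `Φ` is an automorphism of the superalgebra `B` (it preserves parity) such that, with the
primed coefficients `x' = Φ x`, the zero curvature equation
`X_{αβ}[C₁] X_{αγ}[C₂] X_{βγ}[C₃] = X_{βγ}[C₃'] X_{αγ}[C₂'] X_{αβ}[C₁']` holds. -/
structure SolvesZeroCurvature (L₁ : LinearProblem 𝒢₁ s₁) (L₂ : LinearProblem 𝒢₂ s₂)
    (L₃ : LinearProblem 𝒢₃ s₃) (T : TensorEmbedding 𝒢₁ 𝒢₂ 𝒢₃ ℬ) (Φ : B ≃ₐ[ℂ] B) : Prop where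
  map_mem : ∀ s, ∀ x ∈ ℬ s, Φ x ∈ ℬ s
  eqn : L₁.Xαβ T.i₁ * L₂.Xαγ T.i₂ * L₃.Xβγ T.i₃ =
    L₃.Xβγ (Φ.toAlgHom.comp T.i₃) * L₂.Xαγ (Φ.toAlgHom.comp T.i₂) *
      L₁.Xαβ (Φ.toAlgHom.comp T.i₁)

/-- `Φ` conserves the centers of the three local algebras. -/
def FixesCenters (T : TensorEmbedding 𝒢₁ 𝒢₂ 𝒢₃ ℬ) (Φ : B ≃ₐ[ℂ] B) : Prop :=
  (∀ z ∈ Subalgebra.center ℂ C₁, Φ (T.i₁ z) = T.i₁ z) ∧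
  (∀ z ∈ Subalgebra.center ℂ C₂, Φ (T.i₂ z) = T.i₂ z) ∧
  (∀ z ∈ Subalgebra.center ℂ C₃, Φ (T.i₃ z) = T.i₃ z)

/-- `Φ` and `Ψ` agree on the graded tensor product. -/
def AgreeOn (T : TensorEmbedding 𝒢₁ 𝒢₂ 𝒢₃ ℬ) (Φ Ψ : B ≃ₐ[ℂ] B) : Prop :=
  (∀ x, Φ (T.i₁ x) = Ψ (T.i₁ x)) ∧ (∀ x, Φ (T.i₂ x) = Ψ (T.i₂ x)) ∧
    (∀ x, Φ (T.i₃ x) = Ψ (T.i₃ x))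

/-- The coefficients that change sign under the involution
`(a₁, b₁, c₁, d₁, a₂, d₂, a₃, b₃, c₃, d₃) ↦ -(…)`, `(b₂, c₂) ↦ (b₂, c₂)`, which preserves the
right-hand side of the zero curvature equation. -/
def signCoefficients (L₁ : LinearProblem 𝒢₁ s₁) (L₂ : LinearProblem 𝒢₂ s₂)
    (L₃ : LinearProblem 𝒢₃ s₃) (T : TensorEmbedding 𝒢₁ 𝒢₂ 𝒢₃ ℬ) : Set B :=
  {T.i₁ L₁.a, T.i₁ L₁.b, T.i₁ L₁.c, T.i₁ L₁.d, T.i₂ L₂.a, T.i₂ L₂.d,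
    T.i₃ L₃.a, T.i₃ L₃.b, T.i₃ L₃.c, T.i₃ L₃.d}

/-- `Φ` and `Ψ` agree on the graded tensor product up to the choice of that sign: they agree on
`b₂`, `c₂` and on all products of two of the other coefficients. -/
def AgreeUpToSign (L₁ : LinearProblem 𝒢₁ s₁) (L₂ : LinearProblem 𝒢₂ s₂)
    (L₃ : LinearProblem 𝒢₃ s₃) (T : TensorEmbedding 𝒢₁ 𝒢₂ 𝒢₃ ℬ) (Φ Ψ : B ≃ₐ[ℂ] B) : Prop :=
  Φ (T.i₂ L₂.b) = Ψ (T.i₂ L₂.b) ∧ Φ (T.i₂ L₂.c) = Ψ (T.i₂ L₂.c) ∧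
    ∀ x ∈ signCoefficients L₁ L₂ L₃ T, ∀ y ∈ signCoefficients L₁ L₂ L₃ T, Φ (x * y) = Ψ (x * y)

end Evolution

section Automorphisms

variable {C₁ C₂ C₃ : Type u} [Ring C₁] [Algebra ℂ C₁] [Ring C₂] [Algebra ℂ C₂]
  [Ring C₃] [Algebra ℂ C₃]
  {𝒢₁ : ZMod 2 → Submodule ℂ C₁} {𝒢₂ : ZMod 2 → Submodule ℂ C₂} {𝒢₃ : ZMod 2 → Submodule ℂ C₃}
  {s₁ s₂ s₃ : ZMod 2}

/-- The zero curvature equation provides an automorphism for `C₁ ⊗ C₂ ⊗ C₃`.  The primed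
coefficients are in general not polynomial in the unprimed ones (square roots and inverses occur),
so the automorphism acts on a superalgebra `B` that contains the graded tensor product; the primed
coefficients satisfy in `B` exactly the relations that the unprimed ones satisfy. -/
def ProvidesAutomorphism (L₁ : LinearProblem 𝒢₁ s₁) (L₂ : LinearProblem 𝒢₂ s₂)
    (L₃ : LinearProblem 𝒢₃ s₃) : Prop :=
  ∃ (B : Type u) (_ : Ring B) (_ : Algebra ℂ B) (ℬ : ZMod 2 → Submodule ℂ B)
    (_ : GradedAlgebra ℬ) (T : TensorEmbedding 𝒢₁ 𝒢₂ 𝒢₃ ℬ) (Φ : B ≃ₐ[ℂ] B),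
    SolvesZeroCurvature L₁ L₂ L₃ T Φ

/-- The same with an automorphism that conserves the centers of the local algebras. -/
def ProvidesCentralAutomorphism (L₁ : LinearProblem 𝒢₁ s₁) (L₂ : LinearProblem 𝒢₂ s₂)
    (L₃ : LinearProblem 𝒢₃ s₃) : Prop :=
  ∃ (B : Type u) (_ : Ring B) (_ : Algebra ℂ B) (ℬ : ZMod 2 → Submodule ℂ B)
    (_ : GradedAlgebra ℬ) (T : TensorEmbedding 𝒢₁ 𝒢₂ 𝒢₃ ℬ) (Φ : B ≃ₐ[ℂ] B),
    SolvesZeroCurvature L₁ L₂ L₃ T Φ ∧ FixesCenters T Φ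

/-- In every superalgebra that contains the graded tensor product, the automorphism that conserves
the centers is determined by the zero curvature equation. -/
def DeterminesAutomorphism (L₁ : LinearProblem 𝒢₁ s₁) (L₂ : LinearProblem 𝒢₂ s₂)
    (L₃ : LinearProblem 𝒢₃ s₃) : Prop :=
  ∀ (B : Type u) [Ring B] [Algebra ℂ B] (ℬ : ZMod 2 → Submodule ℂ B) [GradedAlgebra ℬ]
    (T : TensorEmbedding 𝒢₁ 𝒢₂ 𝒢₃ ℬ) (Φ Ψ : B ≃ₐ[ℂ] B),
    SolvesZeroCurvature L₁ L₂ L₃ T Φ → FixesCenters T Φ →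
    SolvesZeroCurvature L₁ L₂ L₃ T Ψ → FixesCenters T Ψ → AgreeOn T Φ Ψ

/-- The same up to the choice of a sign. -/
def DeterminesAutomorphismUpToSign (L₁ : LinearProblem 𝒢₁ s₁) (L₂ : LinearProblem 𝒢₂ s₂)
    (L₃ : LinearProblem 𝒢₃ s₃) : Prop :=
  ∀ (B : Type u) [Ring B] [Algebra ℂ B] (ℬ : ZMod 2 → Submodule ℂ B) [GradedAlgebra ℬ]
    (T : TensorEmbedding 𝒢₁ 𝒢₂ 𝒢₃ ℬ) (Φ Ψ : B ≃ₐ[ℂ] B),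
    SolvesZeroCurvature L₁ L₂ L₃ T Φ → FixesCenters T Φ →
    SolvesZeroCurvature L₁ L₂ L₃ T Ψ → FixesCenters T Ψ → AgreeUpToSign L₁ L₂ L₃ T Φ Ψ

end Automorphisms

end SuperTetra

set_option linter.unusedSimpArgs false
set_option linter.unusedSectionVars false

namespace SuperTetra

/-! Attach the parameter `q` to an even line and `q⁻¹` to an odd one (`qp`). The four sets of
relations 𝒜(q), ℱ(q), ℱ(q⁻¹), 𝒜(q⁻¹) are then the cases of one family `LocalRel q s t`: `a`
exchanges with `b`, `c` by the parameter of the first line, `d` by that of the second, and `b`, `c`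
supercommute up to a multiple of `ad`. Let `monL` and `monR` be the products of the three block
matrices in the two orders, both formed from the unprimed coefficients. A solution Φ is an
automorphism that maps `monR` entrywise to `monL`.

Existence. Under `LocalRel` the entries of both matrices obey the same exchange relations, those of
a quantum matrix (`TripleRel.triangular`). Each local algebra acts faithfully on its quotient by the
left ideal generated by `c`: a Fock space, in which `c` lowers, `b` raises, and everything is raised
from the kernel of `c`. On the graded tensor product V of three Fock spaces, the vectors killed by
all three `c` form the vacuum. The upper triangular entries of `monR` raise the whole of V from the
vacuum (`raised_vac_eq_top`). Hence there is at most one operator R with `R monR = monL R` that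
fixes the vacuum. To construct it, raise the diagonal vacuum in V × V by the pairs of entries of
`monR` and `monL`. The exchange relations make the resulting subspace stable under all nine pairs,
and a lowering argument, which uses that `q` is not a root of unity, shows that it is a graph
(`corr_graph`, `exists_intertwiner`). The same construction for the inverse local problems, which
obey the same relations, yields the inverse of R. Conjugation by R on the operators of V is the
required automorphism. It fixes the local centers because central elements are even, hence commute
with all coefficients, and R commutes with such operators.

Necessity. An exchange relation that holds identically among the entries of one matrix is carried by
Φ to the other. There its defect is a single product of three factors, one from each algebra, one of
which is an unknown relation and the others nonzero. Injectivity of the tensor embedding makes the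
unknown relation vanish. Three parity patterns are enough.

Uniqueness. Two center-fixing solutions agree on a subalgebra that contains the local centers, the
entries of `monR` and the entries of its inverse. Thus `b₂` and `c₂` are determined. If the second
problem is odd, they and the center determine `a₂`, `d₂` and then all the rest. If it is even, they
determine only `a₂²` and the products of `a₂` with the other coefficients; odd first and third
problems still fix `a₂`, otherwise a sign is left (`agree_of_solves`). -/

/-- The sign `(-1)^s`. -/
def sg (s : ZMod 2) : ℂ := if s = 0 then 1 else -1

/-- `q` for an even line, `q⁻¹` for an odd line. -/
noncomputable def qp (q : ℂ) (s : ZMod 2) : ℂ := if s = 0 then q else q⁻¹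

/-- The four coefficients of a local linear problem. -/
@[ext] structure Quad (E : Type*) where
  a : E
  b : E
  c : E
  d : E

/-- The exchange relations of the coefficients of a local linear problem between lines of
parities `s` and `t`. -/
structure LocalRel {E : Type*} [Ring E] [Algebra ℂ E] (q : ℂ) (s t : ZMod 2) (x : Quad E) :
    Prop where
  da : x.d * x.a = x.a * x.d
  ab : x.a * x.b = qp q s • (x.b * x.a)
  ca : x.c * x.a = qp q s • (x.a * x.c)
  db : x.d * x.b = qp q t • (x.b * x.d)
  cd : x.c * x.d = qp q t • (x.d * x.c)
  cb : x.c * x.b = sg (s + t) • (x.b * x.c)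
    + (sg (s + t) * (qp q t - (qp q t)⁻¹)) • (x.a * x.d)
  bb : s ≠ t → x.b * x.b = 0
  cc : s ≠ t → x.c * x.c = 0

/-- The coefficients `x`, `y` of two local problems supercommute; `h` is the sign for the
exchange of off-diagonal coefficients. -/
structure CrossRel {E : Type*} [Ring E] [Algebra ℂ E] (h : ℂ) (x y : Quad E) : Prop where
  aa : y.a * x.a = x.a * y.a
  ab : y.a * x.b = x.b * y.a
  ac : y.a * x.c = x.c * y.a
  ad : y.a * x.d = x.d * y.a
  ba : y.b * x.a = x.a * y.b
  bb : y.b * x.b = h • (x.b * y.b)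
  bc : y.b * x.c = h • (x.c * y.b)
  bd : y.b * x.d = x.d * y.b
  ca : y.c * x.a = x.a * y.c
  cb : y.c * x.b = h • (x.b * y.c)
  cc : y.c * x.c = h • (x.c * y.c)
  cd : y.c * x.d = x.d * y.c
  da : y.d * x.a = x.a * y.d
  db : y.d * x.b = x.b * y.d
  dc : y.d * x.c = x.c * y.d
  dd : y.d * x.d = x.d * y.d

/-- Coefficients of the three local problems at a vertex where lines of parities `0`, `s`, `u`
meet. -/
structure TripleRel {E : Type*} [Ring E] [Algebra ℂ E] (q : ℂ) (s u : ZMod 2) (x y z : Quad E) :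
    Prop where
  rel₁ : LocalRel q 0 s x
  rel₂ : LocalRel q 0 u y
  rel₃ : LocalRel q s u z
  cross₁₂ : CrossRel (sg (s * u)) x y
  cross₁₃ : CrossRel (sg (s * (s + u))) x z
  cross₂₃ : CrossRel (sg (u * (s + u))) y z

/-- The relations among the entries of a monodromy matrix that are needed to order its entries:
upper triangular entries to the left. -/
structure TriangularRel {E : Type*} [Ring E] [Algebra ℂ E] (q : ℂ) (s u : ZMod 2)
    (t₁₁ t₁₂ t₁₃ t₂₁ t₂₂ t₂₃ t₃₁ t₃₂ t₃₃ : E) : Prop where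
  r12_13 : t₁₂ * t₁₃ = (sg (s * u) * q) • (t₁₃ * t₁₂)
  r23_13 : t₂₃ * t₁₃ = (sg (u * (s + u)) * qp q u) • (t₁₃ * t₂₃)
  r23_12 : t₂₃ * t₁₂ = sg (s * (s + u)) • (t₁₂ * t₂₃)
  r11_12 : t₁₁ * t₁₂ = q • (t₁₂ * t₁₁)
  r11_13 : t₁₁ * t₁₃ = q • (t₁₃ * t₁₁)
  r11_23 : t₁₁ * t₂₃ = t₂₃ * t₁₁
  r33_12 : t₃₃ * t₁₂ = t₁₂ * t₃₃
  r33_13 : t₃₃ * t₁₃ = qp q u • (t₁₃ * t₃₃)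
  r33_23 : t₃₃ * t₂₃ = qp q u • (t₂₃ * t₃₃)
  r22_12 : t₂₂ * t₁₂ = qp q s • (t₁₂ * t₂₂)
  r22_23 : t₂₂ * t₂₃ = qp q s • (t₂₃ * t₂₂)
  r22_13 : t₂₂ * t₁₃ = t₁₃ * t₂₂ + (sg s * (q - q⁻¹)) • (t₁₂ * t₂₃)
  r21_12 : t₂₁ * t₁₂ = sg s • (t₁₂ * t₂₁) + (q - q⁻¹) • (t₁₁ * t₂₂)
  r21_13 : t₂₁ * t₁₃ = sg (s * u) • (t₁₃ * t₂₁) + (q - q⁻¹) • (t₁₁ * t₂₃)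
  r21_23 : t₂₁ * t₂₃ = (sg (s * (s + u)) * qp q s) • (t₂₃ * t₂₁)
  r32_12 : t₃₂ * t₁₂ = (sg (s * (s + u)) * qp q s) • (t₁₂ * t₃₂)
  r32_13 : t₃₂ * t₁₃ = sg (u * (s + u)) • (t₁₃ * t₃₂)
    + (sg (s * u) * (q - q⁻¹)) • (t₁₂ * t₃₃)
  r32_23 : t₃₂ * t₂₃ = sg (s + u) • (t₂₃ * t₃₂) + (sg s * (q - q⁻¹)) • (t₂₂ * t₃₃)
  r31_12 : t₃₁ * t₁₂ = sg (s * u) • (t₁₂ * t₃₁) + (q - q⁻¹) • (t₁₁ * t₃₂)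
  r31_13 : t₃₁ * t₁₃ = sg u • (t₁₃ * t₃₁) + (q - q⁻¹) • (t₁₁ * t₃₃)
  r31_23 : t₃₁ * t₂₃ = sg (u * (s + u)) • (t₂₃ * t₃₁)
    + (sg (s * u) * (q - q⁻¹)) • (t₂₁ * t₃₃)
  sq12 : s ≠ 0 → t₁₂ * t₁₂ = 0
  sq13 : u ≠ 0 → t₁₃ * t₁₃ = 0
  sq23 : s ≠ u → t₂₃ * t₂₃ = 0

/-- The reassociated forms of the supercommutation relations, for use as rewriting rules. -/
theorem CrossRel.assoc {E : Type*} [Ring E] [Algebra ℂ E] {h : ℂ} {x y : Quad E}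
    (H : CrossRel h x y) :
    (∀ z, y.a * (x.a * z) = x.a * (y.a * z)) ∧ (∀ z, y.a * (x.b * z) = x.b * (y.a * z)) ∧
    (∀ z, y.a * (x.c * z) = x.c * (y.a * z)) ∧ (∀ z, y.a * (x.d * z) = x.d * (y.a * z)) ∧
    (∀ z, y.b * (x.a * z) = x.a * (y.b * z)) ∧ (∀ z, y.b * (x.b * z) = h • (x.b * (y.b * z))) ∧
    (∀ z, y.b * (x.c * z) = h • (x.c * (y.b * z))) ∧ (∀ z, y.b * (x.d * z) = x.d * (y.b * z)) ∧
    (∀ z, y.c * (x.a * z) = x.a * (y.c * z)) ∧ (∀ z, y.c * (x.b * z) = h • (x.b * (y.c * z))) ∧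
    (∀ z, y.c * (x.c * z) = h • (x.c * (y.c * z))) ∧ (∀ z, y.c * (x.d * z) = x.d * (y.c * z)) ∧
    (∀ z, y.d * (x.a * z) = x.a * (y.d * z)) ∧ (∀ z, y.d * (x.b * z) = x.b * (y.d * z)) ∧
    (∀ z, y.d * (x.c * z) = x.c * (y.d * z)) ∧ (∀ z, y.d * (x.d * z) = x.d * (y.d * z)) := by
  simp only [← mul_assoc, ← smul_mul_assoc, H.aa, H.ab, H.ac, H.ad, H.ba, H.bb, H.bc, H.bd,
    H.ca, H.cb, H.cc, H.cd, H.da, H.db, H.dc, H.dd, implies_true, and_self]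

/-- The reassociated forms of the local relations, for use as rewriting rules. -/
theorem LocalRel.assoc {E : Type*} [Ring E] [Algebra ℂ E] {q : ℂ} {s t : ZMod 2} {x : Quad E}
    (H : LocalRel q s t x) :
    (∀ z, x.d * (x.a * z) = x.a * (x.d * z)) ∧
    (∀ z, x.a * (x.b * z) = qp q s • (x.b * (x.a * z))) ∧
    (∀ z, x.c * (x.a * z) = qp q s • (x.a * (x.c * z))) ∧
    (∀ z, x.d * (x.b * z) = qp q t • (x.b * (x.d * z))) ∧
    (∀ z, x.c * (x.d * z) = qp q t • (x.d * (x.c * z))) ∧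
    (∀ z, x.c * (x.b * z) = sg (s + t) • (x.b * (x.c * z))
      + (sg (s + t) * (qp q t - (qp q t)⁻¹)) • (x.a * (x.d * z))) ∧
    (s ≠ t → ∀ z, x.b * (x.b * z) = 0) ∧ (s ≠ t → ∀ z, x.c * (x.c * z) = 0) := by
  simp +contextual only [← mul_assoc, ← smul_mul_assoc, ← add_mul, H.da, H.ab, H.ca, H.db, H.cd,
    H.cb, H.bb, H.cc, implies_true, and_self, ne_eq, not_false_eq_true, zero_mul]

/-! ### Exchange relations of the two monodromy matrices. -/

section Ordering

set_option maxHeartbeats 8000000 in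
/-- The relations among the entries of the monodromy matrices `X_{αβ} X_{αγ} X_{βγ}` and
`X_{βγ} X_{αγ} X_{αβ}`: they are the same. -/
theorem TripleRel.triangular {E : Type*} [Ring E] [Algebra ℂ E] {q : ℂ} (hq : q ≠ 0)
    {s u : ZMod 2} {x y z : Quad E} (h : TripleRel q s u x y z) :
    TriangularRel q s u (x.a * y.a) (x.b * z.a + x.a * y.b * z.c)
      (x.b * z.b + x.a * y.b * z.d) (x.c * y.a) (x.d * z.a + x.c * y.b * z.c)
      (x.d * z.b + x.c * y.b * z.d) y.c (y.d * z.c) (y.d * z.d) ∧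
    TriangularRel q s u (y.a * x.a) (y.a * x.b) y.b
      (z.b * y.c * x.a + z.a * x.c) (z.b * y.c * x.b + z.a * x.d) (z.b * y.d)
      (z.d * y.c * x.a + z.c * x.c) (z.d * y.c * x.b + z.c * x.d) (z.d * y.d) := by
  have two : ∀ i : ZMod 2, i = 0 ∨ i = 1 := by decide
  obtain ⟨h1, h2, h3, h12, h13, h23⟩ := h
  obtain ⟨l1, l2, l3, l4, l5, l6, l7, l8⟩ := h1.assoc
  obtain ⟨m1, m2, m3, m4, m5, m6, m7, m8⟩ := h2.assoc
  obtain ⟨n1, n2, n3, n4, n5, n6, n7, n8⟩ := h3.assoc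
  obtain ⟨x1, x2, x3, x4, x5, x6, x7, x8, x9, x10, x11, x12, x13, x14, x15, x16⟩ := h12.assoc
  obtain ⟨y1, y2, y3, y4, y5, y6, y7, y8, y9, y10, y11, y12, y13, y14, y15, y16⟩ := h13.assoc
  obtain ⟨z1, z2, z3, z4, z5, z6, z7, z8, z9, z10, z11, z12, z13, z14, z15, z16⟩ := h23.assoc
  obtain ⟨l1', l2', l3', l4', l5', l6', l7', l8'⟩ := h1
  obtain ⟨m1', m2', m3', m4', m5', m6', m7', m8'⟩ := h2
  obtain ⟨n1', n2', n3', n4', n5', n6', n7', n8'⟩ := h3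
  obtain ⟨x1', x2', x3', x4', x5', x6', x7', x8', x9', x10', x11', x12', x13', x14', x15', x16'⟩ :=
    h12
  obtain ⟨y1', y2', y3', y4', y5', y6', y7', y8', y9', y10', y11', y12', y13', y14', y15', y16'⟩ :=
    h13
  obtain ⟨z1', z2', z3', z4', z5', z6', z7', z8', z9', z10', z11', z12', z13', z14', z15', z16'⟩ :=
    h23
  -- Fixing the two parities turns all signs and parameters into explicit scalars.
  rcases two s with rfl | rfl <;> rcases two u with rfl | rfl
  all_goals
    clear two
    simp only [sg, qp, show (1 : ZMod 2) + 1 = 0 from rfl, mul_zero, zero_mul, mul_one, one_mul,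
      add_zero, zero_add, ↓reduceIte, one_ne_zero, zero_ne_one, ne_eq, not_true_eq_false,
      not_false_eq_true, forall_const, false_imp_iff, one_smul, neg_smul, inv_inv, neg_mul,
      IsEmpty.forall_iff] at *
    refine ⟨?_, ?_⟩
  all_goals
    constructor
  all_goals
    try simp only [sg, qp, show (1 : ZMod 2) + 1 = 0 from rfl, mul_zero, zero_mul, mul_one,
      one_mul, add_zero, zero_add, ↓reduceIte, one_ne_zero, zero_ne_one, ne_eq,
      not_true_eq_false, not_false_eq_true, forall_const, false_imp_iff, one_smul, neg_smul,
      neg_mul, IsEmpty.forall_iff]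
    -- The relations are oriented as rewriting rules: `x` moves before `y` and `y` before `z`, and
    -- inside one problem the order is `b`, `a`, `d`, `c`. Both sides reach the same normal form.
    try simp only [*, mul_add, add_mul, mul_assoc, smul_mul_assoc, mul_smul_comm, smul_smul,
      smul_add, neg_mul, mul_neg, smul_neg, zero_mul, mul_zero, smul_zero, neg_zero, add_zero,
      zero_add, neg_neg, neg_smul]
    try (match_scalars <;> field_simp <;> ring)

end Ordering

section Triangular

variable {E F : Type*} [Ring E] [Algebra ℂ E] [Ring F] [Algebra ℂ F] {q : ℂ} {s u : ZMod 2}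
  {t₁₁ t₁₂ t₁₃ t₂₁ t₂₂ t₂₃ t₃₁ t₃₂ t₃₃ : E} {r₁₁ r₁₂ r₁₃ r₂₁ r₂₂ r₂₃ r₃₁ r₃₂ r₃₃ : F}

theorem TriangularRel.prod (h : TriangularRel q s u t₁₁ t₁₂ t₁₃ t₂₁ t₂₂ t₂₃ t₃₁ t₃₂ t₃₃)
    (k : TriangularRel q s u r₁₁ r₁₂ r₁₃ r₂₁ r₂₂ r₂₃ r₃₁ r₃₂ r₃₃) :
    TriangularRel q s u (t₁₁, r₁₁) (t₁₂, r₁₂) (t₁₃, r₁₃) (t₂₁, r₂₁) (t₂₂, r₂₂) (t₂₃, r₂₃)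
      (t₃₁, r₃₁) (t₃₂, r₃₂) (t₃₃, r₃₃) where
  r12_13 := Prod.ext h.r12_13 k.r12_13
  r23_13 := Prod.ext h.r23_13 k.r23_13
  r23_12 := Prod.ext h.r23_12 k.r23_12
  r11_12 := Prod.ext h.r11_12 k.r11_12
  r11_13 := Prod.ext h.r11_13 k.r11_13
  r11_23 := Prod.ext h.r11_23 k.r11_23
  r33_12 := Prod.ext h.r33_12 k.r33_12
  r33_13 := Prod.ext h.r33_13 k.r33_13
  r33_23 := Prod.ext h.r33_23 k.r33_23
  r22_12 := Prod.ext h.r22_12 k.r22_12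
  r22_23 := Prod.ext h.r22_23 k.r22_23
  r22_13 := Prod.ext h.r22_13 k.r22_13
  r21_12 := Prod.ext h.r21_12 k.r21_12
  r21_13 := Prod.ext h.r21_13 k.r21_13
  r21_23 := Prod.ext h.r21_23 k.r21_23
  r32_12 := Prod.ext h.r32_12 k.r32_12
  r32_13 := Prod.ext h.r32_13 k.r32_13
  r32_23 := Prod.ext h.r32_23 k.r32_23
  r31_12 := Prod.ext h.r31_12 k.r31_12
  r31_13 := Prod.ext h.r31_13 k.r31_13
  r31_23 := Prod.ext h.r31_23 k.r31_23
  sq12 i := Prod.ext (h.sq12 i) (k.sq12 i)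
  sq13 i := Prod.ext (h.sq13 i) (k.sq13 i)
  sq23 i := Prod.ext (h.sq23 i) (k.sq23 i)

theorem TriangularRel.map (h : TriangularRel q s u t₁₁ t₁₂ t₁₃ t₂₁ t₂₂ t₂₃ t₃₁ t₃₂ t₃₃)
    (f : E →ₐ[ℂ] F) :
    TriangularRel q s u (f t₁₁) (f t₁₂) (f t₁₃) (f t₂₁) (f t₂₂) (f t₂₃) (f t₃₁) (f t₃₂)
      (f t₃₃) := by
  constructor
  all_goals simp only [← map_mul, ← map_smul, ← map_add, h.r12_13, h.r23_13, h.r23_12, h.r11_12,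
    h.r11_13, h.r11_23, h.r33_12, h.r33_13, h.r33_23, h.r22_12, h.r22_23, h.r22_13, h.r21_12,
    h.r21_13, h.r21_23, h.r32_12, h.r32_13, h.r32_23, h.r31_12, h.r31_13, h.r31_23]
  · exact fun i => by rw [h.sq12 i, map_zero]
  · exact fun i => by rw [h.sq13 i, map_zero]
  · exact fun i => by rw [h.sq23 i, map_zero]

end Triangular

/-! ### Subspaces raised from a vacuum. -/

section Raising

variable {W : Type*} [AddCommGroup W] [Module ℂ W]

/-- The smallest subspace that contains `W₀` and is stable under three operators. -/
def raised (W₀ : Submodule ℂ W) (e₁ e₂ e₃ : Module.End ℂ W) : Submodule ℂ W :=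
  sInf {p | W₀ ≤ p ∧ ∀ v ∈ p, e₁ v ∈ p ∧ e₂ v ∈ p ∧ e₃ v ∈ p}

variable {W₀ : Submodule ℂ W} {e₁ e₂ e₃ : Module.End ℂ W}

theorem raised_le {p : Submodule ℂ W} (h₀ : W₀ ≤ p)
    (h : ∀ v ∈ p, e₁ v ∈ p ∧ e₂ v ∈ p ∧ e₃ v ∈ p) : raised W₀ e₁ e₂ e₃ ≤ p :=
  sInf_le ⟨h₀, h⟩

theorem le_raised : W₀ ≤ raised W₀ e₁ e₂ e₃ :=
  le_sInf fun _ hp => hp.1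

theorem raised_stable {v : W} (hv : v ∈ raised W₀ e₁ e₂ e₃) :
    e₁ v ∈ raised W₀ e₁ e₂ e₃ ∧ e₂ v ∈ raised W₀ e₁ e₂ e₃ ∧ e₃ v ∈ raised W₀ e₁ e₂ e₃ := by
  refine ⟨?_, ?_, ?_⟩ <;> refine Submodule.mem_sInf.2 fun p hp => ?_
  · exact (hp.2 v (Submodule.mem_sInf.1 hv p hp)).1
  · exact (hp.2 v (Submodule.mem_sInf.1 hv p hp)).2.1
  · exact (hp.2 v (Submodule.mem_sInf.1 hv p hp)).2.2

/-- An operator preserves `raised W₀ e₁ e₂ e₃` if it does so on `W₀` and can be moved past the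
raising operators. -/
theorem raised_map_mem {g : Module.End ℂ W} (h₀ : ∀ v ∈ W₀, g v ∈ raised W₀ e₁ e₂ e₃)
    (h : ∀ v ∈ raised W₀ e₁ e₂ e₃, g v ∈ raised W₀ e₁ e₂ e₃ → g (e₁ v) ∈ raised W₀ e₁ e₂ e₃ ∧
      g (e₂ v) ∈ raised W₀ e₁ e₂ e₃ ∧ g (e₃ v) ∈ raised W₀ e₁ e₂ e₃)
    {v : W} (hv : v ∈ raised W₀ e₁ e₂ e₃) : g v ∈ raised W₀ e₁ e₂ e₃ := by
  have : raised W₀ e₁ e₂ e₃ ≤ raised W₀ e₁ e₂ e₃ ⊓ (raised W₀ e₁ e₂ e₃).comap g :=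
    raised_le (fun v hv => ⟨le_raised hv, h₀ v hv⟩) fun v hv => by
      obtain ⟨h1, h2, h3⟩ := raised_stable hv.1
      obtain ⟨k1, k2, k3⟩ := h v hv.1 hv.2
      exact ⟨⟨h1, k1⟩, ⟨h2, k2⟩, ⟨h3, k3⟩⟩
  exact (this hv).2

theorem raised_map_mem_of_comm {g : Module.End ℂ W} {k₁ k₂ k₃ : ℂ} (h₀ : ∀ v ∈ W₀, g v ∈ W₀)
    (h₁ : g * e₁ = k₁ • (e₁ * g)) (h₂ : g * e₂ = k₂ • (e₂ * g)) (h₃ : g * e₃ = k₃ • (e₃ * g))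
    {v : W} (hv : v ∈ raised W₀ e₁ e₂ e₃) : g v ∈ raised W₀ e₁ e₂ e₃ := by
  refine raised_map_mem (fun v hv => le_raised (h₀ v hv)) (fun v _ hg => ?_) hv
  have := raised_stable hg
  refine ⟨?_, ?_, ?_⟩
  · rw [← Module.End.mul_apply, h₁]; exact Submodule.smul_mem _ _ this.1
  · rw [← Module.End.mul_apply, h₂]; exact Submodule.smul_mem _ _ this.2.1
  · rw [← Module.End.mul_apply, h₃]; exact Submodule.smul_mem _ _ this.2.2

/-- Every entry can be moved to the right through the raising entries until it meets `W₀`. The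
correction terms involve only raising entries and entries treated earlier, which dictates the order:
diagonal, then `t₂₁` and `t₃₂`, then `t₃₁`. -/
theorem TriangularRel.raised_stable {q : ℂ} {s u : ZMod 2}
    {t₁₁ t₁₂ t₁₃ t₂₁ t₂₂ t₂₃ t₃₁ t₃₂ t₃₃ : Module.End ℂ W}
    (h : TriangularRel q s u t₁₁ t₁₂ t₁₃ t₂₁ t₂₂ t₂₃ t₃₁ t₃₂ t₃₃)
    (h₁₁ : ∀ v ∈ W₀, t₁₁ v ∈ W₀) (h₂₂ : ∀ v ∈ W₀, t₂₂ v ∈ W₀) (h₃₃ : ∀ v ∈ W₀, t₃₃ v ∈ W₀)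
    (h₂₁ : ∀ v ∈ W₀, t₂₁ v = 0) (h₃₁ : ∀ v ∈ W₀, t₃₁ v = 0) (h₃₂ : ∀ v ∈ W₀, t₃₂ v = 0) :
    ∀ v ∈ raised W₀ t₁₂ t₁₃ t₂₃,
      t₁₁ v ∈ raised W₀ t₁₂ t₁₃ t₂₃ ∧ t₁₂ v ∈ raised W₀ t₁₂ t₁₃ t₂₃ ∧
      t₁₃ v ∈ raised W₀ t₁₂ t₁₃ t₂₃ ∧ t₂₁ v ∈ raised W₀ t₁₂ t₁₃ t₂₃ ∧
      t₂₂ v ∈ raised W₀ t₁₂ t₁₃ t₂₃ ∧ t₂₃ v ∈ raised W₀ t₁₂ t₁₃ t₂₃ ∧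
      t₃₁ v ∈ raised W₀ t₁₂ t₁₃ t₂₃ ∧ t₃₂ v ∈ raised W₀ t₁₂ t₁₃ t₂₃ ∧
      t₃₃ v ∈ raised W₀ t₁₂ t₁₃ t₂₃ := by
  have e12 : ∀ v ∈ raised W₀ t₁₂ t₁₃ t₂₃, t₁₂ v ∈ raised W₀ t₁₂ t₁₃ t₂₃ :=
    fun v hv => (SuperTetra.raised_stable hv).1
  have e13 : ∀ v ∈ raised W₀ t₁₂ t₁₃ t₂₃, t₁₃ v ∈ raised W₀ t₁₂ t₁₃ t₂₃ :=
    fun v hv => (SuperTetra.raised_stable hv).2.1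
  have e23 : ∀ v ∈ raised W₀ t₁₂ t₁₃ t₂₃, t₂₃ v ∈ raised W₀ t₁₂ t₁₃ t₂₃ :=
    fun v hv => (SuperTetra.raised_stable hv).2.2
  have app {f g k : Module.End ℂ W} {c : ℂ} (H : f * g = c • k) (v : W) : f (g v) = c • k v := by
    rw [← Module.End.mul_apply, H, LinearMap.smul_apply]
  have app₂ {f g k l : Module.End ℂ W} {c d : ℂ} (H : f * g = c • k + d • l) (v : W) :
      f (g v) = c • k v + d • l v := by
    rw [← Module.End.mul_apply, H, LinearMap.add_apply, LinearMap.smul_apply, LinearMap.smul_apply]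
  have e11 : ∀ v ∈ raised W₀ t₁₂ t₁₃ t₂₃, t₁₁ v ∈ raised W₀ t₁₂ t₁₃ t₂₃ := fun v hv =>
    raised_map_mem_of_comm h₁₁ h.r11_12 h.r11_13 (h.r11_23.trans (one_smul ℂ _).symm) hv
  have e33 : ∀ v ∈ raised W₀ t₁₂ t₁₃ t₂₃, t₃₃ v ∈ raised W₀ t₁₂ t₁₃ t₂₃ := fun v hv =>
    raised_map_mem_of_comm h₃₃ (h.r33_12.trans (one_smul ℂ _).symm) h.r33_13 h.r33_23 hv
  have e22 : ∀ v ∈ raised W₀ t₁₂ t₁₃ t₂₃, t₂₂ v ∈ raised W₀ t₁₂ t₁₃ t₂₃ := fun v hv =>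
    raised_map_mem (fun v hv => le_raised (h₂₂ v hv)) (fun v hv hg =>
      ⟨by rw [app h.r22_12]; exact Submodule.smul_mem _ _ (e12 _ hg),
       by rw [app₂ ((one_smul ℂ (t₁₃ * t₂₂)).symm ▸ h.r22_13)]
          exact add_mem (Submodule.smul_mem _ _ (e13 _ hg))
            (Submodule.smul_mem _ _ (e12 _ (e23 _ hv))),
       by rw [app h.r22_23]; exact Submodule.smul_mem _ _ (e23 _ hg)⟩) hv
  have e21 : ∀ v ∈ raised W₀ t₁₂ t₁₃ t₂₃, t₂₁ v ∈ raised W₀ t₁₂ t₁₃ t₂₃ := fun v hv =>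
    raised_map_mem (fun v hv => h₂₁ v hv ▸ zero_mem _) (fun v hv hg =>
      ⟨by rw [app₂ h.r21_12]; exact add_mem (Submodule.smul_mem _ _ (e12 _ hg))
            (Submodule.smul_mem _ _ (e11 _ (e22 _ hv))),
       by rw [app₂ h.r21_13]; exact add_mem (Submodule.smul_mem _ _ (e13 _ hg))
            (Submodule.smul_mem _ _ (e11 _ (e23 _ hv))),
       by rw [app h.r21_23]; exact Submodule.smul_mem _ _ (e23 _ hg)⟩) hv
  have e32 : ∀ v ∈ raised W₀ t₁₂ t₁₃ t₂₃, t₃₂ v ∈ raised W₀ t₁₂ t₁₃ t₂₃ := fun v hv =>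
    raised_map_mem (fun v hv => h₃₂ v hv ▸ zero_mem _) (fun v hv hg =>
      ⟨by rw [app h.r32_12]; exact Submodule.smul_mem _ _ (e12 _ hg),
       by rw [app₂ h.r32_13]; exact add_mem (Submodule.smul_mem _ _ (e13 _ hg))
            (Submodule.smul_mem _ _ (e12 _ (e33 _ hv))),
       by rw [app₂ h.r32_23]; exact add_mem (Submodule.smul_mem _ _ (e23 _ hg))
            (Submodule.smul_mem _ _ (e22 _ (e33 _ hv)))⟩) hv
  have e31 : ∀ v ∈ raised W₀ t₁₂ t₁₃ t₂₃, t₃₁ v ∈ raised W₀ t₁₂ t₁₃ t₂₃ := fun v hv =>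
    raised_map_mem (fun v hv => h₃₁ v hv ▸ zero_mem _) (fun v hv hg =>
      ⟨by rw [app₂ h.r31_12]; exact add_mem (Submodule.smul_mem _ _ (e12 _ hg))
            (Submodule.smul_mem _ _ (e11 _ (e32 _ hv))),
       by rw [app₂ h.r31_13]; exact add_mem (Submodule.smul_mem _ _ (e13 _ hg))
            (Submodule.smul_mem _ _ (e11 _ (e33 _ hv))),
       by rw [app₂ h.r31_23]; exact add_mem (Submodule.smul_mem _ _ (e23 _ hg))
            (Submodule.smul_mem _ _ (e21 _ (e33 _ hv)))⟩) hv
  exact fun v hv => ⟨e11 v hv, e12 v hv, e13 v hv, e21 v hv, e22 v hv, e23 v hv, e31 v hv,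
    e32 v hv, e33 v hv⟩

/-- The span of the images of `p` under the powers of `e`. -/
def powSum (e : Module.End ℂ W) (p : Submodule ℂ W) : Submodule ℂ W := ⨆ n : ℕ, p.map (e ^ n)

theorem le_powSum (e : Module.End ℂ W) (p : Submodule ℂ W) : p ≤ powSum e p := fun v hv =>
  Submodule.mem_iSup_of_mem 0 ⟨v, hv, by simp⟩

theorem powSum_map_mem_of_comm {e g : Module.End ℂ W} {p : Submodule ℂ W} {k : ℂ}
    (hp : ∀ v ∈ p, g v ∈ p) (h : g * e = k • (e * g)) :
    ∀ v ∈ powSum e p, g v ∈ powSum e p := by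
  have hn (n : ℕ) : g * e ^ n = k ^ n • (e ^ n * g) := by
    induction n with
    | zero => simp
    | succ n ih => rw [pow_succ, ← mul_assoc, ih, smul_mul_assoc, mul_assoc, h, mul_smul_comm,
        smul_smul, pow_succ, mul_assoc]
  intro v hv
  change v ∈ (powSum e p).comap g
  refine (iSup_le fun n => ?_ : powSum e p ≤ (powSum e p).comap g) hv
  rintro _ ⟨v, hv, rfl⟩
  rw [Submodule.mem_comap, ← Module.End.mul_apply, hn]
  exact Submodule.smul_mem _ _ (Submodule.mem_iSup_of_mem n ⟨g v, hp v hv, rfl⟩)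

theorem powSum_map_mem (e : Module.End ℂ W) (p : Submodule ℂ W) :
    ∀ v ∈ powSum e p, e v ∈ powSum e p := by
  intro v hv
  refine (iSup_le fun n => ?_ : powSum e p ≤ (powSum e p).comap e) hv
  rintro _ ⟨v, hv, rfl⟩
  rw [Submodule.mem_comap, ← Module.End.mul_apply, ← pow_succ']
  exact Submodule.mem_iSup_of_mem (n + 1) ⟨v, hv, rfl⟩

theorem exists_of_mem_powSum {e : Module.End ℂ W} {p : Submodule ℂ W} {v : W}
    (hv : v ∈ powSum e p) :
    ∃ (N : ℕ) (f : ℕ → W), (∀ n, f n ∈ p) ∧ v = ∑ n ∈ Finset.range N, (e ^ n) (f n) := by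
  obtain ⟨f, hf, rfl⟩ := (Submodule.mem_iSup_iff_exists_finsupp _ _).1 hv
  choose g hg hge using hf
  refine ⟨f.support.sup id + 1, g, hg, ?_⟩
  simp only [hge]
  exact Finset.sum_subset (fun n hn => Finset.mem_range_succ_iff.2 (Finset.le_sup (f := id) hn))
    fun n _ hn => Finsupp.notMem_support_iff.1 hn

theorem exists_of_mem_powSum_of_sq {e : Module.End ℂ W} (he : e * e = 0) {p : Submodule ℂ W}
    {v : W} (hv : v ∈ powSum e p) :
    ∃ f : ℕ → W, (∀ n, f n ∈ p) ∧ v = ∑ n ∈ Finset.range 2, (e ^ n) (f n) := by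
  let S : Submodule ℂ W := p ⊔ p.map e
  have hS : powSum e p ≤ S := by
    refine iSup_le fun n => ?_
    match n with
    | 0 => rintro _ ⟨v, hv, rfl⟩; exact Submodule.mem_sup_left (by simpa using hv)
    | 1 => rintro _ ⟨v, hv, rfl⟩; exact Submodule.mem_sup_right ⟨v, hv, by simp⟩
    | n + 2 =>
      rintro _ ⟨v, hv, rfl⟩
      rw [pow_add, pow_two, he, mul_zero]
      exact zero_mem _
  obtain ⟨x, hx, _, ⟨y, hy, rfl⟩, rfl⟩ := Submodule.mem_sup.1 (hS hv)
  refine ⟨fun n => if n = 0 then x else y, fun n => ?_, ?_⟩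
  · dsimp only; split_ifs
    exacts [hx, hy]
  · simp [Finset.sum_range_succ]

/-- Under the three ordering relations the raised subspace is spanned by ordered monomials. -/
theorem raised_le_powSum {k₁ k₂ k₃ : ℂ} (h₁ : e₁ * e₂ = k₁ • (e₂ * e₁))
    (h₂ : e₃ * e₂ = k₂ • (e₂ * e₃)) (h₃ : e₃ * e₁ = k₃ • (e₁ * e₃)) :
    raised W₀ e₁ e₂ e₃ ≤ powSum e₂ (powSum e₁ (powSum e₃ W₀)) :=
  raised_le ((le_powSum _ _).trans ((le_powSum _ _).trans (le_powSum _ _))) fun v hv =>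
    ⟨powSum_map_mem_of_comm (powSum_map_mem _ _) h₁ v hv, powSum_map_mem _ _ v hv,
      powSum_map_mem_of_comm (powSum_map_mem_of_comm (powSum_map_mem _ _) h₃) h₂ v hv⟩

end Raising

/-! ### Lowering operators and ladder coefficients. -/

section Lowering

variable {V : Type*} [AddCommGroup V] [Module ℂ V]

/-- The coefficients of `C Bⁿ⁺¹ = ladder e k n • Bⁿ H` on the kernel of `C`, if
`C B = e • B C + H` and `H B = k • B H`. -/
def ladder (e k : ℂ) : ℕ → ℂ
  | 0 => 1
  | n + 1 => e * ladder e k n + k ^ (n + 1)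

theorem ladder_one (k : ℂ) (n : ℕ) : ladder 1 k n = ∑ i ∈ Finset.range (n + 1), k ^ i := by
  induction n with
  | zero => simp [ladder]
  | succ n ih => rw [ladder, ih, one_mul, Finset.sum_range_succ _ (n + 1)]

theorem ladder_one_ne_zero {k : ℂ} (hk : ∀ n : ℕ, 0 < n → k ^ n ≠ 1) (n : ℕ) :
    ladder 1 k n ≠ 0 := by
  intro h
  have := geom_sum_mul k (n + 1)
  rw [← ladder_one, h, zero_mul] at this
  exact hk (n + 1) n.succ_pos (sub_eq_zero.1 this.symm)

variable {B C H : Module.End ℂ V} {e k l : ℂ}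

theorem lower_pow (hCB : C * B = e • (B * C) + H) (hHB : H * B = k • (B * H)) {v : V}
    (hv : C v = 0) (n : ℕ) : C ((B ^ (n + 1)) v) = ladder e k n • (B ^ n) (H v) := by
  have hHn (n : ℕ) : H * B ^ n = k ^ n • (B ^ n * H) := by
    induction n with
    | zero => simp
    | succ n ih => rw [pow_succ, ← mul_assoc, ih, smul_mul_assoc, mul_assoc, hHB, mul_smul_comm,
        smul_smul, pow_succ, mul_assoc]
  induction n with
  | zero =>
    rw [zero_add, pow_one, ← Module.End.mul_apply, hCB]
    simp [hv, ladder]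
  | succ n ih =>
    rw [pow_succ', Module.End.mul_apply, ← Module.End.mul_apply, hCB, LinearMap.add_apply,
      LinearMap.smul_apply, Module.End.mul_apply, ih, ← Module.End.mul_apply H, hHn, ladder,
      map_smul, ← Module.End.mul_apply B, ← pow_succ', smul_smul, LinearMap.smul_apply,
      Module.End.mul_apply, add_smul]

/-- Applying `C` turns the sum into a shorter one of the same kind, with the vectors `ladder e k n •
H (f (n + 1))`, which again lie in the kernel of `C`. Induction on the length and injectivity of `H`
remove all terms but the first, and the sum itself then removes the first. -/
theorem lower_sum_eq_zero (hCB : C * B = e • (B * C) + H) (hHB : H * B = k • (B * H))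
    (hCH : C * H = l • (H * C)) (hH : Function.Injective H) (N : ℕ)
    (hN : ∀ n, n + 1 < N → ladder e k n ≠ 0) (f : ℕ → V) (hf : ∀ n, C (f n) = 0)
    (hsum : ∑ n ∈ Finset.range N, (B ^ n) (f n) = 0) : ∀ n < N, f n = 0 := by
  induction N generalizing f with
  | zero => simp
  | succ N ih =>
    have h1 := congrArg C hsum
    rw [Finset.sum_range_succ', map_add, map_sum, map_zero, pow_zero, Module.End.one_apply, hf,
      add_zero] at h1
    simp only [lower_pow hCB hHB (hf _)] at h1
    have h2 := ih (fun n hn => hN n (by omega)) (fun n => ladder e k n • H (f (n + 1)))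
      (fun n => by
        rw [map_smul, ← Module.End.mul_apply, hCH, LinearMap.smul_apply, Module.End.mul_apply, hf]
        simp) (by simpa only [map_smul] using h1)
    have h3 (n : ℕ) (hn : n < N) : f (n + 1) = 0 := by
      have := (smul_eq_zero.1 (h2 n hn)).resolve_left (hN n (by omega))
      exact hH (by rw [this, map_zero])
    intro n hn
    match n with
    | 0 =>
      rw [Finset.sum_range_succ', Finset.sum_eq_zero (fun i hi => by
        rw [h3 i (Finset.mem_range.1 hi), map_zero]), zero_add] at hsum
      simpa using hsum
    | n + 1 => exact h3 n (by omega)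

/-- A subspace of `V × V` on which the first component determines the second keeps this property
if one applies the powers of a raising operator `(B, B')`. -/
theorem powSum_prodMap_graph {B' : Module.End ℂ V} {p : Submodule ℂ (V × V)}
    (hp : ∀ v ∈ p, v.1 = 0 → v.2 = 0) (hpC : ∀ v ∈ p, C v.1 = 0)
    (hCB : C * B = e • (B * C) + H) (hHB : H * B = k • (B * H))
    (hCH : C * H = l • (H * C)) (hH : Function.Injective H)
    (hcase : (∀ n, ladder e k n ≠ 0) ∨ (B * B = 0 ∧ B' * B' = 0)) :
    ∀ v ∈ powSum (B.prodMap B') p, v.1 = 0 → v.2 = 0 := by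
  have pow_fst (n : ℕ) (w : V × V) : ((B.prodMap B' ^ n) w).1 = (B ^ n) w.1 := by
    induction n generalizing w with
    | zero => simp
    | succ n ih => simp [pow_succ, ih]
  have pow_snd (n : ℕ) (w : V × V) : ((B.prodMap B' ^ n) w).2 = (B' ^ n) w.2 := by
    induction n generalizing w with
    | zero => simp
    | succ n ih => simp [pow_succ, ih]
  have key (N : ℕ) (hN : ∀ n, n + 1 < N → ladder e k n ≠ 0) (f : ℕ → V × V) (hf : ∀ n, f n ∈ p)
      (h : (∑ n ∈ Finset.range N, (B.prodMap B' ^ n) (f n)).1 = 0) :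
      (∑ n ∈ Finset.range N, (B.prodMap B' ^ n) (f n)).2 = 0 := by
    rw [Prod.fst_sum] at h
    rw [Prod.snd_sum]
    simp only [pow_fst, pow_snd] at h ⊢
    have := lower_sum_eq_zero hCB hHB hCH hH N hN (fun n => (f n).1) (fun n => hpC _ (hf n)) h
    exact Finset.sum_eq_zero fun n hn => by
      rw [hp _ (hf n) (this n (Finset.mem_range.1 hn)), map_zero]
  intro v hv h
  rcases hcase with hl | ⟨hB, hB'⟩
  · obtain ⟨N, f, hf, rfl⟩ := exists_of_mem_powSum hv
    exact key N (fun n _ => hl n) f hf h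
  · obtain ⟨f, hf, rfl⟩ := exists_of_mem_powSum_of_sq (by
      rw [LinearMap.prodMap_mul, hB, hB', LinearMap.prodMap_zero]) hv
    -- When the raising operators square to zero, only `ladder e k 0 = 1` occurs.
    refine key 2 (fun n hn => ?_) f hf h
    obtain rfl : n = 0 := by omega
    simp [ladder]

end Lowering

/-! ### Monodromy matrices and their inverses. -/

section BlockMatrices

variable {E : Type*} [Ring E]

/-- The coefficients placed in the block `α ⊕ β`. -/
def Quad.αβ (x : Quad E) : Matrix (Fin 3) (Fin 3) E := !![x.a, x.b, 0; x.c, x.d, 0; 0, 0, 1]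

/-- The coefficients placed in the block `α ⊕ γ`. -/
def Quad.αγ (x : Quad E) : Matrix (Fin 3) (Fin 3) E := !![x.a, 0, x.b; 0, 1, 0; x.c, 0, x.d]

/-- The coefficients placed in the block `β ⊕ γ`. -/
def Quad.βγ (x : Quad E) : Matrix (Fin 3) (Fin 3) E := !![1, 0, 0; 0, x.a, x.b; 0, x.c, x.d]

/-- The monodromy matrix `X_{αβ} X_{αγ} X_{βγ}`. -/
def monL (x y z : Quad E) : Matrix (Fin 3) (Fin 3) E :=
  !![x.a * y.a, x.b * z.a + x.a * y.b * z.c, x.b * z.b + x.a * y.b * z.d;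
     x.c * y.a, x.d * z.a + x.c * y.b * z.c, x.d * z.b + x.c * y.b * z.d;
     y.c, y.d * z.c, y.d * z.d]

/-- The monodromy matrix `X_{βγ} X_{αγ} X_{αβ}`. -/
def monR (x y z : Quad E) : Matrix (Fin 3) (Fin 3) E :=
  !![y.a * x.a, y.a * x.b, y.b;
     z.b * y.c * x.a + z.a * x.c, z.b * y.c * x.b + z.a * x.d, z.b * y.d;
     z.d * y.c * x.a + z.c * x.c, z.d * y.c * x.b + z.c * x.d, z.d * y.d]

theorem mul_eq_monL (x y z : Quad E) : x.αβ * y.αγ * z.βγ = monL x y z := by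
  ext i j
  fin_cases i <;> fin_cases j <;>
    simp [Quad.αβ, Quad.αγ, Quad.βγ, monL, Matrix.mul_apply, Fin.sum_univ_three]

theorem mul_eq_monR (x y z : Quad E) : z.βγ * y.αγ * x.αβ = monR x y z := by
  ext i j
  fin_cases i <;> fin_cases j <;>
    simp [Quad.αβ, Quad.αγ, Quad.βγ, monR, Matrix.mul_apply, Fin.sum_univ_three]

/-- `y` is the two-sided inverse of `x` as a 2×2 matrix. -/
structure Quad.IsInv (x y : Quad E) : Prop where
  h₁₁ : x.a * y.a + x.b * y.c = 1
  h₁₂ : x.a * y.b + x.b * y.d = 0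
  h₂₁ : x.c * y.a + x.d * y.c = 0
  h₂₂ : x.c * y.b + x.d * y.d = 1
  k₁₁ : y.a * x.a + y.b * x.c = 1
  k₁₂ : y.a * x.b + y.b * x.d = 0
  k₂₁ : y.c * x.a + y.d * x.c = 0
  k₂₂ : y.c * x.b + y.d * x.d = 1

theorem Quad.IsInv.symm {x y : Quad E} (h : x.IsInv y) : y.IsInv x :=
  ⟨h.k₁₁, h.k₁₂, h.k₂₁, h.k₂₂, h.h₁₁, h.h₁₂, h.h₂₁, h.h₂₂⟩

theorem Quad.IsInv.αβ_mul {x y : Quad E} (h : x.IsInv y) : x.αβ * y.αβ = 1 := by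
  ext i j
  fin_cases i <;> fin_cases j <;>
    simp [Quad.αβ, Matrix.mul_apply, Fin.sum_univ_three, h.h₁₁, h.h₁₂, h.h₂₁, h.h₂₂]

theorem Quad.IsInv.αγ_mul {x y : Quad E} (h : x.IsInv y) : x.αγ * y.αγ = 1 := by
  ext i j
  fin_cases i <;> fin_cases j <;>
    simp [Quad.αγ, Matrix.mul_apply, Fin.sum_univ_three, h.h₁₁, h.h₁₂, h.h₂₁, h.h₂₂]

theorem Quad.IsInv.βγ_mul {x y : Quad E} (h : x.IsInv y) : x.βγ * y.βγ = 1 := by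
  ext i j
  fin_cases i <;> fin_cases j <;>
    simp [Quad.βγ, Matrix.mul_apply, Fin.sum_univ_three, h.h₁₁, h.h₁₂, h.h₂₁, h.h₂₂]

theorem monL_mul_monR {x y z x' y' z' : Quad E} (hx : x.IsInv x') (hy : y.IsInv y')
    (hz : z.IsInv z') : monL x y z * monR x' y' z' = 1 := by
  rw [← mul_eq_monL, ← mul_eq_monR]
  calc x.αβ * y.αγ * z.βγ * (z'.βγ * y'.αγ * x'.αβ)
      = x.αβ * (y.αγ * (z.βγ * z'.βγ) * y'.αγ) * x'.αβ := by simp only [mul_assoc]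
    _ = 1 := by rw [hz.βγ_mul, mul_one, hy.αγ_mul, mul_one, hx.αβ_mul]

theorem monR_mul_monL {x y z x' y' z' : Quad E} (hx : x.IsInv x') (hy : y.IsInv y')
    (hz : z.IsInv z') : monR x y z * monL x' y' z' = 1 := by
  rw [← mul_eq_monL, ← mul_eq_monR]
  calc z.βγ * y.αγ * x.αβ * (x'.αβ * y'.αγ * z'.βγ)
      = z.βγ * (y.αγ * (x.αβ * x'.αβ) * y'.αγ) * z'.βγ := by simp only [mul_assoc]
    _ = 1 := by rw [hx.αβ_mul, mul_one, hy.αγ_mul, mul_one, hz.βγ_mul]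

end BlockMatrices

theorem mul_mul_of_eq {E : Type*} [Ring E] {x y u : E} (h : x * y = u) (z : E) :
    x * (y * z) = u * z := by
  rw [← mul_assoc, h]

section Units

variable {E : Type*} [Ring E] [Algebra ℂ E]

theorem mul_mul_of_eq_smul {x y u : E} {k : ℂ} (h : x * y = k • u) (z : E) :
    x * (y * z) = k • (u * z) := by
  rw [← mul_assoc, h, smul_mul_assoc]

theorem inv_mul_of_comm {a : Eˣ} {b : E} {k : ℂ} (hk : k ≠ 0) (h : ↑a * b = k • (b * a)) :
    ↑a⁻¹ * b = k⁻¹ • (b * ↑a⁻¹) := by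
  rw [Units.inv_mul_eq_iff_eq_mul, mul_smul_comm, ← mul_assoc, h, smul_mul_assoc, mul_assoc,
    Units.mul_inv, mul_one, smul_smul, inv_mul_cancel₀ hk, one_smul]

theorem mul_inv_of_comm {a : Eˣ} {b : E} {k : ℂ} (hk : k ≠ 0) (h : b * ↑a = k • (↑a * b)) :
    b * ↑a⁻¹ = k⁻¹ • (↑a⁻¹ * b) := by
  rw [Units.mul_inv_eq_iff_eq_mul, smul_mul_assoc, mul_assoc, h, mul_smul_comm, ← mul_assoc,
    Units.inv_mul, one_mul, smul_smul, inv_mul_cancel₀ hk, one_smul]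

end Units

theorem sg_ne_zero (s : ZMod 2) : sg s ≠ 0 := by
  unfold sg; split_ifs <;> simp

theorem qp_ne_zero {q : ℂ} (hq : q ≠ 0) (s : ZMod 2) : qp q s ≠ 0 := by
  unfold qp; split_ifs <;> simp [hq]

/-! ### Fock representations of three supercommuting problems. -/

section Fock

variable {V : Type*} [AddCommGroup V] [Module ℂ V]

/-- The common kernel of the lowering operators. -/
def vac (x y z : Quad (Module.End ℂ V)) : Submodule ℂ V :=
  LinearMap.ker x.c ⊓ LinearMap.ker y.c ⊓ LinearMap.ker z.c

/-- A representation of three supercommuting local problems that is generated by the vectors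
which are killed by the lowering operators. -/
structure FockRep (q : ℂ) (s u : ZMod 2) (x y z : Quad (Module.End ℂ V)) : Prop where
  rel : TripleRel q s u x y z
  x_a : IsUnit x.a
  x_d : IsUnit x.d
  y_a : IsUnit y.a
  y_d : IsUnit y.d
  z_a : IsUnit z.a
  z_d : IsUnit z.d
  gen : ∀ p : Submodule ℂ V, vac x y z ≤ p → (∀ v ∈ p, x.b v ∈ p) → (∀ v ∈ p, y.b v ∈ p) →
    (∀ v ∈ p, z.b v ∈ p) → p = ⊤

theorem ker_map_mem {C G : Module.End ℂ V} {k : ℂ} (h : C * G = k • (G * C)) {v : V}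
    (hv : C v = 0) : C (G v) = 0 := by
  rw [← Module.End.mul_apply, h, LinearMap.smul_apply, Module.End.mul_apply, hv, map_zero,
    smul_zero]

variable {q : ℂ} {s u : ZMod 2} {x y z : Quad (Module.End ℂ V)}

theorem mem_vac {v : V} : v ∈ vac x y z ↔ x.c v = 0 ∧ y.c v = 0 ∧ z.c v = 0 := by
  simp [vac, and_assoc]

theorem vac_map_mem {G : Module.End ℂ V} {k₁ k₂ k₃ : ℂ} (h₁ : x.c * G = k₁ • (G * x.c))
    (h₂ : y.c * G = k₂ • (G * y.c)) (h₃ : z.c * G = k₃ • (G * z.c)) :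
    ∀ v ∈ vac x y z, G v ∈ vac x y z := by
  intro v hv
  rw [mem_vac] at hv ⊢
  exact ⟨ker_map_mem h₁ hv.1, ker_map_mem h₂ hv.2.1, ker_map_mem h₃ hv.2.2⟩

/-- The module is generated by `x.b`, `y.b`, `z.b`, whereas the raising entries of `monR` are `y.a *
x.b`, `y.b`, `z.b * y.d`. The factors `y.a` and `y.d` can be stripped off, since their inverses
commute up to scalars with the raising entries and preserve the vacuum. -/
theorem raised_vac_eq_top (hq : q ≠ 0) (F : FockRep q s u x y z) :
    raised (vac x y z) (y.a * x.b) y.b (z.b * y.d) = ⊤ := by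
  obtain ⟨a, ha⟩ := F.y_a
  obtain ⟨d, hd⟩ := F.y_d
  have h := F.rel
  have hqu := qp_ne_zero hq u
  have hq0 : qp q 0 ≠ 0 := qp_ne_zero hq 0
  have inv_a : ∀ v ∈ raised (vac x y z) (y.a * x.b) y.b (z.b * y.d),
      (↑a⁻¹ : Module.End ℂ V) v ∈ raised (vac x y z) (y.a * x.b) y.b (z.b * y.d) := by
    have e1 : (↑a⁻¹ : Module.End ℂ V) * x.b = (1 : ℂ)⁻¹ • (x.b * ↑a⁻¹) :=
      inv_mul_of_comm one_ne_zero (by rw [ha, one_smul, h.cross₁₂.ab])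
    have e2 : (↑a⁻¹ : Module.End ℂ V) * y.b = (qp q 0)⁻¹ • (y.b * ↑a⁻¹) :=
      inv_mul_of_comm hq0 (by rw [ha, h.rel₂.ab])
    have e3 : (↑a⁻¹ : Module.End ℂ V) * z.b = (1 : ℂ)⁻¹ • (z.b * ↑a⁻¹) :=
      inv_mul_of_comm one_ne_zero (by rw [ha, one_smul, h.cross₂₃.ba])
    have e4 : (↑a⁻¹ : Module.End ℂ V) * y.d = (1 : ℂ)⁻¹ • (y.d * ↑a⁻¹) :=
      inv_mul_of_comm one_ne_zero (by rw [ha, one_smul, h.rel₂.da])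
    have c1 : x.c * (↑a⁻¹ : Module.End ℂ V) = (1 : ℂ)⁻¹ • (↑a⁻¹ * x.c) :=
      mul_inv_of_comm one_ne_zero (by rw [ha, one_smul, h.cross₁₂.ac])
    have c2 : y.c * (↑a⁻¹ : Module.End ℂ V) = (qp q 0)⁻¹ • (↑a⁻¹ * y.c) :=
      mul_inv_of_comm hq0 (by rw [ha, h.rel₂.ca])
    have c3 : z.c * (↑a⁻¹ : Module.End ℂ V) = (1 : ℂ)⁻¹ • (↑a⁻¹ * z.c) :=
      mul_inv_of_comm one_ne_zero (by rw [ha, one_smul, h.cross₂₃.ca])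
    intro v hv
    refine raised_map_mem_of_comm (vac_map_mem c1 c2 c3) (k₁ := 1) ?_ e2 (k₃ := 1) ?_ hv
    · rw [← ha, ← mul_assoc, Units.inv_mul, one_mul, mul_assoc, ← one_smul ℂ (x.b * _),
        ← inv_one, ← e1, ← mul_assoc, Units.mul_inv, one_mul, inv_one, one_smul]
    · rw [← mul_assoc, e3, inv_one, one_smul, mul_assoc, e4, inv_one, one_smul, one_smul,
        mul_assoc]
  have inv_d : ∀ v ∈ raised (vac x y z) (y.a * x.b) y.b (z.b * y.d),
      (↑d⁻¹ : Module.End ℂ V) v ∈ raised (vac x y z) (y.a * x.b) y.b (z.b * y.d) := by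
    have e1 : (↑d⁻¹ : Module.End ℂ V) * x.b = (1 : ℂ)⁻¹ • (x.b * ↑d⁻¹) :=
      inv_mul_of_comm one_ne_zero (by rw [hd, one_smul, h.cross₁₂.db])
    have e2 : (↑d⁻¹ : Module.End ℂ V) * y.b = (qp q u)⁻¹ • (y.b * ↑d⁻¹) :=
      inv_mul_of_comm hqu (by rw [hd, h.rel₂.db])
    have e3 : (↑d⁻¹ : Module.End ℂ V) * z.b = (1 : ℂ)⁻¹ • (z.b * ↑d⁻¹) :=
      inv_mul_of_comm one_ne_zero (by rw [hd, one_smul, h.cross₂₃.bd])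
    have e4 : (↑d⁻¹ : Module.End ℂ V) * y.a = (1 : ℂ)⁻¹ • (y.a * ↑d⁻¹) :=
      inv_mul_of_comm one_ne_zero (by rw [hd, one_smul, h.rel₂.da])
    have c1 : x.c * (↑d⁻¹ : Module.End ℂ V) = (1 : ℂ)⁻¹ • (↑d⁻¹ * x.c) :=
      mul_inv_of_comm one_ne_zero (by rw [hd, one_smul, h.cross₁₂.dc])
    have c2 : y.c * (↑d⁻¹ : Module.End ℂ V) = (qp q u)⁻¹ • (↑d⁻¹ * y.c) :=
      mul_inv_of_comm hqu (by rw [hd, h.rel₂.cd])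
    have c3 : z.c * (↑d⁻¹ : Module.End ℂ V) = (1 : ℂ)⁻¹ • (↑d⁻¹ * z.c) :=
      mul_inv_of_comm one_ne_zero (by rw [hd, one_smul, h.cross₂₃.cd])
    intro v hv
    refine raised_map_mem_of_comm (vac_map_mem c1 c2 c3) (k₁ := 1) ?_ e2 (k₃ := 1) ?_ hv
    · rw [← mul_assoc, e4, inv_one, one_smul, mul_assoc, e1, inv_one, one_smul, one_smul,
        mul_assoc]
    · rw [← mul_assoc, e3, inv_one, one_smul, mul_assoc, ← hd, Units.inv_mul, one_smul,
        mul_assoc, Units.mul_inv]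
  refine F.gen _ le_raised (fun v hv => ?_) (fun v hv => (raised_stable hv).2.1) fun v hv => ?_
  · have := inv_a _ (raised_stable hv).1
    rwa [← Module.End.mul_apply, ← mul_assoc, ← ha, Units.inv_mul, one_mul, ha] at this
  · have := (raised_stable (inv_d _ hv)).2.2
    rwa [← Module.End.mul_apply, mul_assoc, ← hd, Units.mul_inv, mul_one, hd] at this

/-- The fixed vectors of `S` contain the vacuum and are stable under the raising entries of `monR`,
which generate everything. -/
theorem FockRep.eq_one (hq : q ≠ 0) (F : FockRep q s u x y z) {S : Module.End ℂ V}
    (hS : ∀ v ∈ vac x y z, S v = v) (h : ∀ i j, S * monR x y z i j = monR x y z i j * S) :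
    S = 1 := by
  have h12 : S * (y.a * x.b) = y.a * x.b * S := h 0 1
  have h13 : S * y.b = y.b * S := h 0 2
  have h23 : S * (z.b * y.d) = z.b * y.d * S := h 1 2
  have : raised (vac x y z) (y.a * x.b) y.b (z.b * y.d) ≤ LinearMap.ker (S - 1) := by
    refine raised_le (fun v hv => by simp [hS v hv]) fun v hv => ?_
    simp only [LinearMap.mem_ker, LinearMap.sub_apply, Module.End.one_apply, sub_eq_zero] at hv ⊢
    refine ⟨?_, ?_, ?_⟩
    · rw [← Module.End.mul_apply, h12, Module.End.mul_apply, hv]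
    · rw [← Module.End.mul_apply, h13, Module.End.mul_apply, hv]
    · rw [← Module.End.mul_apply, h23, Module.End.mul_apply, hv]
  rw [raised_vac_eq_top hq F, top_le_iff, LinearMap.ker_eq_top, sub_eq_zero] at this
  exact this

end Fock

theorem qp_mul_self_ne_one {q : ℂ} (hroot : ∀ n : ℕ, 0 < n → q ^ n ≠ 1) (s : ZMod 2) (n : ℕ)
    (hn : 0 < n) : (qp q s * qp q s) ^ n ≠ 1 := by
  unfold qp
  split_ifs
  · rw [← pow_two, ← pow_mul]; exact hroot _ (by omega)
  · rw [← mul_inv, inv_pow, ← pow_two, ← pow_mul, ne_eq, inv_eq_one]; exact hroot _ (by omega)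

theorem qp_sub_inv_ne_zero {q : ℂ} (hq : q ≠ 0) (hroot : ∀ n : ℕ, 0 < n → q ^ n ≠ 1)
    (s : ZMod 2) : qp q s - (qp q s)⁻¹ ≠ 0 := by
  intro h
  refine qp_mul_self_ne_one hroot s 1 one_pos ?_
  rw [pow_one]
  nth_rewrite 1 [sub_eq_zero.1 h]
  exact inv_mul_cancel₀ (qp_ne_zero hq s)

theorem ladder_cases {q : ℂ} (hroot : ∀ n : ℕ, 0 < n → q ^ n ≠ 1) (s t : ZMod 2) :
    s ≠ t ∨ ∀ n, ladder (sg (s + t)) (qp q s * qp q t) n ≠ 0 := by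
  by_cases h : s = t
  · subst h
    right
    rw [show s + s = 0 from CharTwo.add_self_eq_zero s, show sg 0 = 1 from rfl]
    exact ladder_one_ne_zero (qp_mul_self_ne_one hroot s)
  · exact Or.inl h

/-! ### The operator that intertwines the two monodromy matrices. -/

section Intertwiner

variable {V : Type*} [AddCommGroup V] [Module ℂ V] {q : ℂ} {s u : ZMod 2}
  {x y z : Quad (Module.End ℂ V)}

/-- The diagonal copy of a subspace in `V × V`. -/
def diag (p : Submodule ℂ V) : Submodule ℂ (V × V) := p.map (LinearMap.id.prod LinearMap.id)

theorem mem_diag {p : Submodule ℂ V} {w : V × V} : w ∈ diag p ↔ w.1 ∈ p ∧ w.2 = w.1 := by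
  constructor
  · rintro ⟨v, hv, rfl⟩; exact ⟨hv, rfl⟩
  · rintro ⟨h, h'⟩; exact ⟨w.1, h, Prod.ext rfl h'.symm⟩

theorem injective_smul_of_isUnit {g : Module.End ℂ V} (hg : IsUnit g) {k : ℂ} (hk : k ≠ 0) :
    Function.Injective (k • g) := by
  have := (Module.End.isUnit_iff g).1 hg
  intro v w h
  exact this.1 (smul_right_injective V hk h)

/-- The subspace of `V × V` generated by the diagonal vacuum vectors under the entries of the
two monodromy matrices. -/
def corr (x y z : Quad (Module.End ℂ V)) : Submodule ℂ (V × V) :=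
  raised (diag (vac x y z)) ((y.a * x.b).prodMap (x.b * z.a + x.a * y.b * z.c))
    (y.b.prodMap (x.b * z.b + x.a * y.b * z.d)) ((z.b * y.d).prodMap (x.d * z.b + x.c * y.b * z.d))

/-- The relations hold for both matrices with the same coefficients, hence for pairs of entries
acting componentwise on `V × V`. -/
theorem corr_triangular (hq : q ≠ 0) (h : TripleRel q s u x y z) :
    TriangularRel q s u ((y.a * x.a).prodMap (x.a * y.a))
    ((y.a * x.b).prodMap (x.b * z.a + x.a * y.b * z.c))
    (y.b.prodMap (x.b * z.b + x.a * y.b * z.d))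
    ((z.b * y.c * x.a + z.a * x.c).prodMap (x.c * y.a))
    ((z.b * y.c * x.b + z.a * x.d).prodMap (x.d * z.a + x.c * y.b * z.c))
    ((z.b * y.d).prodMap (x.d * z.b + x.c * y.b * z.d))
    ((z.d * y.c * x.a + z.c * x.c).prodMap y.c)
    ((z.d * y.c * x.b + z.c * x.d).prodMap (y.d * z.c))
    ((z.d * y.d).prodMap (y.d * z.d)) :=
  ((h.triangular hq).2.prod (h.triangular hq).1).map (LinearMap.prodMapAlgHom ℂ V V)

/-- The subspace is spanned by ordered monomials in three raising pairs applied to diagonal vacuum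
vectors, so it arises in three layers of powers. In the first component the raising operators are
monomials in the coefficients, and `z.c`, `x.c`, `y.c` lower one layer each; each of them kills the
first components of everything below its own layer. Since nonzero ladder coefficients let one
recover the summands from the first component, the graph property passes from each layer to the
next. -/
theorem corr_graph (hq : q ≠ 0) (hroot : ∀ n : ℕ, 0 < n → q ^ n ≠ 1)
    (F : FockRep q s u x y z) : ∀ v ∈ corr x y z, v.1 = 0 → v.2 = 0 := by
  have h := F.rel
  have T := corr_triangular hq h
  obtain ⟨TL, TR⟩ := h.triangular hq
  intro v hv
  have hv' := raised_le_powSum T.r12_13 T.r23_13 T.r23_12 hv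
  -- the first components of the three layers are killed by the lowering operators
  have hCz (w : V × V) (hw : w ∈ diag (vac x y z)) : z.c w.1 = 0 :=
    (mem_vac.1 (mem_diag.1 hw).1).2.2
  have layer {B B' C : Module.End ℂ V} {k : ℂ} {p : Submodule ℂ (V × V)}
      (hp : ∀ w ∈ p, C w.1 = 0) (hC : C * B = k • (B * C)) :
      ∀ w ∈ powSum (B.prodMap B') p, C w.1 = 0 := by
    intro w hw
    have : powSum (B.prodMap B') p ≤ LinearMap.ker (C ∘ₗ LinearMap.fst ℂ V V) := by
      refine iSup_le fun n => ?_
      rintro _ ⟨w, hw, rfl⟩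
      induction n with
      | zero => simpa using hp w hw
      | succ n ih =>
        rw [pow_succ', Module.End.mul_apply]
        simp only [LinearMap.mem_ker, LinearMap.comp_apply, LinearMap.fst_apply,
          LinearMap.prodMap_apply] at ih ⊢
        exact ker_map_mem hC ih
    exact this hw
  have assoc {a b c : Module.End ℂ V} {k l : ℂ} (h₁ : a * b = k • (b * a))
      (h₂ : a * c = l • (c * a)) : a * (b * c) = (k * l) • (b * c * a) := by
    rw [← mul_assoc, h₁, smul_mul_assoc, mul_assoc, h₂, mul_smul_comm, smul_smul, mul_assoc]
  have one {a b : Module.End ℂ V} (h : a * b = b * a) : b * a = (1 : ℂ) • (a * b) := by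
    rw [one_smul, h]
  have one' {a b : Module.End ℂ V} (h : a * b = b * a) : a * b = (1 : ℂ) • (b * a) := by
    rw [one_smul, h]
  have sg_inv (i : ZMod 2) : sg i * sg i = 1 := by unfold sg; split_ifs <;> norm_num
  have inv_sg {a b : Module.End ℂ V} {i : ZMod 2} (h : a * b = sg i • (b * a)) :
      b * a = sg i • (a * b) := by
    rw [h, smul_smul, sg_inv, one_smul]
  have hx₁ : ∀ w ∈ powSum ((z.b * y.d).prodMap (x.d * z.b + x.c * y.b * z.d))
      (diag (vac x y z)), x.c w.1 = 0 :=
    layer (fun w hw => (mem_vac.1 (mem_diag.1 hw).1).1)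
      (assoc (inv_sg h.cross₁₃.bc) (one h.cross₁₂.dc))
  have hy₁ : ∀ w ∈ powSum ((z.b * y.d).prodMap (x.d * z.b + x.c * y.b * z.d))
      (diag (vac x y z)), y.c w.1 = 0 :=
    layer (fun w hw => (mem_vac.1 (mem_diag.1 hw).1).2.1)
      (assoc (inv_sg h.cross₂₃.bc) h.rel₂.cd)
  have hy₂ := layer (B' := x.b * z.a + x.a * y.b * z.c) hy₁ (assoc h.rel₂.ca h.cross₁₂.cb)
  have unit_inj {a b : Module.End ℂ V} (ha : IsUnit a) (hb : IsUnit b) {i j : ZMod 2} :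
      Function.Injective ((sg i * (qp q j - (qp q j)⁻¹)) • (a * b)) :=
    injective_smul_of_isUnit (ha.mul hb)
      (mul_ne_zero (sg_ne_zero i) (qp_sub_inv_ne_zero hq hroot j))
  -- first layer
  have g₁ : ∀ w ∈ powSum ((z.b * y.d).prodMap (x.d * z.b + x.c * y.b * z.d))
      (diag (vac x y z)), w.1 = 0 → w.2 = 0 := by
    refine powSum_prodMap_graph (C := z.c) (e := sg (s + u)) (k := qp q s * qp q u)
      (l := qp q s * qp q u) (H := (sg (s + u) * (qp q u - (qp q u)⁻¹)) • (z.a * z.d * y.d))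
      (fun w hw h0 => by rw [(mem_diag.1 hw).2, h0]) hCz ?_ ?_ ?_
      (unit_inj (F.z_a.mul F.z_d) F.y_d) ?_
    · rw [← mul_assoc, h.rel₃.cb, add_mul, smul_mul_assoc, smul_mul_assoc, mul_assoc z.b,
        mul_assoc z.b, h.cross₂₃.cd]
    · rw [smul_mul_assoc, mul_smul_comm, smul_comm]
      congr 1
      simp only [mul_assoc, mul_mul_of_eq h.cross₂₃.bd.symm, mul_mul_of_eq_smul h.rel₃.db,
        mul_smul_comm, mul_mul_of_eq_smul h.rel₃.ab, smul_smul, mul_mul_of_eq h.cross₂₃.ad,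
        mul_mul_of_eq h.cross₂₃.dd, mul_comm]
    · rw [smul_mul_assoc, mul_smul_comm, smul_comm]
      congr 1
      simp only [mul_assoc, h.cross₂₃.cd.symm, mul_mul_of_eq_smul h.rel₃.ca,
        mul_smul_comm, mul_mul_of_eq_smul h.rel₃.cd, smul_smul, mul_comm]
    · rcases ladder_cases hroot s u with hsu | hl
      exacts [Or.inr ⟨TR.sq23 hsu, TL.sq23 hsu⟩, Or.inl hl]
  -- Second layer, lowered by `x.c`.
  have g₂ := powSum_prodMap_graph (B := y.a * x.b) (B' := x.b * z.a + x.a * y.b * z.c)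
    (C := x.c) (e := sg (0 + s)) (k := qp q 0 * qp q s) (l := qp q 0 * qp q s)
    (H := (sg (0 + s) * (qp q s - (qp q s)⁻¹)) • (x.a * x.d * y.a)) g₁ hx₁
    (by
      rw [← mul_assoc, ← h.cross₁₂.ac, mul_assoc, h.rel₁.cb, mul_add, mul_smul_comm,
        mul_smul_comm, mul_assoc, mul_assoc, ← h.cross₁₂.ad, mul_mul_of_eq h.cross₁₂.aa,
        mul_assoc])
    (by
      rw [smul_mul_assoc, mul_smul_comm, smul_comm]
      congr 1
      simp only [mul_assoc, mul_mul_of_eq h.cross₁₂.ab, h.cross₁₂.ab, mul_mul_of_eq_smul h.rel₁.db,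
        mul_smul_comm, mul_mul_of_eq_smul h.rel₁.ab, smul_smul, mul_mul_of_eq h.cross₁₂.aa,
        mul_mul_of_eq h.cross₁₂.ad, mul_comm])
    (by
      rw [smul_mul_assoc, mul_smul_comm, smul_comm]
      congr 1
      simp only [mul_assoc, h.cross₁₂.ac, mul_mul_of_eq_smul h.rel₁.ca,
        mul_smul_comm, mul_mul_of_eq_smul h.rel₁.cd, smul_smul, mul_comm])
    (unit_inj (F.x_a.mul F.x_d) F.y_a)
    (by
      rcases ladder_cases hroot 0 s with hsu | hl
      exacts [Or.inr ⟨TR.sq12 hsu.symm, TL.sq12 hsu.symm⟩, Or.inl hl])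
  -- Third layer, lowered by `y.c`.
  have g₃ := powSum_prodMap_graph (B := y.b) (B' := x.b * z.b + x.a * y.b * z.d)
    (C := y.c) (e := sg (0 + u)) (k := qp q 0 * qp q u) (l := qp q 0 * qp q u)
    (H := (sg (0 + u) * (qp q u - (qp q u)⁻¹)) • (y.a * y.d)) g₂ hy₂ h.rel₂.cb
    (by
      rw [smul_mul_assoc, mul_smul_comm, smul_comm]
      congr 1
      simp only [mul_assoc, h.rel₂.db, mul_smul_comm, mul_mul_of_eq_smul h.rel₂.ab, smul_smul,
        mul_comm])
    (by
      rw [smul_mul_assoc, mul_smul_comm, smul_comm]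
      congr 1
      simp only [mul_assoc, mul_mul_of_eq_smul h.rel₂.ca, mul_smul_comm, h.rel₂.cd, smul_smul,
        mul_comm])
    (unit_inj F.y_a F.y_d)
    (by
      rcases ladder_cases hroot 0 u with hsu | hl
      exacts [Or.inr ⟨TR.sq13 hsu.symm, TL.sq13 hsu.symm⟩, Or.inl hl])
  exact g₃ v hv'

/-- The two monodromy matrices are intertwined by an operator that fixes the vacuum vectors. -/
theorem exists_intertwiner (hq : q ≠ 0) (hroot : ∀ n : ℕ, 0 < n → q ^ n ≠ 1)
    (F : FockRep q s u x y z) :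
    ∃ R : Module.End ℂ V, (∀ i j, R * monR x y z i j = monL x y z i j * R) ∧
      (∀ v ∈ vac x y z, R v = v) ∧
      ∀ (G : Module.End ℂ V) (k₁ k₂ k₃ : ℂ), (∀ v ∈ vac x y z, G v ∈ vac x y z) →
        G * monR x y z 0 1 = k₁ • (monR x y z 0 1 * G) →
        G * monL x y z 0 1 = k₁ • (monL x y z 0 1 * G) →
        G * monR x y z 0 2 = k₂ • (monR x y z 0 2 * G) →
        G * monL x y z 0 2 = k₂ • (monL x y z 0 2 * G) →
        G * monR x y z 1 2 = k₃ • (monR x y z 1 2 * G) →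
        G * monL x y z 1 2 = k₃ • (monL x y z 1 2 * G) → R * G = G * R := by
  have h := F.rel
  have hsurj : (corr x y z).map (LinearMap.fst ℂ V V) = ⊤ := by
    rw [eq_top_iff, ← raised_vac_eq_top hq F]
    refine raised_le (fun v hv => ⟨(v, v), le_raised (mem_diag.2 ⟨hv, rfl⟩), rfl⟩) ?_
    rintro _ ⟨w, hw, rfl⟩
    obtain ⟨h1, h2, h3⟩ := raised_stable hw
    exact ⟨⟨_, h1, rfl⟩, ⟨_, h2, rfl⟩, ⟨_, h3, rfl⟩⟩
  -- The first projection is onto because the raising entries of `monR` generate `V`, and one-to-one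
  -- by `corr_graph`.
  obtain ⟨R, hR⟩ : ∃ R : V →ₗ[ℂ] V, corr x y z = R.graph := by
    refine Submodule.exists_eq_graph ⟨?_, ?_⟩
    · rintro ⟨v, hv⟩ ⟨w, hw⟩ hvw
      have h1 : v.1 = w.1 := hvw
      have := corr_graph hq hroot F (v - w) (sub_mem hv hw) (by simp [h1])
      exact Subtype.ext (Prod.ext h1 (sub_eq_zero.1 this))
    · intro v
      obtain ⟨w, hw, rfl⟩ : v ∈ (corr x y z).map (LinearMap.fst ℂ V V) := hsurj ▸ trivial
      exact ⟨⟨w, hw⟩, rfl⟩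
  have mem (v : V) : (v, R v) ∈ corr x y z := hR ▸ (R.mem_graph_iff _).2 rfl
  have eq_of_mem {v w : V} (hvw : (v, w) ∈ corr x y z) : w = R v :=
    (R.mem_graph_iff _).1 (hR ▸ hvw)
  have intertwine {f g : Module.End ℂ V}
      (hfg : ∀ w ∈ corr x y z, f.prodMap g w ∈ corr x y z) : R * f = g * R :=
    LinearMap.ext fun v => (eq_of_mem (hfg _ (mem v))).symm
  have vac_of {G : Module.End ℂ V} (hG : ∀ v ∈ vac x y z, G v ∈ vac x y z) :
      ∀ w ∈ diag (vac x y z), (G.prodMap G) w ∈ diag (vac x y z) := by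
    intro w hw
    obtain ⟨h1, h2⟩ := mem_diag.1 hw
    exact mem_diag.2 ⟨hG _ h1, by simp [h2]⟩
  have one {a b : Module.End ℂ V} (h : a * b = b * a) : b * a = (1 : ℂ) • (a * b) := by
    rw [one_smul, h]
  have one' {a b : Module.End ℂ V} (h : a * b = b * a) : a * b = (1 : ℂ) • (b * a) := by
    rw [one_smul, h]
  -- On the vacuum the strictly lower entries of both matrices vanish. The diagonal entries of both
  -- act there as the same operators `x.a * y.a`, `x.d * z.a`, `y.d * z.d`, so diagonal pairs
  -- preserve the diagonal vacuum.
  have stable := (corr_triangular hq h).raised_stable (W₀ := diag (vac x y z))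
    (fun w hw => by
      have key := vac_of (vac_map_mem (G := x.a * y.a) (x := x) (y := y) (z := z)
        (k₁ := qp q 0 * 1) (k₂ := 1 * qp q 0) (k₃ := 1 * 1) ?_ ?_ ?_) w hw
      · have e : y.a * x.a = x.a * y.a := h.cross₁₂.aa
        rwa [e]
      · simp only [mul_assoc, mul_mul_of_eq_smul h.rel₁.ca, ← h.cross₁₂.ac, mul_one,
          smul_mul_assoc]
      · simp only [mul_assoc, mul_mul_of_eq h.cross₁₂.ca, h.rel₂.ca, one_mul, mul_smul_comm]
      · simp only [mul_assoc, mul_mul_of_eq h.cross₁₃.ca, h.cross₂₃.ca, one_mul, one_smul])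
    (fun w hw => by
      obtain ⟨h1, h2⟩ := mem_diag.1 hw
      obtain ⟨hx, hy, hz⟩ := mem_vac.1 h1
      have key := vac_of (vac_map_mem (G := x.d * z.a) (x := x) (y := y) (z := z)
        (k₁ := qp q s) (k₂ := 1) (k₃ := qp q s) ?_ ?_ ?_) w hw
      · convert key using 1
        refine Prod.ext ?_ ?_
        · simp only [LinearMap.prodMap_apply, LinearMap.add_apply, Module.End.mul_apply]
          rw [ker_map_mem (h.cross₁₂.cb) hy, map_zero, zero_add, ← Module.End.mul_apply,
            h.cross₁₃.ad, Module.End.mul_apply]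
        · simp only [LinearMap.prodMap_apply, LinearMap.add_apply, Module.End.mul_apply, h2]
          rw [hz, map_zero, map_zero, add_zero]
      · simp only [mul_assoc, mul_mul_of_eq_smul h.rel₁.cd, ← h.cross₁₃.ac, smul_mul_assoc]
      · simp only [mul_assoc, mul_mul_of_eq h.cross₁₂.cd, ← h.cross₂₃.ac, one_smul]
      · simp only [mul_assoc, mul_mul_of_eq h.cross₁₃.cd, h.rel₃.ca, mul_smul_comm])
    (fun w hw => by
      have key := vac_of (vac_map_mem (G := y.d * z.d) (x := x) (y := y) (z := z)
        (k₁ := 1) (k₂ := qp q u) (k₃ := qp q u) ?_ ?_ ?_) w hw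
      · have e : z.d * y.d = y.d * z.d := h.cross₂₃.dd
        rwa [e]
      · simp only [mul_assoc, mul_mul_of_eq h.cross₁₂.dc.symm, ← h.cross₁₃.dc, one_smul]
      · simp only [mul_assoc, mul_mul_of_eq_smul h.rel₂.cd, ← h.cross₂₃.dc, smul_mul_assoc]
      · simp only [mul_assoc, mul_mul_of_eq h.cross₂₃.cd, h.rel₃.cd, mul_smul_comm])
    (fun w hw => by
      obtain ⟨h1, h2⟩ := mem_diag.1 hw
      obtain ⟨hx, hy, hz⟩ := mem_vac.1 h1
      refine Prod.ext ?_ ?_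
      · simp only [LinearMap.prodMap_apply, LinearMap.add_apply, Module.End.mul_apply]
        rw [ker_map_mem (one' h.cross₁₂.ca) hy, hx, map_zero, map_zero, add_zero, Prod.fst_zero]
      · simp only [LinearMap.prodMap_apply, h2, Module.End.mul_apply, Prod.snd_zero]
        exact ker_map_mem (one h.cross₁₂.ac) hx)
    (fun w hw => by
      obtain ⟨h1, h2⟩ := mem_diag.1 hw
      obtain ⟨hx, hy, hz⟩ := mem_vac.1 h1
      refine Prod.ext ?_ ?_
      · simp only [LinearMap.prodMap_apply, LinearMap.add_apply, Module.End.mul_apply]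
        rw [ker_map_mem (one' h.cross₁₂.ca) hy, hx, map_zero, map_zero, add_zero, Prod.fst_zero]
      · simp only [LinearMap.prodMap_apply, h2, hy, Prod.snd_zero])
    (fun w hw => by
      obtain ⟨h1, h2⟩ := mem_diag.1 hw
      obtain ⟨hx, hy, hz⟩ := mem_vac.1 h1
      refine Prod.ext ?_ ?_
      · simp only [LinearMap.prodMap_apply, LinearMap.add_apply, Module.End.mul_apply]
        rw [ker_map_mem h.cross₁₂.cb hy, ker_map_mem (one' h.cross₁₃.cd) hz, map_zero, add_zero,
          Prod.fst_zero]
      · simp only [LinearMap.prodMap_apply, Module.End.mul_apply, h2, hz, map_zero,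
          Prod.snd_zero])
  refine ⟨R, fun i j => ?_, fun v hv => (eq_of_mem (le_raised (mem_diag.2 ⟨hv, rfl⟩))).symm,
    fun G k₁ k₂ k₃ hG r₁ l₁ r₂ l₂ r₃ l₃ => intertwine fun w hw =>
      raised_map_mem_of_comm (k₁ := k₁) (k₂ := k₂) (k₃ := k₃) (vac_of hG) ?_ ?_ ?_ hw⟩
  · fin_cases i <;> fin_cases j
    exacts [intertwine fun w hw => (stable w hw).1,
      intertwine fun w hw => (stable w hw).2.1,
      intertwine fun w hw => (stable w hw).2.2.1,
      intertwine fun w hw => (stable w hw).2.2.2.1,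
      intertwine fun w hw => (stable w hw).2.2.2.2.1,
      intertwine fun w hw => (stable w hw).2.2.2.2.2.1,
      intertwine fun w hw => (stable w hw).2.2.2.2.2.2.1,
      intertwine fun w hw => (stable w hw).2.2.2.2.2.2.2.1,
      intertwine fun w hw => (stable w hw).2.2.2.2.2.2.2.2]
  · exact (congrArg (LinearMap.prodMapAlgHom ℂ V V) (Prod.ext r₁ l₁ :
      ((G, G) : Module.End ℂ V × Module.End ℂ V) * (monR x y z 0 1, monL x y z 0 1) =
        k₁ • ((monR x y z 0 1, monL x y z 0 1) * (G, G))))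
  · exact (congrArg (LinearMap.prodMapAlgHom ℂ V V) (Prod.ext r₂ l₂ :
      ((G, G) : Module.End ℂ V × Module.End ℂ V) * (monR x y z 0 2, monL x y z 0 2) =
        k₂ • ((monR x y z 0 2, monL x y z 0 2) * (G, G))))
  · exact (congrArg (LinearMap.prodMapAlgHom ℂ V V) (Prod.ext r₃ l₃ :
      ((G, G) : Module.End ℂ V × Module.End ℂ V) * (monR x y z 1 2, monL x y z 1 2) =
        k₃ • ((monR x y z 1 2, monL x y z 1 2) * (G, G))))

/-- If the inverse local problems also form a Fock representation with the same vacuum vectors,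
the intertwiner is invertible. -/
theorem exists_unit_intertwiner (hq : q ≠ 0) (hroot : ∀ n : ℕ, 0 < n → q ^ n ≠ 1)
    {x' y' z' : Quad (Module.End ℂ V)} (F : FockRep q s u x y z) (F' : FockRep q s u x' y' z')
    (hx : x.IsInv x') (hy : y.IsInv y') (hz : z.IsInv z')
    (hvac : vac x' y' z' = vac x y z) :
    ∃ R : (Module.End ℂ V)ˣ, (∀ i j, ↑R * monR x y z i j = monL x y z i j * ↑R) ∧
      ∀ (G : Module.End ℂ V) (k₁ k₂ k₃ : ℂ), (∀ v ∈ vac x y z, G v ∈ vac x y z) →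
        G * monR x y z 0 1 = k₁ • (monR x y z 0 1 * G) →
        G * monL x y z 0 1 = k₁ • (monL x y z 0 1 * G) →
        G * monR x y z 0 2 = k₂ • (monR x y z 0 2 * G) →
        G * monL x y z 0 2 = k₂ • (monL x y z 0 2 * G) →
        G * monR x y z 1 2 = k₃ • (monR x y z 1 2 * G) →
        G * monL x y z 1 2 = k₃ • (monL x y z 1 2 * G) → ↑R * G = G * ↑R := by
  obtain ⟨R, hR, hRv, hRG⟩ := exists_intertwiner hq hroot F
  obtain ⟨S, hS, hSv, -⟩ := exists_intertwiner hq hroot F'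
  have toMat {f : Module.End ℂ V} {M N : Matrix (Fin 3) (Fin 3) (Module.End ℂ V)} :
      (∀ i j, f * M i j = N i j * f) ↔
        Matrix.diagonal (fun _ => f) * M = N * Matrix.diagonal (fun _ => f) := by
    simp only [← Matrix.ext_iff, Matrix.diagonal_mul, Matrix.mul_diagonal]
  have transfer {f : Module.End ℂ V} {M N M' N' : Matrix (Fin 3) (Fin 3) (Module.End ℂ V)}
      (hM : M * M' = 1) (hN : N' * N = 1)
      (h : ∀ i j, f * M i j = N i j * f) : ∀ i j, f * M' i j = N' i j * f := by
    rw [toMat] at h ⊢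
    calc Matrix.diagonal (fun _ => f) * M'
        = N' * (N * Matrix.diagonal (fun _ => f)) * M' := by
          rw [← mul_assoc N', hN, one_mul]
      _ = N' * Matrix.diagonal (fun _ => f) * (M * M') := by
          rw [← h]; simp only [mul_assoc]
      _ = N' * Matrix.diagonal (fun _ => f) := by rw [hM, mul_one]
  -- Inversion reverses the order of the factors: `monR` of the inverse problems is the inverse of
  -- `monL` of the original ones. So `S` intertwines the original matrices in the direction opposite
  -- to `R`, and `S * R` commutes with `monR` and fixes the vacuum.
  have hS' := transfer (monR_mul_monL hx.symm hy.symm hz.symm) (monR_mul_monL hx hy hz) hS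
  have hR' := transfer (monR_mul_monL hx hy hz) (monR_mul_monL hx.symm hy.symm hz.symm) hR
  have hSR : S * R = 1 := F.eq_one hq
    (fun v hv => by rw [Module.End.mul_apply, hRv v hv, hSv v (hvac ▸ hv)])
    fun i j => by rw [mul_assoc, hR, ← mul_assoc, hS', mul_assoc]
  have hRS : R * S = 1 := F'.eq_one hq
    (fun v hv => by rw [Module.End.mul_apply, hSv v hv, hRv v (hvac ▸ hv)])
    fun i j => by rw [mul_assoc, hS, ← mul_assoc, hR', mul_assoc]
  exact ⟨⟨R, S, hRS, hSR⟩, hR, hRG⟩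

end Intertwiner

section QuadBasics

variable {E F : Type*} [Ring E] [Algebra ℂ E] [Ring F] [Algebra ℂ F]

/-- `z` commutes with all the coefficients. -/
structure Quad.Comm (x : Quad E) (z : E) : Prop where
  a : z * x.a = x.a * z
  b : z * x.b = x.b * z
  c : z * x.c = x.c * z
  d : z * x.d = x.d * z

/-- The image of the coefficients under a homomorphism. -/
@[simps] def Quad.map (f : E →ₐ[ℂ] F) (x : Quad E) : Quad F := ⟨f x.a, f x.b, f x.c, f x.d⟩

theorem Quad.IsInv.map {x y : Quad E} (h : x.IsInv y) (f : E →ₐ[ℂ] F) :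
    (x.map f).IsInv (y.map f) where
  h₁₁ := by simpa using congrArg f h.h₁₁
  h₁₂ := by simpa using congrArg f h.h₁₂
  h₂₁ := by simpa using congrArg f h.h₂₁
  h₂₂ := by simpa using congrArg f h.h₂₂
  k₁₁ := by simpa using congrArg f h.k₁₁
  k₁₂ := by simpa using congrArg f h.k₁₂
  k₂₁ := by simpa using congrArg f h.k₂₁
  k₂₂ := by simpa using congrArg f h.k₂₂

theorem LocalRel.map {q : ℂ} {s t : ZMod 2} {x : Quad E} (h : LocalRel q s t x)
    (f : E →ₐ[ℂ] F) : LocalRel q s t (x.map f) where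
  da := by simpa using congrArg f h.da
  ab := by simpa using congrArg f h.ab
  ca := by simpa using congrArg f h.ca
  db := by simpa using congrArg f h.db
  cd := by simpa using congrArg f h.cd
  cb := by simpa only [map_mul, map_add, map_smul, Quad.map] using congrArg f h.cb
  bb i := by simpa using congrArg f (h.bb i)
  cc i := by simpa using congrArg f (h.cc i)

theorem Quad.Comm.inv {x : Quad E} {z : Eˣ} (h : x.Comm z) : x.Comm ↑z⁻¹ where
  a := ((show Commute (z : E) x.a from h.a).units_inv_left).eq
  b := ((show Commute (z : E) x.b from h.b).units_inv_left).eq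
  c := ((show Commute (z : E) x.c from h.c).units_inv_left).eq
  d := ((show Commute (z : E) x.d from h.d).units_inv_left).eq

theorem Quad.Comm.mul {x : Quad E} {z w : E} (hz : x.Comm z) (hw : x.Comm w) :
    x.Comm (z * w) where
  a := by rw [mul_assoc, hw.a, ← mul_assoc, hz.a, mul_assoc]
  b := by rw [mul_assoc, hw.b, ← mul_assoc, hz.b, mul_assoc]
  c := by rw [mul_assoc, hw.c, ← mul_assoc, hz.c, mul_assoc]
  d := by rw [mul_assoc, hw.d, ← mul_assoc, hz.d, mul_assoc]

theorem Quad.Comm.smul {x : Quad E} {z : E} (hz : x.Comm z) (k : ℂ) : x.Comm (k • z) where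
  a := by rw [smul_mul_assoc, hz.a, mul_smul_comm]
  b := by rw [smul_mul_assoc, hz.b, mul_smul_comm]
  c := by rw [smul_mul_assoc, hz.c, mul_smul_comm]
  d := by rw [smul_mul_assoc, hz.d, mul_smul_comm]

end QuadBasics

/-! ### Even problems: quantum determinant and inverse. -/

section Bose

variable {E : Type*} [Ring E] [Algebra ℂ E] {q : ℂ} {s : ZMod 2} {x : Quad E}

/-- The quantum determinant of an even local problem. -/
noncomputable def qdet (q : ℂ) (s : ZMod 2) (x : Quad E) : E := x.b * x.c - (qp q s)⁻¹ • (x.a * x.d)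

theorem sg_add_self (s : ZMod 2) : sg (s + s) = 1 := by
  rw [CharTwo.add_self_eq_zero]; rfl

theorem LocalRel.cb_self (h : LocalRel q s s x) :
    x.c * x.b = x.b * x.c + (qp q s - (qp q s)⁻¹) • (x.a * x.d) := by
  rw [h.cb, sg_add_self, one_smul, one_mul]

theorem qdet_eq (h : LocalRel q s s x) : qdet q s x = x.c * x.b - qp q s • (x.a * x.d) := by
  rw [h.cb_self, qdet]; module

theorem comm_qdet (hq : q ≠ 0) (h : LocalRel q s s x) : x.Comm (qdet q s x) := by
  have hs := qp_ne_zero hq s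
  have cb := h.cb_self
  obtain ⟨l1, l2, l3, l4, l5, -, -, -⟩ := h.assoc
  obtain ⟨l1', l2', l3', l4', l5', -, -, -⟩ := h
  have cb' : ∀ z, x.c * (x.b * z) = x.b * (x.c * z)
      + (qp q s - (qp q s)⁻¹) • (x.a * (x.d * z)) := by
    intro z; rw [← mul_assoc, cb]; simp only [add_mul, smul_mul_assoc, mul_assoc]
  constructor
  all_goals
    simp only [qdet, sub_mul, mul_sub, mul_add, add_mul, mul_assoc, smul_mul_assoc, mul_smul_comm,
      smul_smul, smul_add, *]
  all_goals (match_scalars <;> field_simp <;> ring)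

/-- The inverse of an even local problem, in terms of the inverse of the quantum determinant. -/
noncomputable def boseInv (q : ℂ) (s : ZMod 2) (x : Quad E) (D' : E) : Quad E :=
  ⟨-(qp q s)⁻¹ • (D' * x.d), D' * x.b, D' * x.c, -qp q s • (D' * x.a)⟩

theorem isInv_boseInv (hq : q ≠ 0) (h : LocalRel q s s x) {D' : E} (hD : x.Comm D')
    (h1 : D' * qdet q s x = 1) : x.IsInv (boseInv q s x D') := by
  have hs := qp_ne_zero hq s
  have h2 := h1
  rw [qdet_eq h] at h2
  have h3 := h1
  rw [qdet] at h3
  have pa : ∀ z, x.a * (D' * z) = D' * (x.a * z) := fun z => by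
    rw [← mul_assoc, ← hD.a, mul_assoc]
  have pb : ∀ z, x.b * (D' * z) = D' * (x.b * z) := fun z => by
    rw [← mul_assoc, ← hD.b, mul_assoc]
  have pc : ∀ z, x.c * (D' * z) = D' * (x.c * z) := fun z => by
    rw [← mul_assoc, ← hD.c, mul_assoc]
  have pd : ∀ z, x.d * (D' * z) = D' * (x.d * z) := fun z => by
    rw [← mul_assoc, ← hD.d, mul_assoc]
  constructor <;> simp only [boseInv, mul_smul_comm, smul_mul_assoc, pa, pb, pc, pd, mul_assoc]
  · rw [← h3, mul_sub, mul_smul_comm]; module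
  · rw [h.ab, mul_smul_comm]; module
  · rw [h.cd, mul_smul_comm, smul_smul, neg_mul, inv_mul_cancel₀ hs]; module
  · rw [← h2, mul_sub, mul_smul_comm, h.da]; module
  · rw [← h3, mul_sub, mul_smul_comm, h.da]; module
  · rw [h.db, mul_smul_comm, smul_smul, neg_mul, inv_mul_cancel₀ hs]; module
  · rw [h.ca, mul_smul_comm]; module
  · rw [← h2, mul_sub, mul_smul_comm]; module

/-- The inverse problem must be of the same type, because the intertwiner is inverted by applying
its construction to the inverse problems. In the inverse the roles of `a` and `d` are exchanged,
which is harmless here since both lines carry the same parameter. -/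
theorem localRel_boseInv (hq : q ≠ 0) (h : LocalRel q s s x) {D' : E} (hD : x.Comm D') :
    LocalRel q s s (boseInv q s x D') := by
  have hs := qp_ne_zero hq s
  have pa : ∀ z, x.a * (D' * z) = D' * (x.a * z) := fun z => by
    rw [← mul_assoc, ← hD.a, mul_assoc]
  have pb : ∀ z, x.b * (D' * z) = D' * (x.b * z) := fun z => by
    rw [← mul_assoc, ← hD.b, mul_assoc]
  have pc : ∀ z, x.c * (D' * z) = D' * (x.c * z) := fun z => by
    rw [← mul_assoc, ← hD.c, mul_assoc]
  have pd : ∀ z, x.d * (D' * z) = D' * (x.d * z) := fun z => by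
    rw [← mul_assoc, ← hD.d, mul_assoc]
  constructor
  all_goals
    try simp only [boseInv, mul_smul_comm, smul_mul_assoc, pa, pb, pc, pd, mul_assoc, h.da, h.ab,
      h.ca, h.db, h.cd, h.cb_self, sg_add_self, mul_add, smul_smul, smul_add, smul_neg, neg_smul,
      mul_neg, neg_mul]
  all_goals first
    | exact fun h => (h rfl).elim
    | (match_scalars <;> field_simp)

end Bose

/-! ### Odd problems: normal form and inverse. -/

section Fermi

variable {E : Type*} [Ring E] [Algebra ℂ E] {q : ℂ} {s t : ZMod 2} {x : Quad E}

/-- The normal form of an odd local problem: it is a matrix algebra over its center, with central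
units `l`, `m` and the idempotent `e`. -/
structure FermiForm (Q : ℂ) (x : Quad E) (l m : Eˣ) (e : E) : Prop where
  comm_l : x.Comm l
  comm_m : x.Comm m
  le : l * e = e * l
  me : m * e = e * m
  lm : (l * m : E) = m * l
  ee : e * e = e
  eb : e * x.b = x.b
  be : x.b * e = 0
  ce : x.c * e = x.c
  ec : e * x.c = 0
  a_eq : x.a = l * (1 + (Q - 1) • e)
  d_eq : x.d = m * (1 + (Q⁻¹ - 1) • e)
  bc_eq : x.b * x.c = (Q - Q⁻¹) • (l * m * e)
  cb_eq : x.c * x.b = (Q - Q⁻¹) • (l * m * (1 - e))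

theorem qp_of_ne (q : ℂ) (h : s ≠ t) : qp q t = (qp q s)⁻¹ := by
  have two : ∀ i : ZMod 2, i = 0 ∨ i = 1 := by decide
  rcases two s with rfl | rfl <;> rcases two t with rfl | rfl <;> simp_all [qp]

theorem sg_of_ne (h : s ≠ t) : sg (s + t) = -1 := by
  have two : ∀ i : ZMod 2, i = 0 ∨ i = 1 := by decide
  rcases two s with rfl | rfl <;> rcases two t with rfl | rfl <;> simp_all [sg]

/-- For an odd problem `ad` commutes with all coefficients and `b² = c² = 0`, so `b` and `c` behave,
up to the central unit `ad`, like the two off-diagonal matrix units. The product `bc`, divided by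
`(Q - Q⁻¹) ad`, is the corresponding diagonal idempotent `e`. -/
theorem exists_fermiForm (hq : q ≠ 0) (hroot : ∀ n : ℕ, 0 < n → q ^ n ≠ 1) (hst : s ≠ t)
    (h : LocalRel q s t x) (ha : IsUnit x.a) (hd : IsUnit x.d) :
    ∃ (l m : Eˣ) (e : E), FermiForm (qp q s) x l m e := by
  have hs := qp_ne_zero hq s
  have hk := qp_sub_inv_ne_zero hq hroot s
  obtain ⟨a, ha⟩ := ha
  obtain ⟨d, hd⟩ := hd
  have bb := h.bb hst
  have cc := h.cc hst
  have cb := h.cb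
  have db := h.db
  have cd := h.cd
  have da := h.da
  have ab := h.ab
  have ca := h.ca
  rw [sg_of_ne hst, qp_of_ne q hst] at cb
  rw [qp_of_ne q hst] at db cd
  generalize qp q s = Q at *
  have cb' : x.c * x.b = (Q - Q⁻¹) • (x.a * x.d) - x.b * x.c := by rw [cb, inv_inv]; module
  -- the central element `a d`
  have hp : x.Comm (a * d : Eˣ) := by
    rw [Units.val_mul, ha, hd]
    constructor
    · rw [mul_assoc, da]
    · rw [mul_assoc, db, mul_smul_comm, ← mul_assoc, ab, smul_mul_assoc, smul_smul,
        inv_mul_cancel₀ hs, one_smul, mul_assoc]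
    · rw [← mul_assoc, ca, smul_mul_assoc, mul_assoc, mul_assoc, cd, mul_smul_comm,
        smul_smul, mul_inv_cancel₀ hs, one_smul]
    · rw [← mul_assoc, da]
  have hpv : (↑(a * d) : E) = x.a * x.d := by rw [Units.val_mul, ha, hd]
  generalize a * d = p at hp hpv
  have hp' := hp.inv
  rw [← hpv] at cb'
  have bcb : x.b * (x.c * x.b) = (Q - Q⁻¹) • (↑p * x.b) := by
    rw [cb', mul_sub, ← mul_assoc x.b x.b, bb, zero_mul, sub_zero, mul_smul_comm, hp.b]
  have cbc : x.c * (x.b * x.c) = (Q - Q⁻¹) • (↑p * x.c) := by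
    rw [← mul_assoc, cb', sub_mul, mul_assoc x.b, cc, mul_zero, sub_zero, smul_mul_assoc]
  obtain ⟨e, he⟩ : ∃ e : E, e = (Q - Q⁻¹)⁻¹ • (↑p⁻¹ * (x.b * x.c)) := ⟨_, rfl⟩
  have eb : e * x.b = x.b := by
    rw [he, smul_mul_assoc, mul_assoc, mul_assoc x.b, bcb, mul_smul_comm, smul_smul,
      inv_mul_cancel₀ hk, one_smul, ← mul_assoc, Units.inv_mul, one_mul]
  have be : x.b * e = 0 := by
    rw [he, mul_smul_comm, ← mul_assoc, ← hp'.b, mul_assoc, ← mul_assoc x.b, bb, zero_mul,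
      mul_zero, smul_zero]
  have ce : x.c * e = x.c := by
    rw [he, mul_smul_comm, ← mul_assoc, ← hp'.c, mul_assoc, cbc, mul_smul_comm, smul_smul,
      inv_mul_cancel₀ hk, one_smul, ← mul_assoc, Units.inv_mul, one_mul]
  have ec : e * x.c = 0 := by
    rw [he, smul_mul_assoc, mul_assoc, mul_assoc, cc, mul_zero, mul_zero, smul_zero]
  have bc : x.b * x.c = (Q - Q⁻¹) • (↑p * e) := by
    rw [he, mul_smul_comm, smul_smul, mul_inv_cancel₀ hk, one_smul, ← mul_assoc, Units.mul_inv,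
      one_mul]
  have pe : (p : E) * e = e * p := by
    have h1 : (p : E) * (x.b * x.c) = x.b * x.c * p := by
      rw [← mul_assoc, hp.b, mul_assoc, hp.c, mul_assoc]
    rw [he, mul_smul_comm, smul_mul_assoc, ← mul_assoc, Units.mul_inv, one_mul, mul_assoc, ← h1,
      ← mul_assoc, Units.inv_mul, one_mul]
  have ee : e * e = e := by
    nth_rewrite 2 [he]
    rw [mul_smul_comm, ← mul_assoc, ← show (↑p⁻¹ : E) * e = e * ↑p⁻¹ from
      (show Commute (p : E) e from pe).units_inv_left.eq, mul_assoc, ← mul_assoc e, eb, ← he]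
  have ae : x.a * e = e * x.a := by
    rw [he, mul_smul_comm, smul_mul_assoc, ← mul_assoc, ← hp'.a, mul_assoc, mul_assoc,
      ← mul_assoc x.a, ab, smul_mul_assoc, mul_assoc x.b, mul_assoc x.b, ca]
    simp only [mul_smul_comm]
  have de : x.d * e = e * x.d := by
    rw [he, mul_smul_comm, smul_mul_assoc, ← mul_assoc, ← hp'.d, mul_assoc, mul_assoc,
      ← mul_assoc x.d, db, smul_mul_assoc, mul_assoc x.b, mul_assoc x.b, cd]
    simp only [mul_smul_comm]
  have aex : ∀ z, x.a * (e * z) = e * (x.a * z) := fun z => by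
    rw [← mul_assoc, ae, mul_assoc]
  have dex : ∀ z, x.d * (e * z) = e * (x.d * z) := fun z => by
    rw [← mul_assoc, de, mul_assoc]
  have eex : ∀ z, e * (e * z) = e * z := fun z => by rw [← mul_assoc, ee]
  have bex : ∀ z, x.b * (e * z) = 0 := fun z => by rw [← mul_assoc, be, zero_mul]
  have cex : ∀ z, x.c * (e * z) = x.c * z := fun z => by rw [← mul_assoc, ce]
  have ebx : ∀ z, e * (x.b * z) = x.b * z := fun z => by rw [← mul_assoc, eb]
  have ecx : ∀ z, e * (x.c * z) = 0 := fun z => by rw [← mul_assoc, ec, zero_mul]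
  have eac : e * (x.a * x.c) = 0 := by rw [← aex, ec, mul_zero]
  have edc : e * (x.d * x.c) = 0 := by rw [← dex, ec, mul_zero]
  have f_inv : (1 + (Q⁻¹ - 1) • e) * (1 + (Q - 1) • e) = 1 := by
    simp only [add_mul, mul_add, one_mul, mul_one, smul_mul_assoc, mul_smul_comm, ee, smul_smul]
    match_scalars <;> field_simp; ring
  have f_inv' : (1 + (Q - 1) • e) * (1 + (Q⁻¹ - 1) • e) = 1 := by
    simp only [add_mul, mul_add, one_mul, mul_one, smul_mul_assoc, mul_smul_comm, ee, smul_smul]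
    match_scalars <;> field_simp; ring
  -- The unit `f` is `Q` on the part cut out by `e` and `1` on the complement. It accounts for the
  -- commutation factors of `a` with `b` and `c`, and `f⁻¹` for those of `d`; hence `a f⁻¹` and `d
  -- f` commute with all coefficients.
  obtain ⟨f, hf⟩ : ∃ f : Eˣ, (f : E) = 1 + (Q - 1) • e ∧ (↑f⁻¹ : E) = 1 + (Q⁻¹ - 1) • e :=
    ⟨⟨_, _, f_inv', f_inv⟩, rfl, rfl⟩
  have hl : ((a * f⁻¹ : Eˣ) : E) = x.a * (1 + (Q⁻¹ - 1) • e) := by rw [Units.val_mul, ha, hf.2]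
  have hm : ((d * f : Eˣ) : E) = x.d * (1 + (Q - 1) • e) := by rw [Units.val_mul, hd, hf.1]
  have hlm : ((a * f⁻¹ : Eˣ) : E) * ((d * f : Eˣ) : E) = p := by
    rw [hl, hm, hpv]
    simp only [add_mul, mul_add, one_mul, mul_one, smul_mul_assoc, mul_smul_comm, ee, smul_smul,
      mul_assoc, ae, de, aex, dex, eex]
    match_scalars <;> field_simp; ring
  refine ⟨a * f⁻¹, d * f, e, ?_, ?_, ?_, ?_, ?_, ee, eb, be, ce, ec, ?_, ?_, ?_, ?_⟩
  · rw [hl]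
    constructor <;> simp only [add_mul, mul_add, mul_one, smul_mul_assoc, mul_smul_comm,
      smul_smul, mul_assoc, ae, de, aex, dex, eex, eb, ec, bex, cex, mul_zero, smul_zero,
      add_zero, one_mul, be, ce, ebx, ecx, eac, edc, ab, ca, da]
    all_goals (match_scalars <;> field_simp <;> ring)
  · rw [hm]
    constructor <;> simp only [add_mul, mul_add, mul_one, smul_mul_assoc, mul_smul_comm,
      smul_smul, mul_assoc, ae, de, aex, dex, eex, eb, ec, bex, cex, mul_zero, smul_zero,
      add_zero, one_mul, be, ce, ebx, ecx, eac, edc, db, cd, da]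
    all_goals (match_scalars <;> field_simp <;> ring)
  · rw [hl]
    simp only [add_mul, mul_add, mul_one, smul_mul_assoc, mul_smul_comm, mul_assoc, ee, ae, aex,
      eex]
  · rw [hm]
    simp only [add_mul, mul_add, mul_one, smul_mul_assoc, mul_smul_comm, mul_assoc, ee, de, dex,
      eex]
  · rw [hl, hm]
    simp only [add_mul, mul_add, mul_one, smul_mul_assoc, mul_smul_comm, smul_smul,
      mul_assoc, ae, de, aex, dex, eex, da]
    match_scalars <;> ring
  · rw [hl, mul_assoc, f_inv, mul_one]
  · rw [hm, mul_assoc, f_inv', mul_one]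
  · rw [hlm, bc]
  · rw [hlm, cb', bc, mul_sub, mul_one, smul_sub]

/-- The inverse of an odd local problem. -/
noncomputable def fermiInv (Q : ℂ) (x : Quad E) (l m : Eˣ) (e : E) : Quad E :=
  ⟨↑l⁻¹ * (1 + (Q - 1) • e), -Q • (↑(l⁻¹ * m⁻¹) * x.b), -Q • (↑(l⁻¹ * m⁻¹) * x.c),
    (Q * Q) • (↑m⁻¹ * (1 + (Q⁻¹ - 1) • e))⟩

theorem fermiInv_spec (hq : q ≠ 0) (hst : s ≠ t) {l m : Eˣ} {e : E}
    (h : LocalRel q s t x) (H : FermiForm (qp q s) x l m e) :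
    x.IsInv (fermiInv (qp q s) x l m e) ∧ LocalRel q s t (fermiInv (qp q s) x l m e) := by
  have hs := qp_ne_zero hq s
  have bb := h.bb hst
  have cc := h.cc hst
  have sg1 := sg_of_ne hst
  have qt := qp_of_ne q hst
  obtain ⟨hl, hm, le, me, lm, ee, eb, be, ce, ec, ha, hd, bc, cb⟩ := H
  have l1 := hl.inv.b
  have l2 := hl.inv.c
  have m1 := hm.inv.b
  have m2 := hm.inv.c
  have le' : (↑l⁻¹ : E) * e = e * ↑l⁻¹ := (show Commute (l : E) e from le).units_inv_left.eq
  have me' : (↑m⁻¹ : E) * e = e * ↑m⁻¹ := (show Commute (m : E) e from me).units_inv_left.eq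
  have lm₁ : (↑l⁻¹ : E) * m = m * ↑l⁻¹ := (show Commute (l : E) m from lm).units_inv_left.eq
  have lm₂ : (l : E) * ↑m⁻¹ = ↑m⁻¹ * l := (show Commute (l : E) m from lm).units_inv_right.eq
  have lm₃ : (↑l⁻¹ : E) * ↑m⁻¹ = ↑m⁻¹ * ↑l⁻¹ :=
    (show Commute (l : E) ↑m⁻¹ from lm₂).units_inv_left.eq
  have k1 := hl.b
  have k2 := hl.c
  have n1 := hm.b
  have n2 := hm.c
  generalize hQ : qp q s = Q at *
  have x1 := fun z => mul_mul_of_eq l1.symm z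
  have x2 := fun z => mul_mul_of_eq l2.symm z
  have x3 := fun z => mul_mul_of_eq m1.symm z
  have x4 := fun z => mul_mul_of_eq m2.symm z
  have x5 := fun z => mul_mul_of_eq le'.symm z
  have x6 := fun z => mul_mul_of_eq me'.symm z
  have x7 := fun z => mul_mul_of_eq lm₁.symm z
  have x8 := fun z => mul_mul_of_eq lm₂.symm z
  have x9 := fun z => mul_mul_of_eq lm₃.symm z
  have y1 := fun z => mul_mul_of_eq k1.symm z
  have y2 := fun z => mul_mul_of_eq k2.symm z
  have y3 := fun z => mul_mul_of_eq n1.symm z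
  have y4 := fun z => mul_mul_of_eq n2.symm z
  have y5 := fun z => mul_mul_of_eq le.symm z
  have y6 := fun z => mul_mul_of_eq me.symm z
  have y7 := fun z => mul_mul_of_eq lm.symm z
  have z1 := fun z => mul_mul_of_eq ee z
  have z2 := fun z => mul_mul_of_eq eb z
  have z3 := fun z => mul_mul_of_eq be z
  have z4 := fun z => mul_mul_of_eq ce z
  have z5 := fun z => mul_mul_of_eq ec z
  have z6 := fun z => mul_mul_of_eq bb z
  have z7 := fun z => mul_mul_of_eq cc z
  constructor
  · constructor
    all_goals
      simp only [fermiInv, ha, hd, Units.val_mul, add_mul, mul_add, mul_one, one_mul,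
        smul_mul_assoc, mul_smul_comm, smul_smul, mul_assoc, mul_zero, zero_mul, smul_zero,
        add_zero, zero_add, smul_add, mul_sub, smul_sub, bc, cb, ← l1, ← l2, ← m1, ← m2, ← k1,
        ← k2, ← n1, ← n2, ← le', ← me', ← le, ← me, ← lm, ← lm₂, ← lm₁, ← lm₃, x1, x2, x3, x4, x5,
        x6, x7, x8, x9, y1, y2, y3, y4, y5, y6, y7, z1, z2, z3, z4, z5, z6, z7, ee, eb, be, ce,
        ec, bb, cc, Units.mul_inv, Units.inv_mul, Units.mul_inv_cancel_left,
        Units.inv_mul_cancel_left]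
      match_scalars <;> field_simp <;> ring
  · constructor
    all_goals
      try simp only [sg1, qt, hQ, inv_inv]
      try simp only [fermiInv, Units.val_mul, add_mul, mul_add, mul_one, one_mul,
        smul_mul_assoc, mul_smul_comm, smul_smul, mul_assoc, mul_zero, zero_mul, smul_zero,
        add_zero, zero_add, smul_add, mul_sub, smul_sub, bc, cb, ← l1, ← l2, ← m1, ← m2, ← k1,
        ← k2, ← n1, ← n2, ← le', ← me', ← le, ← me, ← lm, ← lm₂, ← lm₁, ← lm₃, x1, x2, x3, x4, x5,
        x6, x7, x8, x9, y1, y2, y3, y4, y5, y6, y7, z1, z2, z3, z4, z5, z6, z7, ee, eb, be, ce,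
        ec, bb, cc, Units.mul_inv, Units.inv_mul, Units.mul_inv_cancel_left,
        Units.inv_mul_cancel_left, implies_true]
      try (match_scalars <;> field_simp <;> ring)

end Fermi

/-! ### The parity automorphism of a superalgebra. -/

section Parity

variable {C : Type*} [Ring C] [Algebra ℂ C] (𝒢 : ZMod 2 → Submodule ℂ C) [GradedAlgebra 𝒢]

theorem zmod_two_cases (s : ZMod 2) : s = 0 ∨ s = 1 := by
  revert s; decide

theorem exists_add_eq (x : C) : ∃ x₀ ∈ 𝒢 0, ∃ x₁ ∈ 𝒢 1, x = x₀ + x₁ := by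
  refine ⟨_, (DirectSum.decompose 𝒢 x 0).2, _, (DirectSum.decompose 𝒢 x 1).2, ?_⟩
  conv_lhs => rw [← (DirectSum.decompose 𝒢).symm_apply_apply x, ← DirectSum.sum_univ_of
    (DirectSum.decompose 𝒢 x), DirectSum.decompose_symm_sum]
  simp only [DirectSum.decompose_symm_of]
  exact Fin.sum_univ_two _

theorem sg_add (s t : ZMod 2) : sg (s + t) = sg s * sg t := by
  rcases zmod_two_cases s with rfl | rfl <;> rcases zmod_two_cases t with rfl | rfl <;>
    simp [sg, show (1 + 1 : ZMod 2) = 0 from rfl]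

/-- The parity automorphism of a superalgebra as a linear map. -/
noncomputable def parityLin : C →ₗ[ℂ] C :=
  GradedAlgebra.proj 𝒢 0 - GradedAlgebra.proj 𝒢 1

theorem parityLin_of_mem {s : ZMod 2} {x : C} (hx : x ∈ 𝒢 s) : parityLin 𝒢 x = sg s • x := by
  rcases zmod_two_cases s with rfl | rfl <;>
    simp [parityLin, GradedAlgebra.proj_apply, DirectSum.decompose_of_mem_same 𝒢 hx,
      DirectSum.decompose_of_mem_ne 𝒢 hx, sg]

/-- The parity automorphism of a superalgebra. -/
noncomputable def parity : C →ₐ[ℂ] C :=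
  AlgHom.ofLinearMap (parityLin 𝒢)
    (by rw [parityLin_of_mem 𝒢 SetLike.GradedOne.one_mem]; simp [sg])
    (by
      have key : ∀ s t, ∀ x ∈ 𝒢 s, ∀ y ∈ 𝒢 t,
          parityLin 𝒢 (x * y) = parityLin 𝒢 x * parityLin 𝒢 y := by
        intro s t x hx y hy
        rw [parityLin_of_mem 𝒢 hx, parityLin_of_mem 𝒢 hy,
          parityLin_of_mem 𝒢 (SetLike.GradedMul.mul_mem hx hy), sg_add, smul_mul_smul_comm]
      intro x y
      obtain ⟨x₀, hx₀, x₁, hx₁, rfl⟩ := exists_add_eq 𝒢 x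
      obtain ⟨y₀, hy₀, y₁, hy₁, rfl⟩ := exists_add_eq 𝒢 y
      simp only [add_mul, mul_add, map_add, key _ _ _ hx₀ _ hy₀, key _ _ _ hx₀ _ hy₁,
        key _ _ _ hx₁ _ hy₀, key _ _ _ hx₁ _ hy₁])

theorem parity_of_mem {s : ZMod 2} {x : C} (hx : x ∈ 𝒢 s) : parity 𝒢 x = sg s • x :=
  parityLin_of_mem 𝒢 hx

theorem mem_of_parity {s : ZMod 2} {x : C} (h : parity 𝒢 x = sg s • x) : x ∈ 𝒢 s := by
  obtain ⟨x₀, hx₀, x₁, hx₁, rfl⟩ := exists_add_eq 𝒢 x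
  rw [map_add, parity_of_mem 𝒢 hx₀, parity_of_mem 𝒢 hx₁] at h
  have two : ∀ v : C, v = -v → v = 0 := by
    intro v hv
    have h2 : (2 : ℂ) • v = 0 := by rw [two_smul]; exact eq_neg_iff_add_eq_zero.1 hv
    exact (smul_eq_zero.1 h2).resolve_left two_ne_zero
  rcases zmod_two_cases s with rfl | rfl
  · have : x₁ = 0 := two _ (by simpa [sg] using h.symm)
    simpa [this] using hx₀
  · have : x₀ = 0 := two _ (by simpa [sg] using h)
    simpa [this] using hx₁

theorem parity_parity (x : C) : parity 𝒢 (parity 𝒢 x) = x := by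
  obtain ⟨x₀, hx₀, x₁, hx₁, rfl⟩ := exists_add_eq 𝒢 x
  simp [parity_of_mem 𝒢 hx₀, parity_of_mem 𝒢 hx₁, sg]

end Parity

/-! ### Generation by the coefficients; parity of the inverse. -/

section Generation

variable {C : Type u} [Ring C] [Algebra ℂ C] {𝒢 : ZMod 2 → Submodule ℂ C} {s : ZMod 2}

/-- The coefficients of a local linear problem. -/
@[simps] def LinearProblem.quad (L : LinearProblem 𝒢 s) : Quad C := ⟨L.a, L.b, L.c, L.d⟩

variable (L : LinearProblem 𝒢 s)

/-- The entries of the inverse of the matrix of a local linear problem. -/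
noncomputable def LinearProblem.inv : Quad C :=
  let Y := Ring.inverse (!![L.a, L.b; L.c, L.d] : Matrix (Fin 2) (Fin 2) C)
  ⟨Y 0 0, Y 0 1, Y 1 0, Y 1 1⟩

theorem LinearProblem.isInv : L.quad.IsInv L.inv := by
  have h := Ring.mul_inverse_cancel _ L.isUnit_X
  have k := Ring.inverse_mul_cancel _ L.isUnit_X
  have e : ∀ i j, (!![L.a, L.b; L.c, L.d] * Ring.inverse !![L.a, L.b; L.c, L.d]) i j
    = (1 : Matrix (Fin 2) (Fin 2) C) i j := fun i j => by rw [h]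
  have e' : ∀ i j, (Ring.inverse !![L.a, L.b; L.c, L.d] * !![L.a, L.b; L.c, L.d]) i j
    = (1 : Matrix (Fin 2) (Fin 2) C) i j := fun i j => by rw [k]
  constructor
  · simpa [LinearProblem.inv, Matrix.mul_apply, Fin.sum_univ_two] using e 0 0
  · simpa [LinearProblem.inv, Matrix.mul_apply, Fin.sum_univ_two] using e 0 1
  · simpa [LinearProblem.inv, Matrix.mul_apply, Fin.sum_univ_two] using e 1 0
  · simpa [LinearProblem.inv, Matrix.mul_apply, Fin.sum_univ_two] using e 1 1
  · simpa [LinearProblem.inv, Matrix.mul_apply, Fin.sum_univ_two] using e' 0 0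
  · simpa [LinearProblem.inv, Matrix.mul_apply, Fin.sum_univ_two] using e' 0 1
  · simpa [LinearProblem.inv, Matrix.mul_apply, Fin.sum_univ_two] using e' 1 0
  · simpa [LinearProblem.inv, Matrix.mul_apply, Fin.sum_univ_two] using e' 1 1

theorem Quad.IsInv.unique {E : Type*} [Ring E] {x y z : Quad E} (h : x.IsInv y)
    (h' : x.IsInv z) : y = z := by
  have m : ∀ {y z : Quad E}, x.IsInv y → x.IsInv z → !![y.a, y.b; y.c, y.d]
      = !![z.a, z.b; z.c, z.d] := by
    intro y z h h'
    refine left_inv_eq_right_inv (a := !![x.a, x.b; x.c, x.d]) ?_ ?_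
    · ext i j; fin_cases i <;> fin_cases j <;>
        simp [Matrix.mul_apply, Fin.sum_univ_two, h.k₁₁, h.k₁₂, h.k₂₁, h.k₂₂]
    · ext i j; fin_cases i <;> fin_cases j <;>
        simp [Matrix.mul_apply, Fin.sum_univ_two, h'.h₁₁, h'.h₁₂, h'.h₂₁, h'.h₂₂]
  have e := m h h'
  exact Quad.ext (congrFun (congrFun e 0) 0) (congrFun (congrFun e 0) 1)
    (congrFun (congrFun e 1) 0) (congrFun (congrFun e 1) 1)

/-- An element that intertwines two homomorphisms on the coefficients intertwines the entries of
the inverse matrices. -/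
theorem Quad.IsInv.intertwine {E : Type*} [Ring E] {x x' y y' : Quad E} (hx : x.IsInv x')
    (hy : y.IsInv y') {u : E} (ha : u * x.a = y.a * u) (hb : u * x.b = y.b * u)
    (hc : u * x.c = y.c * u) (hd : u * x.d = y.d * u) :
    u * x'.a = y'.a * u ∧ u * x'.b = y'.b * u ∧ u * x'.c = y'.c * u ∧ u * x'.d = y'.d * u := by
  have r₁ {p q : E} (h : x.a * p + x.b * q = 0) : y.a * (u * p) + y.b * (u * q) = 0 := by
    rw [← mul_assoc, ← mul_assoc, ← ha, ← hb, mul_assoc, mul_assoc, ← mul_add, h, mul_zero]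
  have r₁' {p q : E} (h : x.a * p + x.b * q = 1) : y.a * (u * p) + y.b * (u * q) = u := by
    rw [← mul_assoc, ← mul_assoc, ← ha, ← hb, mul_assoc, mul_assoc, ← mul_add, h, mul_one]
  have r₂ {p q : E} (h : x.c * p + x.d * q = 0) : y.c * (u * p) + y.d * (u * q) = 0 := by
    rw [← mul_assoc, ← mul_assoc, ← hc, ← hd, mul_assoc, mul_assoc, ← mul_add, h, mul_zero]
  have r₂' {p q : E} (h : x.c * p + x.d * q = 1) : y.c * (u * p) + y.d * (u * q) = u := by
    rw [← mul_assoc, ← mul_assoc, ← hc, ← hd, mul_assoc, mul_assoc, ← mul_add, h, mul_one]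
  have solve₁ {p q v w : E} (h₁ : y.a * p + y.b * q = v) (h₂ : y.c * p + y.d * q = w) :
      p = y'.a * v + y'.b * w := by
    rw [← h₁, ← h₂, mul_add, mul_add, add_add_add_comm, ← mul_assoc, ← mul_assoc, ← mul_assoc,
      ← mul_assoc, ← add_mul, ← add_mul, hy.k₁₁, hy.k₁₂, one_mul, zero_mul, add_zero]
  have solve₂ {p q v w : E} (h₁ : y.a * p + y.b * q = v) (h₂ : y.c * p + y.d * q = w) :
      q = y'.c * v + y'.d * w := by
    rw [← h₁, ← h₂, mul_add, mul_add, add_add_add_comm, ← mul_assoc, ← mul_assoc, ← mul_assoc,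
      ← mul_assoc, ← add_mul, ← add_mul, hy.k₂₁, hy.k₂₂, one_mul, zero_mul, zero_add]
  refine ⟨?_, ?_, ?_, ?_⟩
  · simpa using solve₁ (r₁' hx.h₁₁) (r₂ hx.h₂₁)
  · simpa using solve₁ (r₁ hx.h₁₂) (r₂' hx.h₂₂)
  · simpa using solve₂ (r₁' hx.h₁₁) (r₂ hx.h₂₁)
  · simpa using solve₂ (r₁ hx.h₁₂) (r₂' hx.h₂₂)

/-- To check a property of all elements, it is enough to check it for the coefficients, and to
know that it passes to inverses. -/
theorem LinearProblem.induction {p : C → Prop} (ha : p L.a) (hb : p L.b) (hc : p L.c)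
    (hd : p L.d) (ha' : p (Ring.inverse L.a)) (hd' : p (Ring.inverse L.d)) (hia : p L.inv.a)
    (hib : p L.inv.b) (hic : p L.inv.c) (hid : p L.inv.d) (alg : ∀ k : ℂ, p (algebraMap ℂ C k))
    (add : ∀ x y, p x → p y → p (x + y)) (mul : ∀ x y, p x → p y → p (x * y)) (x : C) : p x := by
  have hx : x ∈ (⊤ : Subalgebra ℂ C) := Algebra.mem_top
  rw [← L.generates] at hx
  induction hx using Algebra.adjoin_induction with
  | mem x hx =>
    rcases hx with (rfl | rfl | rfl | rfl | rfl | rfl) | ⟨⟨i, j⟩, rfl⟩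
    · exact ha
    · exact hb
    · exact hc
    · exact hd
    · exact ha'
    · exact hd'
    · fin_cases i <;> fin_cases j
      exacts [hia, hib, hic, hid]
  | algebraMap k => exact alg k
  | add x y _ _ hx hy => exact add x y hx hy
  | mul x y _ _ hx hy => exact mul x y hx hy

/-- Intertwining passes to sums, products and inverses, hence from the coefficients to the whole
algebra. With `u = 1` this shows that a homomorphism is determined by the coefficients; with `f = g`
the identity, that commuting with the coefficients means being central. -/
theorem LinearProblem.intertwine {B : Type*} [Ring B] [Algebra ℂ B] (f g : C →ₐ[ℂ] B) (u : B)
    (ha : u * f L.a = g L.a * u) (hb : u * f L.b = g L.b * u) (hc : u * f L.c = g L.c * u)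
    (hd : u * f L.d = g L.d * u) (x : C) : u * f x = g x * u := by
  have inv {y : C} (hy : IsUnit y) (h : u * f y = g y * u) :
      u * f (Ring.inverse y) = g (Ring.inverse y) * u := by
    have h₁ : f y * f (Ring.inverse y) = 1 := by
      rw [← map_mul, Ring.mul_inverse_cancel _ hy, map_one]
    have h₂ : g (Ring.inverse y) * g y = 1 := by
      rw [← map_mul, Ring.inverse_mul_cancel _ hy, map_one]
    calc u * f (Ring.inverse y) = g (Ring.inverse y) * g y * (u * f (Ring.inverse y)) := by
          rw [h₂, one_mul]
      _ = g (Ring.inverse y) * (u * f y) * f (Ring.inverse y) := by rw [h]; simp only [mul_assoc]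
      _ = g (Ring.inverse y) * u := by rw [mul_assoc, mul_assoc, h₁, mul_one]
  obtain ⟨ia, ib, ic, id⟩ := (L.isInv.map f).intertwine (L.isInv.map g) ha hb hc hd
  induction x using L.induction with
  | ha => exact ha
  | hb => exact hb
  | hc => exact hc
  | hd => exact hd
  | ha' => exact inv L.isUnit_a ha
  | hd' => exact inv L.isUnit_d hd
  | hia => exact ia
  | hib => exact ib
  | hic => exact ic
  | hid => exact id
  | alg k => rw [AlgHom.commutes, AlgHom.commutes, Algebra.commutes]
  | add x y hx hy => rw [map_add, map_add, mul_add, add_mul, hx, hy]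
  | mul x y hx hy => rw [map_mul, map_mul, ← mul_assoc, hx, mul_assoc, hy, mul_assoc]

theorem LinearProblem.hom_ext {B : Type*} [Ring B] [Algebra ℂ B] {f g : C →ₐ[ℂ] B}
    (ha : f L.a = g L.a) (hb : f L.b = g L.b) (hc : f L.c = g L.c) (hd : f L.d = g L.d) :
    f = g :=
  AlgHom.ext fun x => by
    simpa using L.intertwine f g 1 (by simpa) (by simpa) (by simpa) (by simpa) x

theorem LinearProblem.mem_center {z : C} (h : L.quad.Comm z) : z ∈ Subalgebra.center ℂ C :=
  Subalgebra.mem_center_iff.2 fun x =>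
    (L.intertwine (AlgHom.id ℂ C) (AlgHom.id ℂ C) z h.a h.b h.c h.d x).symm

theorem LinearProblem.comm_of_mem_center {z : C} (h : z ∈ Subalgebra.center ℂ C) :
    L.quad.Comm z := by
  have := Subalgebra.mem_center_iff.1 h
  exact ⟨(this _).symm, (this _).symm, (this _).symm, (this _).symm⟩

variable [GradedAlgebra 𝒢]

/-- Applying the parity automorphism to the inverse matrix, and changing the signs of its
off-diagonal entries if `s` is odd, yields another inverse of the same matrix. Uniqueness of the
inverse gives the parities. -/
theorem LinearProblem.inv_mem :
    L.inv.a ∈ 𝒢 0 ∧ L.inv.b ∈ 𝒢 s ∧ L.inv.c ∈ 𝒢 s ∧ L.inv.d ∈ 𝒢 0 := by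
  have h := L.isInv.map (parity 𝒢)
  have ss : sg s * sg s = 1 := by rw [← sg_add]; exact sg_add_self s
  have e : L.quad.IsInv ⟨parity 𝒢 L.inv.a, sg s • parity 𝒢 L.inv.b,
      sg s • parity 𝒢 L.inv.c, parity 𝒢 L.inv.d⟩ := by
    obtain ⟨h1, h2, h3, h4, h5, h6, h7, h8⟩ := h
    simp only [Quad.map, LinearProblem.quad, parity_of_mem 𝒢 L.a_mem, parity_of_mem 𝒢 L.b_mem,
      parity_of_mem 𝒢 L.c_mem, parity_of_mem 𝒢 L.d_mem, smul_mul_assoc, mul_smul_comm,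
      show sg 0 = 1 from rfl, one_smul] at h1 h2 h3 h4 h5 h6 h7 h8
    constructor <;> simp only [LinearProblem.quad, smul_mul_assoc, mul_smul_comm]
    · exact h1
    · rw [← smul_zero (sg s), ← h2, smul_add, smul_smul, ss, one_smul]
    · rw [← smul_zero (sg s), ← h3, smul_add, smul_smul, ss, one_smul]
    · exact h4
    · exact h5
    · rw [← smul_zero (sg s), ← h6, smul_add, smul_smul, ss, one_smul]
    · rw [← smul_zero (sg s), ← h7, smul_add, smul_smul, ss, one_smul]
    · exact h8
  have u := L.isInv.unique e
  refine ⟨mem_of_parity 𝒢 ?_, mem_of_parity 𝒢 ?_, mem_of_parity 𝒢 ?_, mem_of_parity 𝒢 ?_⟩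
  · rw [show sg 0 = 1 from rfl, one_smul]; exact (congrArg Quad.a u).symm
  · nth_rewrite 2 [congrArg Quad.b u]; rw [smul_smul, ss, one_smul]
  · nth_rewrite 2 [congrArg Quad.c u]; rw [smul_smul, ss, one_smul]
  · rw [show sg 0 = 1 from rfl, one_smul]; exact (congrArg Quad.d u).symm

end Generation

/-! ### The inverse problem and the parity of the center. -/

section InverseProblem

variable {C : Type u} [Ring C] [Algebra ℂ C] {𝒢 : ZMod 2 → Submodule ℂ C} {q : ℂ} {s t : ZMod 2}

/-- The first row of `X⁻¹ X = 1` gives `L.inv.a * qdet = -Q⁻¹ d`, a unit. The determinant is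
central, so as one of two commuting factors of a unit it is a unit itself. -/
theorem LinearProblem.isUnit_qdet (L : LinearProblem 𝒢 (s + s)) (hq : q ≠ 0)
    (h : LocalRel q s s L.quad) : IsUnit (qdet q s L.quad) := by
  have k₁ := L.isInv.k₁₁
  have k₂ := L.isInv.k₁₂
  have hs := qp_ne_zero hq s
  have hcd := h.cd
  have e : L.inv.a * qdet q s L.quad = -(qp q s)⁻¹ • L.d := by
    simp only [LinearProblem.quad] at k₁ k₂ hcd
    rw [qdet, mul_sub, mul_smul_comm]
    simp only [LinearProblem.quad]
    rw [← mul_assoc, ← mul_assoc, eq_sub_of_add_eq k₁, eq_neg_of_add_eq_zero_left k₂, sub_mul,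
      one_mul, neg_mul, mul_assoc, mul_assoc _ L.c, hcd, mul_smul_comm, smul_sub, smul_smul,
      inv_mul_cancel₀ hs, one_smul]
    module
  have hc : Commute L.inv.a (qdet q s L.quad) :=
    Subalgebra.mem_center_iff.1 (L.mem_center (comm_qdet hq h)) _
  refine (hc.isUnit_mul_iff.1 ?_).2
  rw [e]
  exact ((Units.mk0 _ (neg_ne_zero.2 (inv_ne_zero hs))).isUnit.map (algebraMap ℂ C)).mul
    L.isUnit_d |> fun h => by rwa [Units.val_mk0, ← Algebra.smul_def] at h

theorem isUnit_smul' {E : Type*} [Ring E] [Algebra ℂ E] {x : E} (hx : IsUnit x) {k : ℂ}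
    (hk : k ≠ 0) : IsUnit (k • x) := by
  rw [Algebra.smul_def]
  exact ((Units.mk0 k hk).isUnit.map (algebraMap ℂ E)).mul hx

/-- The inverse of an even local problem. -/
theorem LinearProblem.inv_of_even (L : LinearProblem 𝒢 (s + s)) (hq : q ≠ 0)
    (h : LocalRel q s s L.quad) : ∃ D : Cˣ, (D : C) = qdet q s L.quad ∧ L.quad.Comm ↑D⁻¹ ∧
      L.inv = boseInv q s L.quad ↑D⁻¹ := by
  obtain ⟨D, hD⟩ := L.isUnit_qdet hq h
  have hc : L.quad.Comm D := hD ▸ comm_qdet hq h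
  exact ⟨D, hD, hc.inv, L.isInv.unique (isInv_boseInv hq h hc.inv (by rw [← hD, Units.inv_mul]))⟩

/-- The inverse of an odd local problem. -/
theorem LinearProblem.inv_of_odd (L : LinearProblem 𝒢 (s + t)) (hq : q ≠ 0)
    (hroot : ∀ n : ℕ, 0 < n → q ^ n ≠ 1) (hst : s ≠ t)
    (h : LocalRel q s t L.quad) : ∃ (l m : Cˣ) (e : C), FermiForm (qp q s) L.quad l m e ∧
      L.inv = fermiInv (qp q s) L.quad l m e := by
  obtain ⟨l, m, e, H⟩ := exists_fermiForm hq hroot hst h L.isUnit_a L.isUnit_d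
  exact ⟨l, m, e, H, L.isInv.unique (fermiInv_spec hq hst h H).1⟩

theorem FermiForm.isUnit_one_add {Q : ℂ} (hQ : Q ≠ 0) {x : Quad C} {l m : Cˣ} {e : C}
    (H : FermiForm Q x l m e) : IsUnit (1 + (Q - 1) • e) ∧ IsUnit (1 + (Q⁻¹ - 1) • e) := by
  have h₁ : (1 + (Q⁻¹ - 1) • e) * (1 + (Q - 1) • e) = 1 := by
    simp only [add_mul, mul_add, one_mul, mul_one, smul_mul_assoc, mul_smul_comm, H.ee, smul_smul]
    match_scalars <;> field_simp; ring
  have h₂ : (1 + (Q - 1) • e) * (1 + (Q⁻¹ - 1) • e) = 1 := by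
    simp only [add_mul, mul_add, one_mul, mul_one, smul_mul_assoc, mul_smul_comm, H.ee, smul_smul]
    match_scalars <;> field_simp; ring
  exact ⟨⟨⟨_, _, h₂, h₁⟩, rfl⟩, ⟨⟨_, _, h₁, h₂⟩, rfl⟩⟩

/-- The inverse of a local problem satisfies the same relations; its off-diagonal coefficients
differ from the original ones by a central unit. -/
theorem LinearProblem.inv_spec (L : LinearProblem 𝒢 (s + t)) (hq : q ≠ 0)
    (hroot : ∀ n : ℕ, 0 < n → q ^ n ≠ 1) (h : LocalRel q s t L.quad) :
    LocalRel q s t L.inv ∧ IsUnit L.inv.a ∧ IsUnit L.inv.d ∧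
      ∃ z : Cˣ, L.quad.Comm z ∧ L.inv.b = z * L.b ∧ L.inv.c = z * L.c := by
  have hs := qp_ne_zero hq s
  by_cases hst : s = t
  · subst hst
    obtain ⟨D, -, hc, e⟩ := L.inv_of_even hq h
    rw [e]
    refine ⟨localRel_boseInv hq h hc, ?_, ?_, D⁻¹, hc, rfl, rfl⟩
    · exact isUnit_smul' (D⁻¹.isUnit.mul L.isUnit_d) (neg_ne_zero.2 (inv_ne_zero hs))
    · exact isUnit_smul' (D⁻¹.isUnit.mul L.isUnit_a) (neg_ne_zero.2 hs)
  · obtain ⟨l, m, e, H, he⟩ := L.inv_of_odd hq hroot hst h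
    rw [he]
    obtain ⟨u₁, u₂⟩ := H.isUnit_one_add hs
    refine ⟨(fermiInv_spec hq hst h H).2, l⁻¹.isUnit.mul u₁,
      isUnit_smul' (m⁻¹.isUnit.mul u₂) (mul_ne_zero hs hs), ?_⟩
    obtain ⟨k, hk⟩ : IsUnit ((-qp q s) • (↑(l⁻¹ * m⁻¹) : C)) :=
      isUnit_smul' (l⁻¹ * m⁻¹).isUnit (neg_ne_zero.2 hs)
    refine ⟨k, ?_, ?_, ?_⟩
    · rw [hk, Units.val_mul]
      exact (H.comm_l.inv.mul H.comm_m.inv).smul _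
    · rw [hk, smul_mul_assoc]; rfl
    · rw [hk, smul_mul_assoc]; rfl

variable [GradedAlgebra 𝒢]

/-- Central elements are even. -/
theorem LinearProblem.mem_of_mem_center (L : LinearProblem 𝒢 (s + t)) (hq : q ≠ 0)
    (hroot : ∀ n : ℕ, 0 < n → q ^ n ≠ 1) (h : LocalRel q s t L.quad) {z : C}
    (hz : z ∈ Subalgebra.center ℂ C) : z ∈ 𝒢 0 := by
  have pa := parity_of_mem 𝒢 L.a_mem
  have pb := parity_of_mem 𝒢 L.b_mem
  have pc := parity_of_mem 𝒢 L.c_mem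
  have pd := parity_of_mem 𝒢 L.d_mem
  rw [show sg 0 = 1 from rfl, one_smul] at pa pd
  -- Parity is an inner automorphism, so it fixes every central element.
  suffices ∃ w : C, w * w = 1 ∧ ∀ x, w * x = parity 𝒢 x * w by
    obtain ⟨w, hw, hx⟩ := this
    refine mem_of_parity 𝒢 ?_
    rw [show sg 0 = 1 from rfl, one_smul, ← mul_one (parity 𝒢 z), ← hw, ← mul_assoc, ← hx,
      Subalgebra.mem_center_iff.1 hz, mul_assoc, hw, mul_one]
  by_cases hst : s = t
  · subst hst
    rw [sg_add_self, one_smul] at pb pc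
    exact ⟨1, one_mul 1, L.intertwine (AlgHom.id ℂ C) (parity 𝒢) 1 (by simp [pa]) (by simp [pb])
      (by simp [pc]) (by simp [pd])⟩
  · rw [sg_of_ne hst, neg_one_smul] at pb pc
    obtain ⟨l, m, e, H⟩ := exists_fermiForm hq hroot hst h L.isUnit_a L.isUnit_d
    have eb : e * L.b = L.b := H.eb
    have be : L.b * e = 0 := H.be
    have ce : L.c * e = L.c := H.ce
    have ec : e * L.c = 0 := H.ec
    have ea : e * L.a = L.a * e := by
      rw [show L.a = _ from H.a_eq, mul_assoc, ← mul_assoc, ← H.le, mul_assoc]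
      simp only [mul_add, add_mul, mul_one, one_mul, smul_mul_assoc, mul_smul_comm]
    have ed : e * L.d = L.d * e := by
      rw [show L.d = _ from H.d_eq, mul_assoc, ← mul_assoc, ← H.me, mul_assoc]
      simp only [mul_add, add_mul, mul_one, one_mul, smul_mul_assoc, mul_smul_comm]
    -- The involution `1 - 2e` commutes with `a`, `d` and anticommutes with the off-diagonal `b`,
    -- `c`.
    refine ⟨1 - (2 : ℂ) • e, ?_, L.intertwine (AlgHom.id ℂ C) (parity 𝒢) _ ?_ ?_ ?_ ?_⟩ <;>
      simp only [AlgHom.id_apply, pa, pb, pc, pd, sub_mul, mul_sub, one_mul, mul_one,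
        smul_mul_assoc, mul_smul_comm, H.ee, ea, ed, eb, be, ce, ec, neg_mul] <;> module

end InverseProblem

/-! ### Fock modules of the local algebras; faithfulness in the odd case. -/

section FockModule

variable {C : Type u} [Ring C] [Algebra ℂ C]

/-- The left ideal generated by `c`, as a subspace. -/
def leftIdeal (c : C) : Submodule ℂ C := LinearMap.range (LinearMap.mulRight ℂ c)

theorem mem_leftIdeal {c x : C} : x ∈ leftIdeal c ↔ ∃ y, y * c = x := by
  simp [leftIdeal]

theorem leftIdeal_le_comap (c x : C) :
    leftIdeal c ≤ (leftIdeal c).comap (LinearMap.mulLeft ℂ x) := by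
  intro y hy
  obtain ⟨z, rfl⟩ := mem_leftIdeal.1 hy
  exact mem_leftIdeal.2 ⟨x * z, by simp [mul_assoc]⟩

/-- The action of the algebra on its quotient by the left ideal generated by `c`. -/
def fockHom (c : C) : C →ₐ[ℂ] Module.End ℂ (C ⧸ leftIdeal c) where
  toFun x := (leftIdeal c).mapQ (leftIdeal c) (LinearMap.mulLeft ℂ x) (leftIdeal_le_comap c x)
  map_one' := by ext x; simp
  map_mul' x y := by ext z; simp [mul_assoc]
  map_zero' := by ext x; simp
  map_add' x y := by ext z; simp [add_mul]
  commutes' k := by ext z; simp [← Algebra.smul_def, Module.algebraMap_end_apply]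

@[simp] theorem fockHom_mk (c x y : C) :
    fockHom c x (Submodule.Quotient.mk y) = Submodule.Quotient.mk (x * y) := rfl

theorem fockHom_eq_zero {c x : C} : fockHom c x = 0 ↔ ∀ y, x * y ∈ leftIdeal c := by
  constructor
  · intro h y
    rw [← Submodule.Quotient.mk_eq_zero, ← fockHom_mk, h, LinearMap.zero_apply]
  · intro h
    ext y
    simpa using (Submodule.Quotient.mk_eq_zero _).2 (h y)

variable {𝒢 : ZMod 2 → Submodule ℂ C} {q : ℂ} {s t : ZMod 2}

/-- The module is generated by the vectors that are killed by `c`. -/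
theorem LinearProblem.fockHom_gen (L : LinearProblem 𝒢 (s + t)) (hq : q ≠ 0)
    (hroot : ∀ n : ℕ, 0 < n → q ^ n ≠ 1) (h : LocalRel q s t L.quad)
    (p : Submodule ℂ (C ⧸ leftIdeal L.c)) (hp : LinearMap.ker (fockHom L.c L.c) ≤ p)
    (hb : ∀ v ∈ p, fockHom L.c L.b v ∈ p) : p = ⊤ := by
  obtain ⟨hI, -, -, z, hz, hzb, hzc⟩ := L.inv_spec hq hroot h
  have hs := qp_ne_zero hq s
  have ht := qp_ne_zero hq t
  -- The smallest candidate is shown to be stable under every generator of the algebra, hence under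
  -- the algebra.
  let N : Submodule ℂ (C ⧸ leftIdeal L.c) := sInf {p | LinearMap.ker (fockHom L.c L.c) ≤ p ∧
    ∀ v ∈ p, fockHom L.c L.b v ∈ p}
  have hN : ∀ v, fockHom L.c L.c v = 0 → v ∈ N := fun v hv =>
    Submodule.mem_sInf.2 fun p hp => hp.1 hv
  have hNb : ∀ v ∈ N, fockHom L.c L.b v ∈ N := fun v hv =>
    Submodule.mem_sInf.2 fun p hp => hp.2 v (Submodule.mem_sInf.1 hv p hp)
  have hNp : ∀ p : Submodule ℂ (C ⧸ leftIdeal L.c), LinearMap.ker (fockHom L.c L.c) ≤ p →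
      (∀ v ∈ p, fockHom L.c L.b v ∈ p) → N ≤ p := fun p h₁ h₂ => sInf_le ⟨h₁, h₂⟩
  -- elements that commute with `b` and `c` up to factors preserve `N`
  have pres {g : C} {k k' : ℂ} (h₁ : g * L.b = k • (L.b * g)) (h₂ : L.c * g = k' • (g * L.c)) :
      ∀ v ∈ N, fockHom L.c g v ∈ N := by
    refine hNp (N.comap (fockHom L.c g)) (fun v hv => ?_) fun v hv => ?_
    · refine hN _ ?_
      rw [← Module.End.mul_apply, ← map_mul, h₂, map_smul, LinearMap.smul_apply, map_mul,
        Module.End.mul_apply, hv, map_zero, smul_zero]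
    · rw [Submodule.mem_comap, ← Module.End.mul_apply, ← map_mul, h₁, map_smul,
        LinearMap.smul_apply, map_mul, Module.End.mul_apply]
      exact N.smul_mem _ (hNb _ hv)
  have pa := pres h.ab h.ca
  have pd := pres h.db h.cd
  have pz : ∀ v ∈ N, fockHom L.c z v ∈ N :=
    pres (k := 1) (k' := 1) (by rw [one_smul]; exact hz.b) (by rw [one_smul]; exact hz.c.symm)
  have inv {g : C} (hg : IsUnit g) {k k' : ℂ} (hk : k ≠ 0) (hk' : k' ≠ 0)
      (h₁ : g * L.b = k • (L.b * g)) (h₂ : L.c * g = k' • (g * L.c)) :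
      ∀ v ∈ N, fockHom L.c (Ring.inverse g) v ∈ N := by
    obtain ⟨g, rfl⟩ := hg
    rw [Ring.inverse_unit]
    exact pres (inv_mul_of_comm hk h₁) (mul_inv_of_comm hk' h₂)
  have pc : ∀ v ∈ N, fockHom L.c L.c v ∈ N := by
    intro v hv
    refine (hNp (N.comap (fockHom L.c L.c) ⊓ N) (fun v hv => ?_) (fun v hv => ?_) hv).1
    · rw [LinearMap.mem_ker] at hv
      exact ⟨show fockHom L.c L.c v ∈ N by rw [hv]; exact N.zero_mem, hN v hv⟩
    · refine ⟨?_, hNb _ hv.2⟩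
      change fockHom L.c L.c (fockHom L.c L.b v) ∈ N
      rw [← Module.End.mul_apply, ← map_mul, show L.c * L.b = _ from h.cb,
        map_add, map_smul, map_smul, map_mul, map_mul]
      exact N.add_mem (N.smul_mem _ (hNb _ hv.1)) (N.smul_mem _ (pa _ (pd _ hv.2)))
  have hzz : (↑z⁻¹ : C) * z = 1 := z.inv_mul
  have zb : ∀ w, (z : C) * (L.b * w) = L.b * (z * w) := fun w => by
    rw [← mul_assoc, show (z : C) * L.b = L.b * z from hz.b, mul_assoc]
  -- The off-diagonal entries of the inverse are `z b` and `z c` with `z` a central unit. Cancelling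
  -- `z` shows that the diagonal entries of the inverse commute with `b` and `c` themselves up to
  -- scalars.
  have cancel {v w : C} (e : (z : C) * v = z * w) : v = w := by
    rw [← one_mul v, ← hzz, mul_assoc, e, ← mul_assoc, hzz, one_mul]
  have hzinv := hz.inv
  have zmid : ∀ g : C, (z : C) * g = g * z := fun g =>
    (Subalgebra.mem_center_iff.1 (L.mem_center hz) g).symm
  have pia : ∀ v ∈ N, fockHom L.c L.inv.a v ∈ N := by
    refine pres (k := qp q s) (k' := qp q s) (cancel ?_) (cancel ?_)
    · have := hI.ab
      rw [hzb] at this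
      rw [mul_smul_comm, ← mul_assoc (z : C) L.b, ← this, ← mul_assoc, ← mul_assoc, zmid]
    · have := hI.ca
      rw [hzc] at this
      rw [mul_smul_comm, ← mul_assoc, this, ← mul_assoc, ← mul_assoc, zmid]
  have pid : ∀ v ∈ N, fockHom L.c L.inv.d v ∈ N := by
    refine pres (k := qp q t) (k' := qp q t) (cancel ?_) (cancel ?_)
    · have := hI.db
      rw [hzb] at this
      rw [mul_smul_comm, ← mul_assoc (z : C) L.b, ← this, ← mul_assoc, ← mul_assoc, zmid]
    · have := hI.cd
      rw [hzc] at this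
      rw [mul_smul_comm, ← mul_assoc, this, ← mul_assoc, ← mul_assoc, zmid]
  have all : ∀ x : C, ∀ v ∈ N, fockHom L.c x v ∈ N := by
    intro x
    induction x using L.induction with
    | ha => exact pa
    | hb => exact hNb
    | hc => exact pc
    | hd => exact pd
    | ha' => exact inv L.isUnit_a hs hs h.ab h.ca
    | hd' => exact inv L.isUnit_d ht ht h.db h.cd
    | hia => exact pia
    | hib => intro v hv; rw [hzb, map_mul]; exact pz _ (hNb _ hv)
    | hic => intro v hv; rw [hzc, map_mul]; exact pz _ (pc _ hv)
    | hid => exact pid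
    | alg k =>
      intro v hv
      rw [AlgHom.commutes, Module.algebraMap_end_apply]
      exact N.smul_mem _ hv
    | add x y hx hy =>
      intro v hv
      rw [map_add]
      exact N.add_mem (hx v hv) (hy v hv)
    | mul x y hx hy =>
      intro v hv
      rw [map_mul]
      exact hx _ (hy v hv)
  -- The class of `1` is killed by `c`, and it generates the quotient.
  have one : (Submodule.Quotient.mk 1 : C ⧸ leftIdeal L.c) ∈ N := by
    refine hN _ ?_
    rw [fockHom_mk, mul_one, Submodule.Quotient.mk_eq_zero]
    exact mem_leftIdeal.2 ⟨1, one_mul _⟩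
  rw [eq_top_iff]
  rintro v -
  obtain ⟨x, rfl⟩ := Submodule.Quotient.mk_surjective _ v
  have := all x _ one
  rw [fockHom_mk, mul_one] at this
  exact hNp p hp hb this

/-- The action of an odd local algebra is faithful. -/
theorem LinearProblem.fockHom_injective_of_odd (L : LinearProblem 𝒢 (s + t)) (hq : q ≠ 0)
    (hroot : ∀ n : ℕ, 0 < n → q ^ n ≠ 1) (hst : s ≠ t) (h : LocalRel q s t L.quad) :
    Function.Injective (fockHom L.c) := by
  refine (injective_iff_map_eq_zero _).2 fun x hx => ?_
  obtain ⟨l, m, e, H⟩ := exists_fermiForm hq hroot hst h L.isUnit_a L.isUnit_d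
  have cc : L.c * L.c = 0 := h.cc hst
  -- Elements of the left ideal are killed by `c` on the right because `c² = 0`. So `x` kills both
  -- `bc` and `cb`, whose sum is a nonzero multiple of the unit `l m`.
  have key : ∀ y, x * y * L.c = 0 := by
    intro y
    obtain ⟨z, hz⟩ := mem_leftIdeal.1 (fockHom_eq_zero.1 hx y)
    rw [← hz, mul_assoc, cc, mul_zero]
  have h₁ : x * (L.c * L.b) = 0 := by
    rw [← mul_assoc, show x * L.c = 0 by simpa using key 1, zero_mul]
  have h₂ : x * (L.b * L.c) = 0 := by rw [← mul_assoc, key]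
  rw [show L.c * L.b = _ from H.cb_eq, mul_smul_comm, smul_eq_zero] at h₁
  rw [show L.b * L.c = _ from H.bc_eq, mul_smul_comm, smul_eq_zero] at h₂
  have hk := qp_sub_inv_ne_zero hq hroot s
  have h₃ := congrArg₂ (· + ·) (h₁.resolve_left hk) (h₂.resolve_left hk)
  simp only [mul_sub, mul_one, sub_add_cancel, add_zero] at h₃
  have h₄ : x * ↑(l * m) = 0 := by rw [Units.val_mul]; exact h₃
  exact (Units.mul_left_eq_zero _).1 h₄

end FockModule

/-! ### Independence of ordered monomials in even problems. -/

section Independence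

variable {E : Type*} [Ring E] [Algebra ℂ E] {q : ℂ} {s : ZMod 2} {x : Quad E}

/-- Elements whose commutation factors with `b` are distinct are independent up to powers of
`b`. -/
theorem exists_mul_pow_eq_zero {ι : Type*} (S : Finset ι) {μ : ι → ℂ}
    (hμ : Function.Injective μ) (b : E) (X : ι → E) (hX : ∀ i ∈ S, b * X i = μ i • (X i * b))
    (h : ∑ i ∈ S, X i = 0) : ∃ n : ℕ, ∀ i ∈ S, X i * b ^ n = 0 := by
  classical
  induction S using Finset.induction_on generalizing X with
  | empty => exact ⟨0, by simp⟩
  | insert j S hj ih =>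
    rw [Finset.sum_insert hj] at h
    -- Multiplying the relation by `b` on the left and subtracting `μ j` times its product with `b`
    -- on the right eliminates the term `j`, at the cost of one factor `b`.
    have h' : ∑ i ∈ S, (μ i - μ j) • (X i * b) = 0 := by
      have e₁ : ∑ i ∈ S, b * X i = ∑ i ∈ S, μ i • (X i * b) :=
        Finset.sum_congr rfl fun i hi => hX i (Finset.mem_insert_of_mem hi)
      have e₂ : b * X j = μ j • (X j * b) := hX j (Finset.mem_insert_self _ _)
      have e₃ := eq_neg_of_add_eq_zero_right h
      simp only [sub_smul, Finset.sum_sub_distrib]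
      rw [← e₁, ← Finset.mul_sum, ← Finset.smul_sum, ← Finset.sum_mul, e₃, mul_neg, e₂, neg_mul,
        smul_neg, sub_self]
    obtain ⟨n, hn⟩ := ih (fun i => (μ i - μ j) • (X i * b)) (fun i hi => by
      rw [mul_smul_comm, ← mul_assoc, hX i (Finset.mem_insert_of_mem hi)]
      simp only [smul_mul_assoc, smul_smul, mul_comm]) h'
    have hn' : ∀ i ∈ S, X i * b ^ (n + 1) = 0 := by
      intro i hi
      have := hn i hi
      rw [smul_mul_assoc, mul_assoc, ← pow_succ', smul_eq_zero, sub_eq_zero] at this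
      exact this.resolve_left fun e => hj (hμ e ▸ hi)
    refine ⟨n + 1, fun i hi => ?_⟩
    rcases Finset.mem_insert.1 hi with rfl | hi
    · rw [eq_neg_of_add_eq_zero_left h, neg_mul, Finset.sum_mul, Finset.sum_eq_zero hn', neg_zero]
    · exact hn' i hi

theorem lower_mul_pow (h : LocalRel q s s x) (n : ℕ) : x.c * x.b ^ (n + 1) = x.b ^ (n + 1) * x.c +
    ((qp q s - (qp q s)⁻¹) * ladder 1 (qp q s * qp q s) n) • (x.b ^ n * (x.a * x.d)) := by
  have had : x.a * x.d * x.b = (qp q s * qp q s) • (x.b * (x.a * x.d)) := by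
    rw [mul_assoc, h.db, mul_smul_comm, ← mul_assoc, h.ab, smul_mul_assoc, smul_smul, mul_assoc]
  have hadn (n : ℕ) : x.a * x.d * x.b ^ n
      = ((qp q s * qp q s) ^ n) • (x.b ^ n * (x.a * x.d)) := by
    induction n with
    | zero => simp
    | succ n ih => rw [pow_succ, ← mul_assoc, ih, smul_mul_assoc, mul_assoc, had, mul_smul_comm,
        smul_smul, pow_succ, mul_assoc]
  induction n with
  | zero => simp [h.cb_self, ladder]
  | succ n ih =>
    rw [pow_succ', ← mul_assoc, h.cb_self, add_mul, mul_assoc, ih, smul_mul_assoc, hadn, ladder,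
      mul_add, mul_smul_comm, ← mul_assoc, ← pow_succ', ← mul_assoc, ← pow_succ']
    module

/-- Multiplication by `c` on the left passes through `z` and lowers the power of `b`: what remains
is a nonzero multiple of `z bⁿ` times the unit `ad`. -/
theorem eq_zero_of_mul_pow_eq_zero (hq : q ≠ 0) (hroot : ∀ n : ℕ, 0 < n → q ^ n ≠ 1)
    (h : LocalRel q s s x) (ha : IsUnit x.a) (hd : IsUnit x.d) {z : E} (hz : x.Comm z) (n : ℕ)
    (hn : z * x.b ^ n = 0) : z = 0 := by
  induction n with
  | zero => simpa using hn
  | succ n ih =>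
    refine ih ?_
    have e : x.c * (z * x.b ^ (n + 1)) = z * (x.c * x.b ^ (n + 1)) := by
      rw [← mul_assoc, ← hz.c, mul_assoc]
    rw [hn, mul_zero, lower_mul_pow h, mul_add, ← mul_assoc, hn, zero_mul, zero_add,
      mul_smul_comm, ← mul_assoc] at e
    have hk := mul_ne_zero (qp_sub_inv_ne_zero hq hroot s)
      (ladder_one_ne_zero (qp_mul_self_ne_one hroot s) n)
    exact (ha.mul hd).mul_left_eq_zero.1 ((smul_eq_zero.1 e.symm).resolve_left hk)

theorem mul_zpow_of_comm {a : Eˣ} {b : E} {k : ℂ} (hk : k ≠ 0) (h : b * ↑a = k • (↑a * b))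
    (j : ℤ) : b * ↑(a ^ j) = k ^ j • (↑(a ^ j) * b) := by
  induction j using Int.induction_on with
  | zero => simp
  | succ n ih =>
    rw [zpow_add_one, Units.val_mul, ← mul_assoc, ih, smul_mul_assoc, mul_assoc, h,
      mul_smul_comm, smul_smul, zpow_add_one₀ hk, mul_assoc]
  | pred n ih =>
    rw [zpow_sub_one, Units.val_mul, ← mul_assoc, ih, smul_mul_assoc, mul_assoc,
      mul_inv_of_comm hk h, mul_smul_comm, smul_smul, zpow_sub_one₀ hk, mul_assoc]

theorem zpow_qp_injective {q : ℂ} (hq : q ≠ 0) (hroot : ∀ n : ℕ, 0 < n → q ^ n ≠ 1)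
    (s : ZMod 2) : Function.Injective fun k : ℤ => qp q s ^ k := by
  have hs := qp_ne_zero hq s
  have key : ∀ n : ℕ, 0 < n → qp q s ^ n ≠ 1 := by
    intro n hn e
    refine qp_mul_self_ne_one hroot s n hn ?_
    rw [mul_pow, e, one_mul]
  have : ¬IsOfFinOrder (Units.mk0 _ hs) := by
    rw [isOfFinOrder_iff_pow_eq_one]
    rintro ⟨n, hn, e⟩
    exact key n hn (by simpa using congrArg Units.val e)
  intro i j e
  refine injective_zpow_iff_not_isOfFinOrder.2 this (Units.ext ?_)
  simpa using e

/-- This symmetry turns statements about powers of `b` into statements about powers of `c`. -/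
theorem LocalRel.swap (hq : q ≠ 0) (h : LocalRel q s s x) : LocalRel q⁻¹ s s ⟨x.a, x.c, x.b, x.d⟩ := by
  have e : qp q⁻¹ s = (qp q s)⁻¹ := by unfold qp; split_ifs <;> rfl
  have hs := qp_ne_zero hq s
  constructor <;> simp only [e, inv_inv, sg_add_self, one_smul, one_mul]
  · exact h.da
  · rw [h.ca, smul_smul, inv_mul_cancel₀ hs, one_smul]
  · rw [h.ab, smul_smul, inv_mul_cancel₀ hs, one_smul]
  · rw [h.cd, smul_smul, inv_mul_cancel₀ hs, one_smul]
  · rw [h.db, smul_smul, inv_mul_cancel₀ hs, one_smul]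
  · rw [h.cb_self]; module
  · exact fun h => (h rfl).elim
  · exact fun h => (h rfl).elim

/-- The powers of `a` have distinct commutation factors with `b`, so the terms separate after
multiplication by a further power of `b`, which `eq_zero_of_mul_pow_eq_zero` then removes. -/
theorem eq_zero_of_sum_mul_pow (hq : q ≠ 0) (hroot : ∀ n : ℕ, 0 < n → q ^ n ≠ 1)
    (h : LocalRel q s s x) {a : Eˣ} (ha : (a : E) = x.a) (hd : IsUnit x.d) (S : Finset ℤ)
    {z : ℤ → E} (hz : ∀ k, x.Comm (z k)) (n : ℕ)
    (hsum : (∑ k ∈ S, z k * ↑(a ^ k)) * x.b ^ n = 0) : ∀ k ∈ S, z k = 0 := by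
  have hs := qp_ne_zero hq s
  have hba : x.b * a = (qp q s)⁻¹ • (↑a * x.b) := by
    rw [ha, h.ab, smul_smul, inv_mul_cancel₀ hs, one_smul]
  have inj : Function.Injective fun k : ℤ => (qp q s)⁻¹ ^ k := by
    intro i j e
    exact zpow_qp_injective hq hroot s (by simpa using e)
  rw [Finset.sum_mul] at hsum
  obtain ⟨N, hN⟩ := exists_mul_pow_eq_zero S inj x.b (fun k => z k * ↑(a ^ k) * x.b ^ n)
    (fun k _ => by
      rw [← mul_assoc, ← mul_assoc, ← (hz k).b, mul_assoc (z k),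
        mul_zpow_of_comm (inv_ne_zero hs) hba, mul_smul_comm, smul_mul_assoc, mul_assoc,
        mul_assoc, mul_assoc, mul_assoc, ← pow_succ', ← pow_succ]) hsum
  intro k hk
  have hzk : z k * ↑(a ^ k) = ↑(a ^ k) * z k := by
    have : Commute (z k) a := by rw [ha]; exact (hz k).a
    exact (this.units_zpow_right k).eq
  have e := hN k hk
  rw [mul_assoc, ← pow_add, hzk, mul_assoc] at e
  exact eq_zero_of_mul_pow_eq_zero hq hroot h ⟨a, ha⟩ hd (hz k) _ ((Units.mul_right_eq_zero _).1 e)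

/-- The powers of `b` and of `c`, as a sequence indexed by the integers. -/
def osc (x : Quad E) (m : ℤ) : E := x.b ^ m.toNat * x.c ^ (-m).toNat

theorem osc_natCast (n : ℕ) : osc x n = x.b ^ n := by
  simp [osc]

theorem osc_neg_natCast (n : ℕ) : osc x (-n) = x.c ^ n := by
  simp [osc]

theorem a_mul_osc (hq : q ≠ 0) (h : LocalRel q s s x) (m : ℤ) :
    x.a * osc x m = qp q s ^ m • (osc x m * x.a) := by
  have hs := qp_ne_zero hq s
  have hb (n : ℕ) : x.a * x.b ^ n = qp q s ^ n • (x.b ^ n * x.a) := by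
    induction n with
    | zero => simp
    | succ n ih => rw [pow_succ, ← mul_assoc, ih, smul_mul_assoc, mul_assoc, h.ab, mul_smul_comm,
        smul_smul, ← pow_succ, ← mul_assoc, ← pow_succ]
  have hc (n : ℕ) : x.a * x.c ^ n = (qp q s)⁻¹ ^ n • (x.c ^ n * x.a) := by
    have hac : x.a * x.c = (qp q s)⁻¹ • (x.c * x.a) := by
      rw [h.ca, smul_smul, inv_mul_cancel₀ hs, one_smul]
    induction n with
    | zero => simp
    | succ n ih => rw [pow_succ, ← mul_assoc, ih, smul_mul_assoc, mul_assoc, hac, mul_smul_comm,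
        smul_smul, ← pow_succ, ← mul_assoc, ← pow_succ]
  nth_rewrite 2 [← Int.toNat_sub_toNat_neg m]
  rw [osc, ← mul_assoc, hb, smul_mul_assoc, mul_assoc, hc, mul_smul_comm, smul_smul, mul_assoc,
    zpow_sub₀ hs, zpow_natCast, zpow_natCast, div_eq_mul_inv, inv_pow]

/-- The ordered monomials are independent over the elements that commute with all coefficients. -/
theorem eq_zero_of_sum_osc (hq : q ≠ 0) (hroot : ∀ n : ℕ, 0 < n → q ^ n ≠ 1)
    (h : LocalRel q s s x) {a : Eˣ} (ha : (a : E) = x.a) (hd : IsUnit x.d) (M : Finset ℤ)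
    (S : ℤ → Finset ℤ) {z : ℤ → ℤ → E} (hz : ∀ m k, x.Comm (z m k))
    (hsum : ∑ m ∈ M, (∑ k ∈ S m, z m k * ↑(a ^ k)) * osc x m = 0) :
    ∀ m ∈ M, ∀ k ∈ S m, z m k = 0 := by
  -- The oscillator monomials are separated by their weights under `a`. As `a` is a unit, the extra
  -- power of `a` cancels, and each coefficient sum is left multiplied by a power of `b` or of `c`.
  obtain ⟨N, hN⟩ := exists_mul_pow_eq_zero M (zpow_qp_injective hq hroot s) x.a _
    (fun m _ => by
      have hzk : ∀ k ∈ S m, x.a * (z m k * ↑(a ^ k)) = z m k * ↑(a ^ k) * x.a := by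
        intro k _
        rw [← mul_assoc, ← (hz m k).a, mul_assoc, mul_assoc, ← ha, ← Units.val_mul,
          ← Units.val_mul, mul_zpow_self, mul_self_zpow, add_comm]
      rw [← mul_assoc, Finset.mul_sum, Finset.sum_congr rfl hzk, ← Finset.sum_mul, mul_assoc,
        a_mul_osc hq h, mul_smul_comm, mul_assoc]) hsum
  intro m hm
  have e := hN m hm
  rw [← ha, ← Units.val_pow_eq_pow_val, Units.mul_left_eq_zero] at e
  rcases Int.eq_nat_or_neg m with ⟨n, hn⟩
  rcases hn with rfl | rfl
  · rw [osc_natCast] at e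
    exact eq_zero_of_sum_mul_pow hq hroot h ha hd (S _) (hz _) n e
  · rw [osc_neg_natCast] at e
    refine eq_zero_of_sum_mul_pow (inv_ne_zero hq) (fun n hn => ?_) (h.swap hq) ha hd (S _)
      (fun k => ?_) n e
    · rw [inv_pow, ne_eq, inv_eq_one]; exact hroot n hn
    · obtain ⟨h₁, h₂, h₃, h₄⟩ := hz (-n) k
      exact ⟨h₁, h₃, h₂, h₄⟩

end Independence

/-! ### Normal ordering and faithfulness in the even case. -/

section Faithful

variable {C : Type u} [Ring C] [Algebra ℂ C] {𝒢 : ZMod 2 → Submodule ℂ C} {q : ℂ} {s : ZMod 2}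

/-- In an even problem both lines carry the same parameter, so `a` and `d` have the same commutation
factors with `b` and `c`, which cancel in `d a⁻¹`. -/
theorem LinearProblem.exists_central_ratio (L : LinearProblem 𝒢 (s + s)) (hq : q ≠ 0)
    (h : LocalRel q s s L.quad) : ∃ r : Cˣ, L.quad.Comm r ∧ L.d = r * L.a := by
  have hs := qp_ne_zero hq s
  obtain ⟨a, ha⟩ := L.isUnit_a
  obtain ⟨d, hd⟩ := L.isUnit_d
  have hda : L.d * L.a = L.a * L.d := h.da
  have hab : L.a * L.b = qp q s • (L.b * L.a) := h.ab
  have hca : L.c * L.a = qp q s • (L.a * L.c) := h.ca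
  have hdb : L.d * L.b = qp q s • (L.b * L.d) := h.db
  have hcd : L.c * L.d = qp q s • (L.d * L.c) := h.cd
  rw [← ha, ← hd] at hda
  rw [← ha] at hab hca
  rw [← hd] at hdb hcd
  have c₁ : Commute (d : C) ↑a⁻¹ := (show Commute (d : C) a from hda).units_inv_right
  refine ⟨d * a⁻¹, ⟨?_, ?_, ?_, ?_⟩, by rw [Units.val_mul, mul_assoc, ← ha, Units.inv_mul,
    mul_one, hd]⟩ <;> simp only [LinearProblem.quad, Units.val_mul]
  · rw [← ha, mul_assoc, Units.inv_mul, mul_one, ← mul_assoc, ← hda, mul_assoc, Units.mul_inv,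
      mul_one]
  · rw [mul_assoc, inv_mul_of_comm hs hab, mul_smul_comm, ← mul_assoc, hdb, smul_mul_assoc,
      smul_smul, inv_mul_cancel₀ hs, one_smul, mul_assoc]
  · rw [← mul_assoc, hcd, smul_mul_assoc, mul_assoc _ L.c, mul_inv_of_comm hs hca, mul_smul_comm,
      smul_smul, mul_inv_cancel₀ hs, one_smul, mul_assoc]
  · rw [← hd, mul_assoc, ← c₁.eq]

/-- Every element is a combination of ordered monomials with central coefficients. -/
theorem LinearProblem.mem_span_osc (L : LinearProblem 𝒢 (s + s)) (hq : q ≠ 0)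
    (h : LocalRel q s s L.quad) {a : Cˣ} (ha : (a : C) = L.a) (x : C) :
    x ∈ Submodule.span ℂ {y | ∃ z, L.quad.Comm z ∧ ∃ k m : ℤ, y = z * ↑(a ^ k) * osc L.quad m} := by
  have hs := qp_ne_zero hq s
  obtain ⟨D, hD, hDc, hinv⟩ := L.inv_of_even hq h
  obtain ⟨r, hr, hda⟩ := L.exists_central_ratio hq h
  -- The span contains `1`, so it is enough that left multiplication by each generator preserves it.
  set N := Submodule.span ℂ
    {y | ∃ z, L.quad.Comm z ∧ ∃ k m : ℤ, y = z * ↑(a ^ k) * osc L.quad m} with hNdef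
  have mem {z : C} (hz : L.quad.Comm z) (k m : ℤ) : z * ↑(a ^ k) * osc L.quad m ∈ N :=
    Submodule.subset_span ⟨z, hz, k, m, rfl⟩
  have stab {g : C} (hg : ∀ z, L.quad.Comm z → ∀ k m : ℤ,
      g * (z * ↑(a ^ k) * osc L.quad m) ∈ N) : ∀ v ∈ N, g * v ∈ N := by
    intro v hv
    have : N ≤ N.comap (LinearMap.mulLeft ℂ g) := by
      rw [hNdef, Submodule.span_le]
      rintro _ ⟨z, hz, k, m, rfl⟩
      exact hg z hz k m
    exact this hv
  have sc {g : C} (hg : L.quad.Comm g) : ∀ v ∈ N, g * v ∈ N := stab fun z hz k m => by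
    rw [← mul_assoc, ← mul_assoc]
    exact mem (hg.mul hz) k m
  have sa (j : ℤ) : ∀ v ∈ N, ↑(a ^ j) * v ∈ N := stab fun z hz k m => by
    have : Commute z ↑(a ^ j) := by
      have : Commute z a := by rw [ha]; exact hz.a
      exact this.units_zpow_right j
    rw [← mul_assoc, ← mul_assoc, ← this.eq, mul_assoc z, ← Units.val_mul, ← zpow_add]
    exact mem hz _ m
  have sa₁ : ∀ v ∈ N, L.a * v ∈ N := by
    rw [← ha]; simpa using sa 1
  have sa' : ∀ v ∈ N, (↑a⁻¹ : C) * v ∈ N := by simpa using sa (-1)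
  have sd : ∀ v ∈ N, L.d * v ∈ N := by
    intro v hv
    rw [hda, mul_assoc]
    exact sc hr _ (sa₁ _ hv)
  -- `b` and `c` act on the oscillator part
  have osc_mem (m : ℤ) : osc L.quad m ∈ N := by
    simpa using mem (z := 1) ⟨by simp, by simp, by simp, by simp⟩ 0 m
  have hbc : L.b * L.c = D + (qp q s)⁻¹ • (L.a * L.d) := by
    rw [hD, qdet]; simp only [LinearProblem.quad]; abel
  have hcb : L.c * L.b = D + qp q s • (L.a * L.d) := by
    rw [hD, qdet_eq h]; simp only [LinearProblem.quad]; abel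
  have hDc' : L.quad.Comm D := by simpa using hDc.inv
  have sb₀ (m : ℤ) : L.b * osc L.quad m ∈ N := by
    rcases Int.eq_nat_or_neg m with ⟨n, rfl | rfl⟩
    · have := osc_mem ((n + 1 : ℕ) : ℤ)
      rw [osc_natCast, pow_succ'] at this
      rwa [osc_natCast]
    · rw [osc_neg_natCast]
      cases n with
      | zero => simpa [osc] using osc_mem 1
      | succ n =>
        have := osc_mem (-(n : ℤ))
        rw [osc_neg_natCast] at this
        simp only [LinearProblem.quad] at this ⊢
        rw [pow_succ', ← mul_assoc, hbc, add_mul, smul_mul_assoc, mul_assoc]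
        exact N.add_mem (sc hDc' _ this) (N.smul_mem _ (sa₁ _ (sd _ this)))
  have sc₀ (m : ℤ) : L.c * osc L.quad m ∈ N := by
    rcases Int.eq_nat_or_neg m with ⟨n, rfl | rfl⟩
    · rw [osc_natCast]
      cases n with
      | zero => simpa [osc] using osc_mem (-1)
      | succ n =>
        have := osc_mem (n : ℤ)
        rw [osc_natCast] at this
        simp only [LinearProblem.quad] at this ⊢
        rw [pow_succ', ← mul_assoc, hcb, add_mul, smul_mul_assoc, mul_assoc]
        exact N.add_mem (sc hDc' _ this) (N.smul_mem _ (sa₁ _ (sd _ this)))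
    · have := osc_mem (-((n + 1 : ℕ) : ℤ))
      rw [osc_neg_natCast, pow_succ'] at this
      rwa [osc_neg_natCast]
  have sb : ∀ v ∈ N, L.b * v ∈ N := stab fun z hz k m => by
    have hba : L.b * a = (qp q s)⁻¹ • (↑a * L.b) := by
      rw [ha, show L.a * L.b = _ from h.ab, smul_smul, inv_mul_cancel₀ hs, one_smul]; rfl
    rw [← mul_assoc, ← mul_assoc, ← show z * L.b = L.b * z from hz.b, mul_assoc z,
      mul_zpow_of_comm (inv_ne_zero hs) hba, mul_smul_comm, smul_mul_assoc, mul_assoc, mul_assoc]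
    exact N.smul_mem _ (sc hz _ (sa k _ (sb₀ m)))
  have sc : ∀ v ∈ N, L.c * v ∈ N := stab fun z hz k m => by
    have hca : L.c * a = qp q s • (↑a * L.c) := by rw [ha]; exact h.ca
    rw [← mul_assoc, ← mul_assoc, ← show z * L.c = L.c * z from hz.c, mul_assoc z,
      mul_zpow_of_comm hs hca, mul_smul_comm, smul_mul_assoc, mul_assoc, mul_assoc]
    exact N.smul_mem _ (sc hz _ (sa k _ (sc₀ m)))
  -- The name `sc` has been reused for stability under `c`, so the earlier stability under central
  -- elements is recalled by its type.
  have sD := ‹∀ {g : C}, L.quad.Comm g → ∀ v ∈ N, g * v ∈ N› hDc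
  have sr := ‹∀ {g : C}, L.quad.Comm g → ∀ v ∈ N, g * v ∈ N› hr.inv
  have hd' : Ring.inverse L.d = ↑r⁻¹ * ↑a⁻¹ := by
    have hra : (r : C) * a = a * r := by rw [ha]; exact hr.a
    rw [hda, ← ha, hra, ← Units.val_mul, Ring.inverse_unit, mul_inv_rev, Units.val_mul]
  have all : ∀ y : C, ∀ v ∈ N, y * v ∈ N := by
    intro y
    induction y using L.induction with
    | ha => exact sa₁
    | hb => exact sb
    | hc => exact sc
    | hd => exact sd
    | ha' => rw [← ha, Ring.inverse_unit]; exact sa'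
    | hd' => intro v hv; rw [hd', mul_assoc]; exact sr _ (sa' _ hv)
    | hia =>
      intro v hv
      rw [hinv, boseInv, smul_mul_assoc, mul_assoc]
      exact N.smul_mem _ (sD _ (sd _ hv))
    | hib => intro v hv; rw [hinv, boseInv, mul_assoc]; exact sD _ (sb _ hv)
    | hic => intro v hv; rw [hinv, boseInv, mul_assoc]; exact sD _ (sc _ hv)
    | hid =>
      intro v hv
      rw [hinv, boseInv, smul_mul_assoc, mul_assoc]
      exact N.smul_mem _ (sD _ (sa₁ _ hv))
    | alg k => intro v hv; rw [← Algebra.smul_def]; exact N.smul_mem _ hv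
    | add x y hx hy => intro v hv; rw [add_mul]; exact N.add_mem (hx v hv) (hy v hv)
    | mul x y hx hy => intro v hv; rw [mul_assoc]; exact hx _ (hy v hv)
  have one : (1 : C) ∈ N := by simpa [osc] using osc_mem 0
  simpa using all x 1 one

end Faithful

section FaithfulEven

variable {C : Type u} [Ring C] [Algebra ℂ C] {𝒢 : ZMod 2 → Submodule ℂ C} {q : ℂ} {s t : ZMod 2}

/-- The normal ordered form of an element. -/
theorem LinearProblem.exists_finsupp_osc (L : LinearProblem 𝒢 (s + s)) (hq : q ≠ 0)
    (h : LocalRel q s s L.quad) {a : Cˣ} (ha : (a : C) = L.a) (x : C) :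
    ∃ f : ℤ →₀ ℤ →₀ C, (∀ m k, L.quad.Comm (f m k)) ∧
      x = f.sum fun m g => (g.sum fun k z => z * ↑(a ^ k)) * osc L.quad m := by
  have zero : L.quad.Comm 0 := ⟨by simp, by simp, by simp, by simp⟩
  have addc {z w : C} (hz : L.quad.Comm z) (hw : L.quad.Comm w) : L.quad.Comm (z + w) :=
    ⟨by rw [add_mul, mul_add, hz.a, hw.a], by rw [add_mul, mul_add, hz.b, hw.b],
      by rw [add_mul, mul_add, hz.c, hw.c], by rw [add_mul, mul_add, hz.d, hw.d]⟩
  have g0 (m : ℤ) : (((0 : ℤ →₀ C).sum fun k z => z * ↑(a ^ k)) * osc L.quad m) = 0 := by simp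
  have gadd (g g' : ℤ →₀ C) : ((g + g').sum fun k z => z * ↑(a ^ k))
      = (g.sum fun k z => z * ↑(a ^ k)) + g'.sum fun k z => z * ↑(a ^ k) :=
    Finsupp.sum_add_index' (fun _ => zero_mul _) fun _ _ _ => add_mul _ _ _
  induction L.mem_span_osc hq h ha x using Submodule.span_induction with
  | mem x hx =>
    obtain ⟨z, hz, k, m, rfl⟩ := hx
    refine ⟨Finsupp.single m (Finsupp.single k z), fun m' k' => ?_, ?_⟩
    · classical
      rw [Finsupp.single_apply]
      split_ifs
      · rw [Finsupp.single_apply]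
        split_ifs
        exacts [hz, zero]
      · exact zero
    · rw [Finsupp.sum_single_index (g0 m), Finsupp.sum_single_index (zero_mul _)]
  | zero => exact ⟨0, fun _ _ => zero, by simp⟩
  | add x y _ _ hx hy =>
    obtain ⟨f, hf, rfl⟩ := hx
    obtain ⟨g, hg, rfl⟩ := hy
    refine ⟨f + g, fun m k => addc (hf m k) (hg m k), ?_⟩
    rw [Finsupp.sum_add_index' g0]
    intro m g g'
    rw [gadd, add_mul]
  | smul k x _ hx =>
    obtain ⟨f, hf, rfl⟩ := hx
    refine ⟨k • f, fun m j => (hf m j).smul k, ?_⟩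
    rw [Finsupp.sum_smul_index' g0, Finsupp.smul_sum]
    refine Finsupp.sum_congr fun m _ => ?_
    rw [Finsupp.sum_smul_index' fun _ => zero_mul _, ← smul_mul_assoc, Finsupp.smul_sum]
    simp only [smul_mul_assoc]

/-- A central element of the left ideal generated by `c` vanishes. -/
theorem LinearProblem.eq_zero_of_mem_leftIdeal (L : LinearProblem 𝒢 (s + s)) (hq : q ≠ 0)
    (hroot : ∀ n : ℕ, 0 < n → q ^ n ≠ 1) (h : LocalRel q s s L.quad) {g : C}
    (hg : L.quad.Comm g) (hgc : g ∈ leftIdeal L.c) : g = 0 := by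
  have hs := qp_ne_zero hq s
  obtain ⟨a, ha⟩ := L.isUnit_a
  obtain ⟨D, hD, hDc, -⟩ := L.inv_of_even hq h
  obtain ⟨r, hr, hda⟩ := L.exists_central_ratio hq h
  obtain ⟨y, rfl⟩ := mem_leftIdeal.1 hgc
  obtain ⟨f, hf, hy⟩ := L.exists_finsupp_osc hq h ha y
  have hDc' : L.quad.Comm D := by simpa using hDc.inv
  -- With `d = r a`, the determinant formula reads `bc = D + τ a²` with central units `D` and `τ`.
  set τ : C := (qp q s)⁻¹ • (r : C) with hτ
  have hτc : L.quad.Comm τ := hr.smul _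
  have acomm {z : C} (hz : L.quad.Comm z) : Commute z a := by rw [ha]; exact hz.a
  have hbc : L.b * L.c = D + τ * (↑a * ↑a) := by
    rw [hD, qdet, hτ, smul_mul_assoc, ← mul_assoc, (acomm hr).eq, ha, mul_assoc, ← hda]
    simp only [LinearProblem.quad]; abel
  -- the component of weight one
  have hw : ∀ m : ℤ, L.a * (((f m).sum fun k z => z * ↑(a ^ k)) * osc L.quad m * L.c)
      = qp q s ^ (m - 1)
        • ((((f m).sum fun k z => z * ↑(a ^ k)) * osc L.quad m * L.c) * L.a) := by
    intro m
    have h₁ : L.a * ((f m).sum fun k z => z * ↑(a ^ k))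
        = ((f m).sum fun k z => z * ↑(a ^ k)) * L.a := by
      rw [Finsupp.sum, Finset.mul_sum, Finset.sum_mul]
      refine Finset.sum_congr rfl fun k _ => ?_
      rw [← ha, ← mul_assoc, ← (acomm (hf m k)).eq, mul_assoc, mul_assoc, ← Units.val_mul,
        ← Units.val_mul, mul_zpow_self, mul_self_zpow, add_comm]
    have h₂ : L.a * osc L.quad m = _ := a_mul_osc hq h m
    have h₃ : L.a * L.c = (qp q s)⁻¹ • (L.c * L.a) := by
      rw [show L.c * L.a = _ from h.ca, smul_smul, inv_mul_cancel₀ hs, one_smul]; rfl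
    rw [← mul_assoc, ← mul_assoc, h₁, mul_assoc _ L.a, h₂, mul_smul_comm, smul_mul_assoc,
      mul_assoc, mul_assoc, show L.quad.a * L.c = _ from h₃, mul_smul_comm, mul_smul_comm,
      smul_smul, zpow_sub_one₀ hs]
    simp only [mul_assoc]
  have inj : Function.Injective fun m : ℤ => qp q s ^ (m - 1) := fun i j e => by
    have := zpow_qp_injective hq hroot s e
    omega
  -- The term with index `m` has weight `m - 1`, and the central element `y c` has weight `0`, so it
  -- is subtracted in the term `m = 1`. That index is inserted because it may lie outside the
  -- support.
  have hsum : ∑ m ∈ insert 1 f.support, (((f m).sum fun k z => z * ↑(a ^ k)) * osc L.quad m * L.c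
      - if m = 1 then y * L.c else 0) = 0 := by
    rw [Finset.sum_sub_distrib, Finset.sum_ite_eq' _ (1 : ℤ), if_pos (Finset.mem_insert_self _ _),
      ← Finset.sum_mul, sub_eq_zero]
    congr 1
    rw [hy, Finsupp.sum]
    refine (Finset.sum_subset (Finset.subset_insert _ _) fun m _ hm => ?_).symm
    rw [Finsupp.notMem_support_iff.1 hm]; simp
  obtain ⟨n, hn⟩ := exists_mul_pow_eq_zero _ inj L.a _ (fun m _ => by
    rw [mul_sub, sub_mul, smul_sub, hw]
    congr 1
    split_ifs with hm
    · rw [hm, sub_self, zpow_zero, one_smul, show L.a * (y * L.c) = _ from hg.a.symm]; rfl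
    · simp) hsum
  have h₁ := hn 1 (Finset.mem_insert_self _ _)
  rw [← ha, ← Units.val_pow_eq_pow_val, Units.mul_left_eq_zero, if_pos rfl, sub_eq_zero,
    show osc L.quad 1 = L.b by simp [osc], mul_assoc, hbc] at h₁
  -- compare coefficients
  generalize hF : f 1 = F at h₁
  have hFc : ∀ k, L.quad.Comm (F k) := fun k => hF ▸ hf 1 k
  -- These are the coefficients of the Laurent polynomial `F(a) (D + τ a²) - y c` in `a`; the shift
  -- by `2` comes from `a²`.
  let G : ℤ →₀ C := F.mapRange (· * (D : C)) (zero_mul _)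
    + (F.mapRange (· * τ) (zero_mul _)).mapDomain (· + 2) - Finsupp.single 0 (y * L.c)
  have shift (k : ℤ) : (F.mapRange (· * τ) (zero_mul _)).mapDomain (· + 2) k = F (k - 2) * τ := by
    have := Finsupp.mapDomain_apply (f := fun k : ℤ => k + 2) (add_left_injective 2)
      (F.mapRange (· * τ) (zero_mul _)) (k - 2)
    rwa [sub_add_cancel, Finsupp.mapRange_apply] at this
  have hGk (k : ℤ) : G k = F k * D + F (k - 2) * τ - if k = 0 then y * L.c else 0 := by
    classical
    simp only [G, Finsupp.sub_apply, Finsupp.add_apply, shift, Finsupp.mapRange_apply,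
      Finsupp.single_apply, eq_comm]
  have hGc (k : ℤ) : L.quad.Comm (G k) := by
    have e₁ := (hFc k).mul hDc'
    have e₂ := (hFc (k - 2)).mul hτc
    have e₃ : L.quad.Comm (if k = 0 then y * L.c else 0) := by
      split_ifs
      · exact hg
      · exact ⟨by simp, by simp, by simp, by simp⟩
    rw [hGk]
    constructor <;> simp only [sub_mul, add_mul, mul_sub, mul_add, e₁.a, e₁.b, e₁.c, e₁.d, e₂.a,
      e₂.b, e₂.c, e₂.d, e₃.a, e₃.b, e₃.c, e₃.d]
  have hGsum : G.sum (fun k z => z * ↑(a ^ k)) = 0 := by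
    rw [Finsupp.sum_sub_index fun k z w => sub_mul _ _ _,
      Finsupp.sum_add_index' (fun _ => zero_mul _) fun _ _ _ => add_mul _ _ _,
      Finsupp.sum_single_index (zero_mul _), Finsupp.sum_mapRange_index fun _ => zero_mul _,
      Finsupp.sum_mapDomain_index (fun _ => zero_mul _) fun _ _ _ => add_mul _ _ _,
      Finsupp.sum_mapRange_index fun _ => zero_mul _, zpow_zero, Units.val_one, mul_one, ← h₁,
      sub_eq_zero, Finsupp.sum, Finsupp.sum, Finsupp.sum, Finset.sum_mul,
      ← Finset.sum_add_distrib]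
    refine Finset.sum_congr rfl fun k _ => ?_
    rw [mul_add, mul_assoc, mul_assoc, mul_assoc (F k), mul_assoc (F k), ← mul_add, ← mul_add,
      ((acomm hDc').units_zpow_right k).eq, ← mul_assoc _ τ, ← ((acomm hτc).units_zpow_right k).eq,
      mul_assoc τ, zpow_add, Units.val_mul, zpow_two, Units.val_mul]
  have hG0 : ∀ k, G k = 0 := by
    intro k
    have := eq_zero_of_sum_mul_pow hq hroot h ha L.isUnit_d G.support hGc 0
      (by rw [pow_zero, mul_one]; exact hGsum)
    by_cases hk : k ∈ G.support
    · exact this k hk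
    · exact Finsupp.notMem_support_iff.1 hk
  have coeff (k : ℤ) : F k * D + F (k - 2) * τ = if k = 0 then y * L.c else 0 := by
    rw [← sub_eq_zero, ← hGk]; exact hG0 k
  have hτu : IsUnit τ := isUnit_smul' r.isUnit (inv_ne_zero hs)
  -- If `F` were nonzero, then, `D` and `τ` being units, the lowest and the highest term of `F(a) (D
  -- + τ a²)` would survive. Since only degree `0` is allowed, the lowest degree of `F` would be `0`
  -- and the highest `-2`.
  have hF0 : F = 0 := by
    by_contra hne
    have hsupp := Finsupp.support_nonempty_iff.2 hne
    have top : F.support.max' hsupp = -2 := by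
      have hm := Finset.max'_mem _ hsupp
      have hlt : F (F.support.max' hsupp + 2) = 0 := by
        by_contra hc
        have := Finset.le_max' _ _ (Finsupp.mem_support_iff.2 hc)
        omega
      have e := coeff (F.support.max' hsupp + 2)
      rw [hlt, zero_mul, zero_add, add_sub_cancel_right] at e
      by_contra hc
      rw [if_neg (by omega), hτu.mul_left_eq_zero] at e
      exact Finsupp.mem_support_iff.1 hm e
    have bot : F.support.min' hsupp = 0 := by
      have hm := Finset.min'_mem _ hsupp
      have hlt : F (F.support.min' hsupp - 2) = 0 := by
        by_contra hc
        have := Finset.min'_le _ _ (Finsupp.mem_support_iff.2 hc)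
        omega
      have e := coeff (F.support.min' hsupp)
      rw [hlt, zero_mul, add_zero] at e
      by_contra hc
      rw [if_neg hc, D.isUnit.mul_left_eq_zero] at e
      exact Finsupp.mem_support_iff.1 hm e
    have := Finset.min'_le_max' _ hsupp
    omega
  have := coeff 0
  simpa [hF0] using this.symm

/-- The action of an even local algebra is faithful. -/
theorem LinearProblem.fockHom_injective_of_even (L : LinearProblem 𝒢 (s + s)) (hq : q ≠ 0)
    (hroot : ∀ n : ℕ, 0 < n → q ^ n ≠ 1) (h : LocalRel q s s L.quad) :
    Function.Injective (fockHom L.c) := by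
  refine (injective_iff_map_eq_zero _).2 fun x hx => ?_
  obtain ⟨a, ha⟩ := L.isUnit_a
  obtain ⟨f, hf, rfl⟩ := L.exists_finsupp_osc hq h ha x
  let ρ := fockHom L.c
  have hmap : ∀ m, ρ (osc L.quad m) = osc (L.quad.map ρ) m := fun m => by simp [osc]
  -- Independence is applied to the operators: every coefficient of a normal ordered element of the
  -- kernel acts by zero, so it is a central element of the left ideal.
  have key := eq_zero_of_sum_osc hq hroot (h.map ρ) (a := Units.map ρ.toMonoidHom a)
    (congrArg ρ ha) (L.isUnit_d.map ρ) f.support (fun m => (f m).support)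
    (z := fun m k => ρ (f m k))
    (fun m k => ⟨by simpa using congrArg ρ (hf m k).a, by simpa using congrArg ρ (hf m k).b,
      by simpa using congrArg ρ (hf m k).c, by simpa using congrArg ρ (hf m k).d⟩)
    (by
      rw [← hx, Finsupp.sum, map_sum]
      refine Finset.sum_congr rfl fun m _ => ?_
      rw [map_mul, ← hmap, Finsupp.sum, map_sum]
      congr 1
      refine Finset.sum_congr rfl fun k _ => ?_
      rw [map_mul, ← map_zpow]; rfl)
  have hf0 : ∀ m k, f m k = 0 := by
    intro m k
    by_cases hm : m ∈ f.support
    · by_cases hk : k ∈ (f m).support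
      · refine L.eq_zero_of_mem_leftIdeal hq hroot h (hf m k) ?_
        simpa using fockHom_eq_zero.1 (key m hm k hk) 1
      · exact Finsupp.notMem_support_iff.1 hk
    · rw [Finsupp.notMem_support_iff.1 hm]; rfl
  have : f = 0 := Finsupp.ext fun m => Finsupp.ext fun k => hf0 m k
  simp [this]

end FaithfulEven

section GradedFock

variable {C : Type u} [Ring C] [Algebra ℂ C] {𝒢 : ZMod 2 → Submodule ℂ C} [GradedAlgebra 𝒢]
  {q : ℂ} {s t : ZMod 2}

/-- The local algebras act faithfully on graded spaces that are generated by the kernel of `c`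
under `b`. -/
theorem LinearProblem.exists_fock (L : LinearProblem 𝒢 (s + t)) (hq : q ≠ 0)
    (hroot : ∀ n : ℕ, 0 < n → q ^ n ≠ 1) (h : LocalRel q s t L.quad) :
    ∃ (M : Type u) (_ : AddCommGroup M) (_ : Module ℂ M) (ρ : C →ₐ[ℂ] Module.End ℂ M)
      (P : Module.End ℂ M), Function.Injective ρ ∧ P * P = 1 ∧
      (∀ x, P * ρ x = ρ (parity 𝒢 x) * P) ∧
      ∀ p : Submodule ℂ M, LinearMap.ker (ρ L.c) ≤ p → (∀ v ∈ p, ρ L.b v ∈ p) → p = ⊤ := by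
  have hP : leftIdeal L.c ≤ (leftIdeal L.c).comap (parity 𝒢).toLinearMap := by
    intro x hx
    obtain ⟨y, rfl⟩ := mem_leftIdeal.1 hx
    refine mem_leftIdeal.2 ⟨sg (s + t) • parity 𝒢 y, ?_⟩
    simp [parity_of_mem 𝒢 L.c_mem]
  refine ⟨C ⧸ leftIdeal L.c, inferInstance, inferInstance, fockHom L.c,
    (leftIdeal L.c).mapQ (leftIdeal L.c) (parity 𝒢).toLinearMap hP, ?_, ?_, ?_,
    L.fockHom_gen hq hroot h⟩
  · by_cases hst : s = t
    · subst hst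
      exact L.fockHom_injective_of_even hq hroot h
    · exact L.fockHom_injective_of_odd hq hroot hst h
  · ext x
    simp [parity_parity]
  · intro x
    ext y
    simp

end GradedFock

/-! ### Superalgebras of operators and graded tensor products. -/

section EndGrading

variable {V : Type u} [AddCommGroup V] [Module ℂ V]

/-- The operators that commute with the involution `P` up to the sign `(-1)^s`. -/
def endGrading (P : Module.End ℂ V) (s : ZMod 2) : Submodule ℂ (Module.End ℂ V) where
  carrier := {x | P * x = sg s • (x * P)}
  add_mem' {x y} hx hy := by
    simp only [Set.mem_ofPred_eq] at hx hy ⊢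
    rw [mul_add, hx, hy, add_mul, smul_add]
  zero_mem' := by simp
  smul_mem' k x hx := by
    simp only [Set.mem_ofPred_eq] at hx ⊢
    rw [mul_smul_comm, hx, smul_mul_assoc, smul_comm]

theorem mem_endGrading {P x : Module.End ℂ V} {s : ZMod 2} :
    x ∈ endGrading P s ↔ P * x = sg s • (x * P) := Iff.rfl

theorem endGrading_mul {P x y : Module.End ℂ V} {s t : ZMod 2} (hx : x ∈ endGrading P s)
    (hy : y ∈ endGrading P t) : x * y ∈ endGrading P (s + t) := by
  rw [mem_endGrading] at *
  rw [← mul_assoc, hx, smul_mul_assoc, mul_assoc, hy, mul_smul_comm, smul_smul, sg_add, mul_assoc]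

/-- The projection to the operators of parity `s`. -/
noncomputable def endProj (P : Module.End ℂ V) (s : ZMod 2) :
    Module.End ℂ V →ₗ[ℂ] Module.End ℂ V :=
  (2⁻¹ : ℂ) • (LinearMap.id + sg s • (LinearMap.mulLeft ℂ P ∘ₗ LinearMap.mulRight ℂ P))

theorem endProj_apply (P x : Module.End ℂ V) (s : ZMod 2) :
    endProj P s x = (2⁻¹ : ℂ) • (x + sg s • (P * (x * P))) := by
  simp [endProj]

theorem sg_mul_self (s : ZMod 2) : sg s * sg s = 1 := by
  rw [← sg_add, sg_add_self]

theorem endProj_mem {P : Module.End ℂ V} (hP : P * P = 1) (x : Module.End ℂ V) (s : ZMod 2) :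
    endProj P s x ∈ endGrading P s := by
  rw [mem_endGrading, endProj_apply, mul_smul_comm, smul_mul_assoc, mul_add, add_mul,
    mul_smul_comm, smul_mul_assoc, ← mul_assoc P P, hP, one_mul, mul_assoc P, mul_assoc x, hP,
    mul_one, smul_comm (sg s), smul_add (sg s), smul_smul (sg s) (sg s), sg_mul_self, one_smul,
    add_comm]

theorem endProj_of_mem {P : Module.End ℂ V} (hP : P * P = 1) {x : Module.End ℂ V} {s : ZMod 2}
    (hx : x ∈ endGrading P s) (t : ZMod 2) : endProj P t x = if t = s then x else 0 := by
  rw [mem_endGrading] at hx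
  rw [endProj_apply, ← mul_assoc, hx, smul_mul_assoc, mul_assoc, hP, mul_one, smul_smul]
  split_ifs with h
  · rw [h, sg_mul_self]; module
  · have : sg t * sg s = -1 := by
      rw [← sg_add, sg_of_ne h]
    rw [this]; module

theorem endProj_add {P : Module.End ℂ V} (x : Module.End ℂ V) :
    endProj P 0 x + endProj P 1 x = x := by
  simp only [endProj_apply, sg, if_true, one_ne_zero, if_false]
  module

/-- An involution defines a superalgebra structure on the operators. -/
noncomputable abbrev endGradedAlgebra {P : Module.End ℂ V} (hP : P * P = 1) :
    GradedAlgebra (endGrading P) where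
  one_mem := by rw [mem_endGrading]; simp [sg]
  mul_mem _ _ _ _ hx hy := endGrading_mul hx hy
  toDecomposition := DirectSum.Decomposition.ofLinearMap _
    (∑ s, DirectSum.lof ℂ _ (fun s => endGrading P s) s ∘ₗ
      (endProj P s).codRestrict _ fun x => endProj_mem hP x s)
    (by
      ext1 x
      have : ∀ f : ZMod 2 → Module.End ℂ V, ∑ s, f s = f 0 + f 1 := fun f => Fin.sum_univ_two f
      simp [DirectSum.coeLinearMap_lof, this, endProj_add])
    (by
      refine DirectSum.linearMap_ext _ fun s => LinearMap.ext fun x => ?_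
      simp only [LinearMap.comp_apply, LinearMap.id_apply, DirectSum.coeLinearMap_lof,
        LinearMap.sum_apply]
      rw [Finset.sum_eq_single s]
      · congr 1
        ext1
        simp [endProj_of_mem hP x.2]
      · intro t _ hts
        convert map_zero (DirectSum.lof ℂ (ZMod 2) (fun s => endGrading P s) t)
        ext1
        simp [endProj_of_mem hP x.2, hts]
      · simp)

end EndGrading

section TensorOperators

variable {M N : Type u} [AddCommGroup M] [Module ℂ M] [AddCommGroup N] [Module ℂ N]

theorem map_mul_map (f f' : Module.End ℂ M) (g g' : Module.End ℂ N) :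
    TensorProduct.map f g * TensorProduct.map f' g' = TensorProduct.map (f * f') (g * g') :=
  (TensorProduct.map_mul f f' g g').symm

/-- Operators on a tensor product that come from different tensors are different. -/
theorem homTensorHomMap_injective :
    Function.Injective (TensorProduct.homTensorHomMap (.id ℂ) M N M N) := by
  refine (injective_iff_map_eq_zero _).2 fun w hw => ?_
  obtain ⟨f, rfl⟩ := TensorProduct.eq_repr_basis_right (Module.Free.chooseBasis ℂ (Module.End ℂ N)) w
  set e := Module.Free.chooseBasis ℂ (Module.End ℂ N)
  suffices f = 0 by simp [this]
  ext i m
  refine (Module.forall_dual_apply_eq_zero_iff ℂ _).1 fun φ => ?_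
  -- Evaluating the first tensor factor at `m` and then under `φ` turns the vanishing operator into
  -- a linear relation among basis elements.
  have key : ∑ j ∈ f.support, φ (f j m) • e j = 0 := by
    ext n
    have := congrArg ((TensorProduct.lid ℂ N).toLinearMap ∘ₗ TensorProduct.map φ LinearMap.id)
      (LinearMap.congr_fun hw (m ⊗ₜ n))
    simpa [Finsupp.sum, LinearMap.sum_apply] using this
  by_cases hi : i ∈ f.support
  · exact linearIndependent_iff'.1 e.linearIndependent _ _ key i hi
  · simp [Finsupp.notMem_support_iff.1 hi]

/-- `1` or the parity operator. -/
def signOp (P : Module.End ℂ M) (s : ZMod 2) : Module.End ℂ M := if s = 0 then 1 else P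

theorem signOp_mul_self {P : Module.End ℂ M} (hP : P * P = 1) (s : ZMod 2) :
    signOp P s * signOp P s = 1 := by
  unfold signOp; split_ifs <;> simp [hP]

variable {C D : Type u} [Ring C] [Algebra ℂ C] {𝒞 : ZMod 2 → Submodule ℂ C} [GradedAlgebra 𝒞]
  [Ring D] [Algebra ℂ D] {𝒟 : ZMod 2 → Submodule ℂ D} [GradedAlgebra 𝒟]

/-- An action of a superalgebra on a space that is graded by an involution. -/
structure GradedRep (𝒞 : ZMod 2 → Submodule ℂ C) [GradedAlgebra 𝒞] (ρ : C →ₐ[ℂ] Module.End ℂ M)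
    (P : Module.End ℂ M) : Prop where
  sq : P * P = 1
  conj : ∀ x, P * ρ x = ρ (parity 𝒞 x) * P

theorem GradedRep.mem {ρ : C →ₐ[ℂ] Module.End ℂ M} {P : Module.End ℂ M} (h : GradedRep 𝒞 ρ P)
    {s : ZMod 2} {x : C} (hx : x ∈ 𝒞 s) : ρ x ∈ endGrading P s := by
  rw [mem_endGrading, h.conj, parity_of_mem 𝒞 hx, map_smul, smul_mul_assoc]

/-- The action of the second factor of a graded tensor product. -/
noncomputable def twist (𝒟 : ZMod 2 → Submodule ℂ D) [GradedAlgebra 𝒟] {P : Module.End ℂ M}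
    (hP : P * P = 1) (σ : D →ₐ[ℂ] Module.End ℂ N) : D →ₐ[ℂ] Module.End ℂ (M ⊗[ℂ] N) :=
  AlgHom.ofLinearMap
    (TensorProduct.homTensorHomMap (.id ℂ) M N M N ∘ₗ
      (TensorProduct.mk ℂ _ _ ((2⁻¹ : ℂ) • (1 + P)) ∘ₗ σ.toLinearMap +
        TensorProduct.mk ℂ _ _ ((2⁻¹ : ℂ) • (1 - P)) ∘ₗ σ.toLinearMap ∘ₗ (parity 𝒟).toLinearMap))
    (by
      ext m n
      simp only [LinearMap.comp_apply, LinearMap.add_apply, TensorProduct.mk_apply,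
        AlgHom.toLinearMap_apply, map_one, map_add, TensorProduct.homTensorHomMap_apply,
        TensorProduct.AlgebraTensorModule.curry_apply, TensorProduct.curry_apply,
        LinearMap.coe_restrictScalars, TensorProduct.map_tmul, LinearMap.smul_apply,
        LinearMap.sub_apply, Module.End.one_apply]
      rw [← TensorProduct.add_tmul]
      congr 1
      module)
    (by
      intro x y
      have h₁ : ((2⁻¹ : ℂ) • (1 + P)) * ((2⁻¹ : ℂ) • (1 + P)) = (2⁻¹ : ℂ) • (1 + P) := by
        simp only [smul_mul_assoc, mul_smul_comm, add_mul, mul_add, one_mul, mul_one, hP]; module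
      have h₂ : ((2⁻¹ : ℂ) • (1 - P)) * ((2⁻¹ : ℂ) • (1 - P)) = (2⁻¹ : ℂ) • (1 - P) := by
        simp only [smul_mul_assoc, mul_smul_comm, sub_mul, mul_sub, one_mul, mul_one, hP]; module
      have h₃ : ((2⁻¹ : ℂ) • (1 + P)) * ((2⁻¹ : ℂ) • (1 - P)) = 0 := by
        simp only [smul_mul_assoc, mul_smul_comm, add_mul, mul_sub, one_mul, mul_one, hP]; module
      have h₄ : ((2⁻¹ : ℂ) • (1 - P)) * ((2⁻¹ : ℂ) • (1 + P)) = 0 := by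
        simp only [smul_mul_assoc, mul_smul_comm, sub_mul, mul_add, one_mul, mul_one, hP]; module
      simp only [LinearMap.comp_apply, LinearMap.add_apply, TensorProduct.mk_apply,
        AlgHom.toLinearMap_apply, map_add, map_mul, TensorProduct.homTensorHomMap_apply, add_mul,
        mul_add, map_mul_map, h₁, h₂, h₃, h₄, TensorProduct.map_zero_left, add_zero, zero_add])

theorem twist_apply {P : Module.End ℂ M} (hP : P * P = 1) (σ : D →ₐ[ℂ] Module.End ℂ N) (y : D) :
    twist 𝒟 hP σ y = TensorProduct.map ((2⁻¹ : ℂ) • (1 + P)) (σ y) +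
      TensorProduct.map ((2⁻¹ : ℂ) • (1 - P)) (σ (parity 𝒟 y)) := by
  rfl

/-- On homogeneous elements the twist puts the power `Pᵗ` on the first factor; this operator
produces the sign rule of the graded tensor product. -/
theorem twist_of_mem {P : Module.End ℂ M} (hP : P * P = 1) (σ : D →ₐ[ℂ] Module.End ℂ N)
    {t : ZMod 2} {y : D} (hy : y ∈ 𝒟 t) :
    twist 𝒟 hP σ y = TensorProduct.map (signOp P t) (σ y) := by
  rw [twist_apply, parity_of_mem 𝒟 hy, map_smul, TensorProduct.map_smul_right,
    ← TensorProduct.map_smul_left, ← TensorProduct.map_add_left]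
  congr 1
  rcases zmod_two_cases t with rfl | rfl <;> simp only [signOp, sg, if_true, one_ne_zero, if_false]
    <;> module

theorem GradedRep.left {ρ : C →ₐ[ℂ] Module.End ℂ M} {P : Module.End ℂ M}
    (h : GradedRep 𝒞 ρ P) {Q : Module.End ℂ N} (hQ : Q * Q = 1) :
    GradedRep 𝒞 ((Module.End.rTensorAlgHom ℂ M N).comp ρ) (TensorProduct.map P Q) where
  sq := by rw [map_mul_map, h.sq, hQ]; exact TensorProduct.map_one
  conj x := by
    change TensorProduct.map P Q * TensorProduct.map (ρ x) 1
      = TensorProduct.map (ρ (parity 𝒞 x)) 1 * TensorProduct.map P Q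
    rw [map_mul_map, map_mul_map, h.conj, one_mul, mul_one]

theorem GradedRep.twist {σ : D →ₐ[ℂ] Module.End ℂ N} {Q : Module.End ℂ N}
    (h : GradedRep 𝒟 σ Q) {P : Module.End ℂ M} (hP : P * P = 1) :
    GradedRep 𝒟 (twist 𝒟 hP σ) (TensorProduct.map P Q) where
  sq := by rw [map_mul_map, h.sq, hP]; exact TensorProduct.map_one
  conj x := by
    rw [twist_apply, twist_apply, parity_parity, mul_add, add_mul]
    simp only [map_mul_map, h.conj, parity_parity, mul_smul_comm, smul_mul_assoc, mul_add, add_mul,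
      mul_sub, sub_mul, one_mul, mul_one]

theorem sg_mul (s t : ZMod 2) : sg (s * t) = (-1) ^ (s.val * t.val) := by
  rcases zmod_two_cases s with rfl | rfl <;> rcases zmod_two_cases t with rfl | rfl <;>
    simp [sg, ZMod.val_one]

theorem GradedRep.superCommuting {ρ : C →ₐ[ℂ] Module.End ℂ M} {P : Module.End ℂ M}
    (h : GradedRep 𝒞 ρ P) (σ : D →ₐ[ℂ] Module.End ℂ N) :
    SuperCommuting 𝒞 𝒟 ((Module.End.rTensorAlgHom ℂ M N).comp ρ) (SuperTetra.twist 𝒟 h.sq σ) := by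
  intro s t x hx y hy
  rw [← sg_mul, twist_of_mem h.sq σ hy]
  change TensorProduct.map (ρ x) 1 * _ = _ • (_ * TensorProduct.map (ρ x) 1)
  have e : signOp P t * ρ x = sg (s * t) • (ρ x * signOp P t) := by
    rcases zmod_two_cases t with rfl | rfl
    · simp [signOp, sg]
    · simpa [signOp] using mem_endGrading.1 (h.mem hx)
  rw [map_mul_map, map_mul_map, e, TensorProduct.map_smul_left, smul_smul, sg_mul_self, one_smul,
    one_mul, mul_one]

/-- The action of a graded tensor product on the tensor product of faithful modules is
faithful. -/
theorem GradedRep.mul_twist_injective {A : Type u} [AddCommGroup A] [Module ℂ A]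
    {g : A →ₗ[ℂ] Module.End ℂ M} (hg : Function.Injective g) {P : Module.End ℂ M} (hP : P * P = 1)
    {σ : D →ₐ[ℂ] Module.End ℂ N} {Q : Module.End ℂ N} (h : GradedRep 𝒟 σ Q)
    (hσ : Function.Injective σ) :
    Function.Injective (LinearMap.mul' ℂ _ ∘ₗ TensorProduct.map
      ((Module.End.rTensorAlgHom ℂ M N).toLinearMap ∘ₗ g) (SuperTetra.twist 𝒟 hP σ).toLinearMap) := by
  let e₁ : Module.End ℂ M →ₗ[ℂ] Module.End ℂ M := LinearMap.mulRight ℂ ((2⁻¹ : ℂ) • (1 + P))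
  let e₂ : Module.End ℂ M →ₗ[ℂ] Module.End ℂ M := LinearMap.mulRight ℂ ((2⁻¹ : ℂ) • (1 - P))
  let κ : Module.End ℂ N →ₗ[ℂ] Module.End ℂ N := LinearMap.mulLeft ℂ Q ∘ₗ LinearMap.mulRight ℂ Q
  let H := TensorProduct.homTensorHomMap (.id ℂ) M N M N
  let G := TensorProduct.map g σ.toLinearMap
  have hG : Function.Injective G := TensorProduct.map_injective_of_flat_flat _ _ hg hσ
  -- The map factors into the injective ungraded tensor map, a reshuffling by the two
  -- eigenprojections of `P`, and the injective passage from tensors to operators. The reshuffling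
  -- is its own inverse.
  have hF : (LinearMap.mul' ℂ _ ∘ₗ TensorProduct.map
      ((Module.End.rTensorAlgHom ℂ M N).toLinearMap ∘ₗ g) (SuperTetra.twist 𝒟 hP σ).toLinearMap)
      = H ∘ₗ (TensorProduct.map e₁ LinearMap.id + TensorProduct.map e₂ κ) ∘ₗ G := by
    refine TensorProduct.ext' fun a d => ?_
    have hd : Q * (σ d * Q) = σ (parity 𝒟 d) := by
      rw [← mul_assoc, h.conj, mul_assoc, h.sq, mul_one]
    change TensorProduct.map (g a) 1 * SuperTetra.twist 𝒟 hP σ d = H ((g a * _) ⊗ₜ σ d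
      + (g a * _) ⊗ₜ (Q * (σ d * Q)))
    rw [hd, twist_apply, mul_add, map_mul_map, map_mul_map, one_mul, one_mul, map_add]
    rfl
  rw [hF]
  refine (injective_iff_map_eq_zero _).2 fun w hw => ?_
  have h₀ := (injective_iff_map_eq_zero H).1 homTensorHomMap_injective _ hw
  refine (injective_iff_map_eq_zero G).1 hG w ?_
  rw [LinearMap.comp_apply] at h₀
  generalize G w = v at h₀
  have hPe : ∀ f : Module.End ℂ M, e₁ (e₁ f) = e₁ f ∧ e₁ (e₂ f) = 0 ∧ e₂ (e₁ f) = 0 ∧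
      e₂ (e₂ f) = e₂ f ∧ e₁ f + e₂ f = f := by
    intro f
    simp only [e₁, e₂, LinearMap.mulRight_apply, mul_assoc]
    refine ⟨?_, ?_, ?_, ?_, ?_⟩ <;> simp only [smul_mul_assoc, mul_smul_comm, sub_mul, mul_sub,
      add_mul, mul_add, one_mul, mul_one, hP] <;> module
  have hκ : ∀ f, κ (κ f) = f := by
    intro f
    simp only [κ, LinearMap.comp_apply, LinearMap.mulRight_apply, LinearMap.mulLeft_apply]
    rw [mul_assoc Q, mul_assoc f, h.sq, mul_one, ← mul_assoc, h.sq, one_mul]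
  have inv : (TensorProduct.map e₁ LinearMap.id + TensorProduct.map e₂ κ) ∘ₗ
      (TensorProduct.map e₁ LinearMap.id + TensorProduct.map e₂ κ) = LinearMap.id := by
    refine TensorProduct.ext' fun f f' => ?_
    simp only [LinearMap.comp_apply, LinearMap.add_apply, TensorProduct.map_tmul, map_add,
      LinearMap.id_apply, (hPe f).1, (hPe f).2.1, (hPe f).2.2.1, (hPe f).2.2.2.1, hκ,
      TensorProduct.zero_tmul, add_zero, zero_add]
    rw [← TensorProduct.add_tmul, (hPe f).2.2.2.2]
  have := LinearMap.congr_fun inv v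
  rw [LinearMap.comp_apply, h₀, map_zero] at this
  exact this.symm

end TensorOperators

section Shift

variable {E : Type*} [Ring E] [Algebra ℂ E] {q : ℂ} {s t : ZMod 2} {x : Quad E}

theorem qp_qp (q : ℂ) (r s : ZMod 2) : qp (qp q r) (r + s) = qp q s := by
  rcases zmod_two_cases r with rfl | rfl <;> rcases zmod_two_cases s with rfl | rfl <;>
    simp [qp, show (1 + 1 : ZMod 2) = 0 from rfl]

theorem qp_pow_ne_one {q : ℂ} (hroot : ∀ n : ℕ, 0 < n → q ^ n ≠ 1) (s : ZMod 2) (n : ℕ)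
    (hn : 0 < n) : qp q s ^ n ≠ 1 := by
  intro e
  refine qp_mul_self_ne_one hroot s n hn ?_
  rw [mul_pow, e, one_mul]

/-- Changing the parities of all lines amounts to replacing `q` by `q⁻¹`. -/
theorem LocalRel.shift (h : LocalRel q s t x) (r : ZMod 2) :
    LocalRel (qp q r) (r + s) (r + t) x := by
  have e : r + s + (r + t) = s + t := by
    rw [add_add_add_comm, CharTwo.add_self_eq_zero, zero_add]
  obtain ⟨h₁, h₂, h₃, h₄, h₅, h₆, h₇, h₈⟩ := h
  constructor
  all_goals
    first
    | rw [qp_qp, e]; assumption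
    | rw [qp_qp]; assumption
    | simpa using ‹_›

end Shift

/-! ### Problems embedded in a common superalgebra. -/

section Existence

variable {C : Type u} [Ring C] [Algebra ℂ C] {𝒢 : ZMod 2 → Submodule ℂ C}
  {D : Type u} [Ring D] [Algebra ℂ D] {𝒟 : ZMod 2 → Submodule ℂ D}
  {B : Type u} [Ring B] [Algebra ℂ B] {s t : ZMod 2}

/-- Coefficients of the parity of a local problem. -/
structure Quad.IsHomog (𝒢 : ZMod 2 → Submodule ℂ C) (s : ZMod 2) (x : Quad C) : Prop where
  a : x.a ∈ 𝒢 0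
  b : x.b ∈ 𝒢 s
  c : x.c ∈ 𝒢 s
  d : x.d ∈ 𝒢 0

theorem LinearProblem.isHomog (L : LinearProblem 𝒢 s) : L.quad.IsHomog 𝒢 s :=
  ⟨L.a_mem, L.b_mem, L.c_mem, L.d_mem⟩

theorem LinearProblem.inv_isHomog [GradedAlgebra 𝒢] (L : LinearProblem 𝒢 s) :
    L.inv.IsHomog 𝒢 s :=
  ⟨L.inv_mem.1, L.inv_mem.2.1, L.inv_mem.2.2.1, L.inv_mem.2.2.2⟩

theorem SuperCommuting.swap_eq {f : C →ₐ[ℂ] B} {g : D →ₐ[ℂ] B} (h : SuperCommuting 𝒢 𝒟 f g)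
    {s t : ZMod 2} {x : C} (hx : x ∈ 𝒢 s) {y : D} (hy : y ∈ 𝒟 t) :
    g y * f x = sg (s * t) • (f x * g y) := by
  rw [h s t x hx y hy, ← sg_mul, smul_smul, sg_mul_self, one_smul]

theorem SuperCommuting.crossRel {f : C →ₐ[ℂ] B} {g : D →ₐ[ℂ] B} (h : SuperCommuting 𝒢 𝒟 f g)
    {x : Quad C} (hx : x.IsHomog 𝒢 s) {y : Quad D} (hy : y.IsHomog 𝒟 t) :
    CrossRel (sg (s * t)) (x.map f) (y.map g) := by
  have e0 : ∀ s : ZMod 2, sg (s * 0) = 1 := fun s => by rw [mul_zero]; rfl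
  have e1 : ∀ s : ZMod 2, sg (0 * s) = 1 := fun s => by rw [zero_mul]; rfl
  constructor <;> simp only [Quad.map]
  · rw [h.swap_eq hx.a hy.a, e0, one_smul]
  · rw [h.swap_eq hx.b hy.a, e0, one_smul]
  · rw [h.swap_eq hx.c hy.a, e0, one_smul]
  · rw [h.swap_eq hx.d hy.a, e0, one_smul]
  · rw [h.swap_eq hx.a hy.b, e1, one_smul]
  · rw [h.swap_eq hx.b hy.b]
  · rw [h.swap_eq hx.c hy.b]
  · rw [h.swap_eq hx.d hy.b, e1, one_smul]
  · rw [h.swap_eq hx.a hy.c, e1, one_smul]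
  · rw [h.swap_eq hx.b hy.c]
  · rw [h.swap_eq hx.c hy.c]
  · rw [h.swap_eq hx.d hy.c, e1, one_smul]
  · rw [h.swap_eq hx.a hy.d, e0, one_smul]
  · rw [h.swap_eq hx.b hy.d, e0, one_smul]
  · rw [h.swap_eq hx.c hy.d, e0, one_smul]
  · rw [h.swap_eq hx.d hy.d, e0, one_smul]

/-- Even elements commute with elements of the other factors. -/
theorem SuperCommuting.commute_left [GradedAlgebra 𝒟] {f : C →ₐ[ℂ] B} {g : D →ₐ[ℂ] B}
    (h : SuperCommuting 𝒢 𝒟 f g) {x : C} (hx : x ∈ 𝒢 0) (y : D) : f x * g y = g y * f x := by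
  obtain ⟨y₀, h₀, y₁, h₁, rfl⟩ := exists_add_eq 𝒟 y
  rw [map_add, mul_add, add_mul, h.swap_eq hx h₀, h.swap_eq hx h₁]
  simp [sg]

theorem SuperCommuting.commute_right [GradedAlgebra 𝒢] {f : C →ₐ[ℂ] B} {g : D →ₐ[ℂ] B}
    (h : SuperCommuting 𝒢 𝒟 f g) {y : D} (hy : y ∈ 𝒟 0) (x : C) : g y * f x = f x * g y := by
  obtain ⟨x₀, h₀, x₁, h₁, rfl⟩ := exists_add_eq 𝒢 x
  rw [map_add, mul_add, add_mul, h.swap_eq h₀ hy, h.swap_eq h₁ hy]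
  simp [sg]

variable {C₁ C₂ C₃ : Type u} [Ring C₁] [Algebra ℂ C₁] [Ring C₂] [Algebra ℂ C₂]
  [Ring C₃] [Algebra ℂ C₃]
  {𝒢₁ : ZMod 2 → Submodule ℂ C₁} {𝒢₂ : ZMod 2 → Submodule ℂ C₂} {𝒢₃ : ZMod 2 → Submodule ℂ C₃}
  {ℬ : ZMod 2 → Submodule ℂ B} {q : ℂ} {α β γ : ZMod 2}

/-- Shifting all parities by `α` makes the first line even and replaces `q` by `qp q α`. The eight
parity patterns thus reduce to the four that are covered by `TripleRel`. -/
theorem TensorEmbedding.tripleRel (T : TensorEmbedding 𝒢₁ 𝒢₂ 𝒢₃ ℬ) {x : Quad C₁} {y : Quad C₂}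
    {z : Quad C₃} (hx : x.IsHomog 𝒢₁ (α + β)) (hy : y.IsHomog 𝒢₂ (α + γ))
    (hz : z.IsHomog 𝒢₃ (β + γ)) (h₁ : LocalRel q α β x) (h₂ : LocalRel q α γ y)
    (h₃ : LocalRel q β γ z) :
    TripleRel (qp q α) (α + β) (α + γ) (x.map T.i₁) (y.map T.i₂) (z.map T.i₃) := by
  have e : α + β + (α + γ) = β + γ := by
    rw [add_add_add_comm, CharTwo.add_self_eq_zero, zero_add]
  have r₁ := (h₁.shift α).map T.i₁
  have r₂ := (h₂.shift α).map T.i₂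
  rw [CharTwo.add_self_eq_zero] at r₁ r₂
  exact ⟨r₁, r₂, (h₃.shift α).map T.i₃, T.comm₁₂.crossRel hx hy, e.symm ▸ T.comm₁₃.crossRel hx hz,
    e.symm ▸ T.comm₂₃.crossRel hy hz⟩

theorem monL_comm {x y z : Quad B} {g : B} (hx : x.Comm g) (hy : y.Comm g) (hz : z.Comm g)
    (i j : Fin 3) : g * monL x y z i j = monL x y z i j * g := by
  have m : ∀ {u v : B}, g * u = u * g → g * v = v * g → g * (u * v) = u * v * g := by
    intro u v hu hv
    rw [← mul_assoc, hu, mul_assoc, hv, mul_assoc]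
  have p : ∀ {u v : B}, g * u = u * g → g * v = v * g → g * (u + v) = (u + v) * g := by
    intro u v hu hv
    rw [mul_add, hu, hv, add_mul]
  fin_cases i <;> fin_cases j
  exacts [m hx.a hy.a, p (m hx.b hz.a) (m (m hx.a hy.b) hz.c),
    p (m hx.b hz.b) (m (m hx.a hy.b) hz.d), m hx.c hy.a, p (m hx.d hz.a) (m (m hx.c hy.b) hz.c),
    p (m hx.d hz.b) (m (m hx.c hy.b) hz.d), hy.c, m hy.d hz.c, m hy.d hz.d]

theorem monR_comm {x y z : Quad B} {g : B} (hx : x.Comm g) (hy : y.Comm g) (hz : z.Comm g)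
    (i j : Fin 3) : g * monR x y z i j = monR x y z i j * g := by
  have m : ∀ {u v : B}, g * u = u * g → g * v = v * g → g * (u * v) = u * v * g := by
    intro u v hu hv
    rw [← mul_assoc, hu, mul_assoc, hv, mul_assoc]
  have p : ∀ {u v : B}, g * u = u * g → g * v = v * g → g * (u + v) = (u + v) * g := by
    intro u v hu hv
    rw [mul_add, hu, hv, add_mul]
  fin_cases i <;> fin_cases j
  exacts [m hy.a hx.a, m hy.a hx.b, hy.b, p (m (m hz.b hy.c) hx.a) (m hz.a hx.c),
    p (m (m hz.b hy.c) hx.b) (m hz.a hx.d), m hz.b hy.d, p (m (m hz.d hy.c) hx.a) (m hz.c hx.c),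
    p (m (m hz.d hy.c) hx.b) (m hz.c hx.d), m hz.d hy.d]

theorem LinearProblem.mul_X_eq_monL {s₁ s₂ s₃ : ZMod 2} (L₁ : LinearProblem 𝒢₁ s₁)
    (L₂ : LinearProblem 𝒢₂ s₂) (L₃ : LinearProblem 𝒢₃ s₃) (f : C₁ →ₐ[ℂ] B) (g : C₂ →ₐ[ℂ] B)
    (h : C₃ →ₐ[ℂ] B) : L₁.Xαβ f * L₂.Xαγ g * L₃.Xβγ h
      = monL (L₁.quad.map f) (L₂.quad.map g) (L₃.quad.map h) :=
  mul_eq_monL (L₁.quad.map f) (L₂.quad.map g) (L₃.quad.map h)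

theorem LinearProblem.mul_X_eq_monR {s₁ s₂ s₃ : ZMod 2} (L₁ : LinearProblem 𝒢₁ s₁)
    (L₂ : LinearProblem 𝒢₂ s₂) (L₃ : LinearProblem 𝒢₃ s₃) (f : C₁ →ₐ[ℂ] B) (g : C₂ →ₐ[ℂ] B)
    (h : C₃ →ₐ[ℂ] B) : L₃.Xβγ h * L₂.Xαγ g * L₁.Xαβ f
      = monR (L₁.quad.map f) (L₂.quad.map g) (L₃.quad.map h) :=
  mul_eq_monR (L₁.quad.map f) (L₂.quad.map g) (L₃.quad.map h)

theorem map_monR {F : Type*} [Ring F] [Algebra ℂ F] (Φ : B →ₐ[ℂ] F) (x y z : Quad B)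
    (i j : Fin 3) : monR (x.map Φ) (y.map Φ) (z.map Φ) i j = Φ (monR x y z i j) := by
  fin_cases i <;> fin_cases j <;> simp [monR]

/-- Conjugation by a unit. -/
def conjUnit (R : Bˣ) : B ≃ₐ[ℂ] B where
  toFun x := R * x * ↑R⁻¹
  invFun x := ↑R⁻¹ * x * R
  left_inv x := by simp [mul_assoc]
  right_inv x := by simp [mul_assoc]
  map_mul' x y := by simp [mul_assoc]
  map_add' x y := by simp [mul_add, add_mul]
  commutes' k := by rw [← Algebra.commutes, mul_assoc, Units.mul_inv, mul_one]

theorem conjUnit_apply (R : Bˣ) (x : B) : conjUnit R x = R * x * ↑R⁻¹ := rfl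

theorem conjUnit_of_comm {R : Bˣ} {x y : B} (h : R * x = y * R) : conjUnit R x = y := by
  rw [conjUnit_apply, h, mul_assoc, Units.mul_inv, mul_one]

end Existence

/-! ### The tensor product of three Fock modules. -/

section FockTensor

variable {C₁ C₂ C₃ : Type u} [Ring C₁] [Algebra ℂ C₁] [Ring C₂] [Algebra ℂ C₂]
  [Ring C₃] [Algebra ℂ C₃]
  {𝒢₁ : ZMod 2 → Submodule ℂ C₁} {𝒢₂ : ZMod 2 → Submodule ℂ C₂} {𝒢₃ : ZMod 2 → Submodule ℂ C₃}
  [GradedAlgebra 𝒢₁] [GradedAlgebra 𝒢₂] [GradedAlgebra 𝒢₃]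
  {M₁ M₂ M₃ : Type u} [AddCommGroup M₁] [Module ℂ M₁] [AddCommGroup M₂] [Module ℂ M₂]
  [AddCommGroup M₃] [Module ℂ M₃]
  {ρ₁ : C₁ →ₐ[ℂ] Module.End ℂ M₁} {ρ₂ : C₂ →ₐ[ℂ] Module.End ℂ M₂} {ρ₃ : C₃ →ₐ[ℂ] Module.End ℂ M₃}
  {P₁ : Module.End ℂ M₁} {P₂ : Module.End ℂ M₂} {P₃ : Module.End ℂ M₃}

/-- The action of the graded tensor product of three superalgebras on the tensor product of
graded modules. -/
noncomputable def tensorRep (h₁ : GradedRep 𝒢₁ ρ₁ P₁) (h₂ : GradedRep 𝒢₂ ρ₂ P₂)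
    (h₃ : GradedRep 𝒢₃ ρ₃ P₃) (inj₁ : Function.Injective ρ₁) (inj₂ : Function.Injective ρ₂)
    (inj₃ : Function.Injective ρ₃) :
    TensorEmbedding (B := Module.End ℂ ((M₁ ⊗[ℂ] M₂) ⊗[ℂ] M₃)) 𝒢₁ 𝒢₂ 𝒢₃
      (endGrading (TensorProduct.map (TensorProduct.map P₁ P₂) P₃)) where
  i₁ := (Module.End.rTensorAlgHom ℂ (M₁ ⊗[ℂ] M₂) M₃).comp
    ((Module.End.rTensorAlgHom ℂ M₁ M₂).comp ρ₁)
  i₂ := (Module.End.rTensorAlgHom ℂ (M₁ ⊗[ℂ] M₂) M₃).comp (twist 𝒢₂ h₁.sq ρ₂)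
  i₃ := twist 𝒢₃ (h₁.left h₂.sq).sq ρ₃
  map_mem₁ _ _ hx := ((h₁.left h₂.sq).left h₃.sq).mem hx
  map_mem₂ _ _ hx := ((h₂.twist h₁.sq).left h₃.sq).mem hx
  map_mem₃ _ _ hx := (h₃.twist (h₁.left h₂.sq).sq).mem hx
  comm₁₂ s t x hx y hy := by
    have := congrArg (Module.End.rTensorAlgHom ℂ (M₁ ⊗[ℂ] M₂) M₃)
      (h₁.superCommuting (𝒟 := 𝒢₂) ρ₂ s t x hx y hy)
    rwa [map_mul, map_smul, map_mul] at this
  comm₁₃ := (h₁.left h₂.sq).superCommuting ρ₃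
  comm₂₃ := (h₂.twist h₁.sq).superCommuting ρ₃
  injective := by
    have e : LinearMap.mul' ℂ (Module.End ℂ ((M₁ ⊗[ℂ] M₂) ⊗[ℂ] M₃)) ∘ₗ TensorProduct.map
        ((Module.End.rTensorAlgHom ℂ (M₁ ⊗[ℂ] M₂) M₃).comp
          ((Module.End.rTensorAlgHom ℂ M₁ M₂).comp ρ₁)).toLinearMap
        ((Module.End.rTensorAlgHom ℂ (M₁ ⊗[ℂ] M₂) M₃).comp (twist 𝒢₂ h₁.sq ρ₂)).toLinearMap
        = (Module.End.rTensorAlgHom ℂ (M₁ ⊗[ℂ] M₂) M₃).toLinearMap ∘ₗ (LinearMap.mul' ℂ _ ∘ₗ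
          TensorProduct.map ((Module.End.rTensorAlgHom ℂ M₁ M₂).toLinearMap ∘ₗ ρ₁.toLinearMap)
            (twist 𝒢₂ h₁.sq ρ₂).toLinearMap) :=
      TensorProduct.ext' fun x y => (map_mul (Module.End.rTensorAlgHom ℂ (M₁ ⊗[ℂ] M₂) M₃) _ _).symm
    rw [e]
    exact h₃.mul_twist_injective
      (h₂.mul_twist_injective (g := ρ₁.toLinearMap) inj₁ h₁.sq inj₂) _ inj₃

/-- The tensor factors are filled one after the other. Raising in a later factor also applies a sign
operator to the earlier ones, so the induction there runs over all vectors of the earlier factors at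
once. -/
theorem tensorRep_gen (h₁ : GradedRep 𝒢₁ ρ₁ P₁) (h₂ : GradedRep 𝒢₂ ρ₂ P₂)
    (h₃ : GradedRep 𝒢₃ ρ₃ P₃) (inj₁ : Function.Injective ρ₁) (inj₂ : Function.Injective ρ₂)
    (inj₃ : Function.Injective ρ₃) {x : Quad C₁} {y : Quad C₂} {z : Quad C₃} {t u : ZMod 2}
    (hy : y.IsHomog 𝒢₂ t) (hz : z.IsHomog 𝒢₃ u)
    (gen₁ : ∀ p : Submodule ℂ M₁, LinearMap.ker (ρ₁ x.c) ≤ p → (∀ v ∈ p, ρ₁ x.b v ∈ p) → p = ⊤)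
    (gen₂ : ∀ p : Submodule ℂ M₂, LinearMap.ker (ρ₂ y.c) ≤ p → (∀ v ∈ p, ρ₂ y.b v ∈ p) → p = ⊤)
    (gen₃ : ∀ p : Submodule ℂ M₃, LinearMap.ker (ρ₃ z.c) ≤ p → (∀ v ∈ p, ρ₃ z.b v ∈ p) → p = ⊤)
    (p : Submodule ℂ ((M₁ ⊗[ℂ] M₂) ⊗[ℂ] M₃))
    (hp : vac (x.map (tensorRep h₁ h₂ h₃ inj₁ inj₂ inj₃).i₁)
      (y.map (tensorRep h₁ h₂ h₃ inj₁ inj₂ inj₃).i₂)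
      (z.map (tensorRep h₁ h₂ h₃ inj₁ inj₂ inj₃).i₃) ≤ p)
    (hb₁ : ∀ v ∈ p, (tensorRep h₁ h₂ h₃ inj₁ inj₂ inj₃).i₁ x.b v ∈ p)
    (hb₂ : ∀ v ∈ p, (tensorRep h₁ h₂ h₃ inj₁ inj₂ inj₃).i₂ y.b v ∈ p)
    (hb₃ : ∀ v ∈ p, (tensorRep h₁ h₂ h₃ inj₁ inj₂ inj₃).i₃ z.b v ∈ p) : p = ⊤ := by
  have P12 := (h₁.left h₂.sq).sq
  have a₁ (w : C₁) (m₁ : M₁) (m₂ : M₂) (m₃ : M₃) :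
      (tensorRep h₁ h₂ h₃ inj₁ inj₂ inj₃).i₁ w (m₁ ⊗ₜ m₂ ⊗ₜ m₃) = ρ₁ w m₁ ⊗ₜ m₂ ⊗ₜ m₃ := rfl
  have a₂ {w : C₂} {t : ZMod 2} (hw : w ∈ 𝒢₂ t) (m₁ : M₁) (m₂ : M₂) (m₃ : M₃) :
      (tensorRep h₁ h₂ h₃ inj₁ inj₂ inj₃).i₂ w (m₁ ⊗ₜ m₂ ⊗ₜ m₃)
        = signOp P₁ t m₁ ⊗ₜ ρ₂ w m₂ ⊗ₜ m₃ := by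
    change twist 𝒢₂ h₁.sq ρ₂ w (m₁ ⊗ₜ m₂) ⊗ₜ m₃ = _
    rw [twist_of_mem h₁.sq ρ₂ hw]; rfl
  have a₃ {w : C₃} {t : ZMod 2} (hw : w ∈ 𝒢₃ t) (m : M₁ ⊗[ℂ] M₂) (m₃ : M₃) :
      (tensorRep h₁ h₂ h₃ inj₁ inj₂ inj₃).i₃ w (m ⊗ₜ m₃)
        = signOp (TensorProduct.map P₁ P₂) t m ⊗ₜ ρ₃ w m₃ := by
    change twist 𝒢₃ P12 ρ₃ w (m ⊗ₜ m₃) = _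
    rw [twist_of_mem P12 ρ₃ hw]; rfl
  have s₁ : ∀ m₁ m₂ m₃, ρ₂ y.c m₂ = 0 → ρ₃ z.c m₃ = 0 → m₁ ⊗ₜ m₂ ⊗ₜ m₃ ∈ p := by
    intro m₁ m₂ m₃ h₂' h₃'
    have := gen₁ (p.comap ((TensorProduct.mk ℂ _ M₃).flip m₃ ∘ₗ (TensorProduct.mk ℂ M₁ M₂).flip m₂))
      (fun m hm => hp ?_) fun m hm => hb₁ _ hm
    · exact (this.symm ▸ Submodule.mem_top : m₁ ∈ _)
    · rw [mem_vac]
      change (tensorRep h₁ h₂ h₃ inj₁ inj₂ inj₃).i₁ x.c (m ⊗ₜ m₂ ⊗ₜ m₃) = 0 ∧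
        (tensorRep h₁ h₂ h₃ inj₁ inj₂ inj₃).i₂ y.c (m ⊗ₜ m₂ ⊗ₜ m₃) = 0 ∧
        (tensorRep h₁ h₂ h₃ inj₁ inj₂ inj₃).i₃ z.c (m ⊗ₜ m₂ ⊗ₜ m₃) = 0
      rw [a₁, a₂ hy.c, a₃ hz.c, LinearMap.mem_ker.1 hm, h₂', h₃']
      simp
  have s₂ : ∀ m₂ m₁ m₃, ρ₃ z.c m₃ = 0 → m₁ ⊗ₜ m₂ ⊗ₜ m₃ ∈ p := by
    intro m₂ m₁ m₃ h₃'
    have := gen₂ (⨅ m₁ : M₁, p.comap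
      ((TensorProduct.mk ℂ _ M₃).flip m₃ ∘ₗ TensorProduct.mk ℂ M₁ M₂ m₁))
      (fun m hm => (Submodule.mem_iInf _).2 fun m₁ => s₁ m₁ m m₃ hm h₃') fun m hm => ?_
    · exact (Submodule.mem_iInf _).1 (this.symm ▸ Submodule.mem_top : m₂ ∈ _) m₁
    · rw [Submodule.mem_iInf] at hm ⊢
      intro m₁
      -- Starting from `signOp P₁ t m₁`, the sign operator is applied twice and disappears.
      have := hb₂ _ (hm (signOp P₁ t m₁))
      change (tensorRep h₁ h₂ h₃ inj₁ inj₂ inj₃).i₂ y.b (signOp P₁ t m₁ ⊗ₜ m ⊗ₜ m₃) ∈ p at this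
      rw [a₂ hy.b, ← Module.End.mul_apply, signOp_mul_self h₁.sq] at this
      exact this
  have s₃ : ∀ m₃ m, m ⊗ₜ m₃ ∈ p := by
    intro m₃
    have := gen₃ (⨅ m : M₁ ⊗[ℂ] M₂, p.comap (TensorProduct.mk ℂ _ M₃ m))
      (fun m₃ hm₃ => (Submodule.mem_iInf _).2 fun m => ?_) fun m₃ hm₃ => ?_
    · exact fun m => (Submodule.mem_iInf _).1 (this.symm ▸ Submodule.mem_top : m₃ ∈ _) m
    · induction m using TensorProduct.induction_on with
      | zero => simp
      | tmul m₁ m₂ => exact s₂ m₂ m₁ m₃ hm₃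
      | add m m' h h' =>
        rw [Submodule.mem_comap, map_add, LinearMap.add_apply]
        exact p.add_mem h h'
    · rw [Submodule.mem_iInf] at hm₃ ⊢
      intro m
      have := hb₃ _ (hm₃ (signOp (TensorProduct.map P₁ P₂) u m))
      change (tensorRep h₁ h₂ h₃ inj₁ inj₂ inj₃).i₃ z.b (signOp _ u m ⊗ₜ m₃) ∈ p at this
      rw [a₃ hz.b, ← Module.End.mul_apply, signOp_mul_self P12] at this
      exact this
  rw [eq_top_iff, ← TensorProduct.span_tmul_eq_top, Submodule.span_le]
  rintro _ ⟨m, m₃, rfl⟩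
  exact s₃ m₃ m

end FockTensor

/-! ### Construction of the center-fixing automorphism. -/

section

variable {C₁ C₂ C₃ : Type u} [Ring C₁] [Algebra ℂ C₁] [Ring C₂] [Algebra ℂ C₂]
  [Ring C₃] [Algebra ℂ C₃]
  {𝒢₁ : ZMod 2 → Submodule ℂ C₁} {𝒢₂ : ZMod 2 → Submodule ℂ C₂} {𝒢₃ : ZMod 2 → Submodule ℂ C₃}
  [GradedAlgebra 𝒢₁] [GradedAlgebra 𝒢₂] [GradedAlgebra 𝒢₃] {q : ℂ} {α β γ : ZMod 2}

theorem LinearProblem.ker_inv_c {C : Type u} [Ring C] [Algebra ℂ C]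
    {𝒢 : ZMod 2 → Submodule ℂ C} {s : ZMod 2} (L : LinearProblem 𝒢 s) {z : Cˣ}
    (hz : L.inv.c = z * L.c) {V : Type*} [AddCommGroup V] [Module ℂ V]
    (f : C →ₐ[ℂ] Module.End ℂ V) (v : V) : f L.inv.c v = 0 ↔ f L.c v = 0 := by
  rw [hz, map_mul, Module.End.mul_apply]
  refine ⟨fun h => ?_, fun h => by rw [h, map_zero]⟩
  have := congrArg (f ↑z⁻¹) h
  rwa [← Module.End.mul_apply, ← map_mul, Units.inv_mul, map_one, map_zero] at this

/-- Multiplying the raising operator by a central unit does not change the generated space. -/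
theorem eq_top_of_unit_mul {C : Type u} [Ring C] [Algebra ℂ C] {M : Type u} [AddCommGroup M]
    [Module ℂ M] {ρ : C →ₐ[ℂ] Module.End ℂ M} {b c b' c' : C} {z : Cˣ} (hb : b' = z * b)
    (hzb : (z : C) * b = b * z) (hzc : (z : C) * c = c * z) (hc : ∀ v, ρ c' v = 0 ↔ ρ c v = 0)
    (gen : ∀ p : Submodule ℂ M, LinearMap.ker (ρ c) ≤ p → (∀ v ∈ p, ρ b v ∈ p) → p = ⊤)
    (p : Submodule ℂ M) (hp : LinearMap.ker (ρ c') ≤ p) (hbp : ∀ v ∈ p, ρ b' v ∈ p) : p = ⊤ := by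
  let N : Submodule ℂ M := sInf {p | LinearMap.ker (ρ c) ≤ p ∧ ∀ v ∈ p, ρ b' v ∈ p}
  have hN : ∀ v, ρ c v = 0 → v ∈ N := fun v hv => Submodule.mem_sInf.2 fun p hp => hp.1 hv
  have hNb : ∀ v ∈ N, ρ b' v ∈ N := fun v hv =>
    Submodule.mem_sInf.2 fun p hp => hp.2 v (Submodule.mem_sInf.1 hv p hp)
  have hNp : ∀ p : Submodule ℂ M, LinearMap.ker (ρ c) ≤ p → (∀ v ∈ p, ρ b' v ∈ p) → N ≤ p :=
    fun p h₁ h₂ => sInf_le ⟨h₁, h₂⟩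
  have hzb' : (↑z⁻¹ : C) * b' = b' * ↑z⁻¹ := by
    have : Commute (z : C) b' := by
      rw [hb]; exact (Commute.refl (z : C)).mul_right hzb
    exact this.units_inv_left.eq
  have hzc' : c * (↑z⁻¹ : C) = ↑z⁻¹ * c :=
    (show Commute (z : C) c from hzc).units_inv_left.eq.symm
  have hz : ∀ v ∈ N, ρ ↑z⁻¹ v ∈ N := by
    refine hNp (N.comap (ρ ↑z⁻¹)) (fun v hv => hN _ ?_) fun v hv => ?_
    · rw [← Module.End.mul_apply, ← map_mul, hzc', map_mul, Module.End.mul_apply, hv, map_zero]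
    · rw [Submodule.mem_comap, ← Module.End.mul_apply, ← map_mul, hzb', map_mul]
      exact hNb _ hv
  have hNtop : N = ⊤ := gen N (fun v hv => hN v hv) fun v hv => by
    have := hz _ (hNb v hv)
    rwa [← Module.End.mul_apply, ← map_mul, hb, Units.inv_mul_cancel_left] at this
  rw [eq_top_iff, ← hNtop]
  exact hNp p (fun v hv => hp ((hc v).2 hv)) hbp

/-- Corresponding raising entries of the two matrices have equal parity, so the parity operator
satisfies the conditions under which an operator commutes with the intertwiner. -/
theorem endGrading_pow {V : Type u} [AddCommGroup V] [Module ℂ V] {P : Module.End ℂ V}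
    {x y z : Quad (Module.End ℂ V)} {s u : ZMod 2} (hx : x.IsHomog (C := Module.End ℂ _) (endGrading P) s)
    (hy : y.IsHomog (C := Module.End ℂ _) (endGrading P) u) (hz : z.IsHomog (endGrading P) (s + u)) :
    (monR x y z 0 1 ∈ endGrading P s ∧ monL x y z 0 1 ∈ endGrading P s) ∧
    (monR x y z 0 2 ∈ endGrading P u ∧ monL x y z 0 2 ∈ endGrading P u) ∧
    (monR x y z 1 2 ∈ endGrading P (s + u) ∧ monL x y z 1 2 ∈ endGrading P (s + u)) := by
  have two : ∀ t : ZMod 2, t + t = 0 := CharTwo.add_self_eq_zero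
  have m {f g : Module.End ℂ V} {i j k : ZMod 2} (hf : f ∈ endGrading P i)
      (hg : g ∈ endGrading P j) (e : i + j = k) : f * g ∈ endGrading P k := e ▸ endGrading_mul hf hg
  refine ⟨⟨m hy.a hx.b (zero_add _), ?_⟩, ⟨hy.b, ?_⟩, ⟨m hz.b hy.d (add_zero _), ?_⟩⟩
  · refine Submodule.add_mem _ (m hx.b hz.a (add_zero _)) (m (m hx.a hy.b (zero_add _)) hz.c ?_)
    rw [add_left_comm, two, add_zero]
  · exact Submodule.add_mem _ (m hx.b hz.b (by rw [← add_assoc, two, zero_add]))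
      (m (m hx.a hy.b (zero_add _)) hz.d (add_zero _))
  · exact Submodule.add_mem _ (m hx.d hz.b (zero_add _)) (m (m hx.c hy.b rfl) hz.d (add_zero _))

theorem TensorEmbedding.zeroCurvature_conjUnit {B : Type u} [Ring B] [Algebra ℂ B]
    {ℬ : ZMod 2 → Submodule ℂ B} (T : TensorEmbedding 𝒢₁ 𝒢₂ 𝒢₃ ℬ) {s₁ s₂ s₃ : ZMod 2}
    (L₁ : LinearProblem 𝒢₁ s₁) (L₂ : LinearProblem 𝒢₂ s₂) (L₃ : LinearProblem 𝒢₃ s₃) {R : Bˣ}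
    (hR : ∀ i j, ↑R * monR (L₁.quad.map T.i₁) (L₂.quad.map T.i₂) (L₃.quad.map T.i₃) i j
      = monL (L₁.quad.map T.i₁) (L₂.quad.map T.i₂) (L₃.quad.map T.i₃) i j * ↑R) :
    L₁.Xαβ T.i₁ * L₂.Xαγ T.i₂ * L₃.Xβγ T.i₃ =
      L₃.Xβγ ((conjUnit R).toAlgHom.comp T.i₃) * L₂.Xαγ ((conjUnit R).toAlgHom.comp T.i₂) *
        L₁.Xαβ ((conjUnit R).toAlgHom.comp T.i₁) := by
  rw [LinearProblem.mul_X_eq_monL]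
  refine Eq.trans ?_ (LinearProblem.mul_X_eq_monR L₁ L₂ L₃ _ _ _).symm
  ext1 i j
  exact (conjUnit_of_comm (hR i j)).symm.trans (map_monR (conjUnit R).toAlgHom
    (L₁.quad.map T.i₁) (L₂.quad.map T.i₂) (L₃.quad.map T.i₃) i j).symm

/-- The local algebras of the Bose and Fermi problems admit an automorphism that solves the zero
curvature equation. -/
theorem providesCentralAutomorphism (hq : q ≠ 0) (hroot : ∀ n : ℕ, 0 < n → q ^ n ≠ 1)
    (L₁ : LinearProblem 𝒢₁ (α + β)) (L₂ : LinearProblem 𝒢₂ (α + γ))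
    (L₃ : LinearProblem 𝒢₃ (β + γ)) (h₁ : LocalRel q α β L₁.quad) (h₂ : LocalRel q α γ L₂.quad)
    (h₃ : LocalRel q β γ L₃.quad) : ProvidesCentralAutomorphism L₁ L₂ L₃ := by
  obtain ⟨M₁, _, _, ρ₁, P₁, inj₁, sq₁, conj₁, gen₁⟩ := L₁.exists_fock hq hroot h₁
  obtain ⟨M₂, _, _, ρ₂, P₂, inj₂, sq₂, conj₂, gen₂⟩ := L₂.exists_fock hq hroot h₂
  obtain ⟨M₃, _, _, ρ₃, P₃, inj₃, sq₃, conj₃, gen₃⟩ := L₃.exists_fock hq hroot h₃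
  have g₁ : GradedRep 𝒢₁ ρ₁ P₁ := ⟨sq₁, conj₁⟩
  have g₂ : GradedRep 𝒢₂ ρ₂ P₂ := ⟨sq₂, conj₂⟩
  have g₃ : GradedRep 𝒢₃ ρ₃ P₃ := ⟨sq₃, conj₃⟩
  let P : Module.End ℂ ((M₁ ⊗[ℂ] M₂) ⊗[ℂ] M₃) := TensorProduct.map (TensorProduct.map P₁ P₂) P₃
  let T := tensorRep g₁ g₂ g₃ inj₁ inj₂ inj₃
  have hP : P * P = 1 := ((g₁.left g₂.sq).left g₃.sq).sq
  obtain ⟨i₁, ia₁, id₁, z₁, hz₁, hb₁, hc₁⟩ := L₁.inv_spec hq hroot h₁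
  obtain ⟨i₂, ia₂, id₂, z₂, hz₂, hb₂, hc₂⟩ := L₂.inv_spec hq hroot h₂
  obtain ⟨i₃, ia₃, id₃, z₃, hz₃, hb₃, hc₃⟩ := L₃.inv_spec hq hroot h₃
  have ker₁ {V : Type u} [AddCommGroup V] [Module ℂ V] := L₁.ker_inv_c hc₁ (V := V)
  have ker₂ {V : Type u} [AddCommGroup V] [Module ℂ V] := L₂.ker_inv_c hc₂ (V := V)
  have ker₃ {V : Type u} [AddCommGroup V] [Module ℂ V] := L₃.ker_inv_c hc₃ (V := V)
  have F : FockRep (qp q α) (α + β) (α + γ) (L₁.quad.map T.i₁) (L₂.quad.map T.i₂)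
      (L₃.quad.map T.i₃) :=
    ⟨T.tripleRel L₁.isHomog L₂.isHomog L₃.isHomog h₁ h₂ h₃, L₁.isUnit_a.map T.i₁,
      L₁.isUnit_d.map T.i₁, L₂.isUnit_a.map T.i₂, L₂.isUnit_d.map T.i₂, L₃.isUnit_a.map T.i₃,
      L₃.isUnit_d.map T.i₃,
      tensorRep_gen g₁ g₂ g₃ inj₁ inj₂ inj₃ L₂.isHomog L₃.isHomog gen₁ gen₂ gen₃⟩
  have F' : FockRep (qp q α) (α + β) (α + γ) (L₁.inv.map T.i₁) (L₂.inv.map T.i₂)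
      (L₃.inv.map T.i₃) :=
    ⟨T.tripleRel L₁.inv_isHomog L₂.inv_isHomog L₃.inv_isHomog i₁ i₂ i₃, ia₁.map T.i₁,
      id₁.map T.i₁, ia₂.map T.i₂, id₂.map T.i₂, ia₃.map T.i₃, id₃.map T.i₃,
      tensorRep_gen g₁ g₂ g₃ inj₁ inj₂ inj₃ L₂.inv_isHomog L₃.inv_isHomog
        (eq_top_of_unit_mul hb₁ hz₁.b hz₁.c (ker₁ ρ₁) gen₁) (eq_top_of_unit_mul hb₂ hz₂.b hz₂.c (ker₂ ρ₂) gen₂)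
        (eq_top_of_unit_mul hb₃ hz₃.b hz₃.c (ker₃ ρ₃) gen₃)⟩
  have hvac : vac (L₁.inv.map T.i₁) (L₂.inv.map T.i₂) (L₃.inv.map T.i₃)
      = vac (L₁.quad.map T.i₁) (L₂.quad.map T.i₂) (L₃.quad.map T.i₃) := by
    ext v
    rw [mem_vac, mem_vac]
    exact and_congr (ker₁ _ v) (and_congr (ker₂ _ v) (ker₃ _ v))
  have v₁ := L₁.isInv.map (F := Module.End ℂ ((M₁ ⊗[ℂ] M₂) ⊗[ℂ] M₃)) T.i₁
  have v₂ := L₂.isInv.map (F := Module.End ℂ ((M₁ ⊗[ℂ] M₂) ⊗[ℂ] M₃)) T.i₂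
  have v₃ := L₃.isInv.map (F := Module.End ℂ ((M₁ ⊗[ℂ] M₂) ⊗[ℂ] M₃)) T.i₃
  obtain ⟨R, hR, hRG⟩ := exists_unit_intertwiner (qp_ne_zero hq α) (qp_pow_ne_one hroot α) F F'
    v₁ v₂ v₃ hvac
  have comm {G : Module.End ℂ ((M₁ ⊗[ℂ] M₂) ⊗[ℂ] M₃)} (c₁ : (L₁.quad.map T.i₁).Comm G)
      (c₂ : (L₂.quad.map T.i₂).Comm G) (c₃ : (L₃.quad.map T.i₃).Comm G) : ↑R * G = G * ↑R := by
    refine hRG G 1 1 1 ?_ ?_ ?_ ?_ ?_ ?_ ?_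
    · exact vac_map_mem (k₁ := 1) (k₂ := 1) (k₃ := 1) (by rw [c₁.c, one_smul])
        (by rw [c₂.c, one_smul]) (by rw [c₃.c, one_smul])
    all_goals rw [one_smul]
    exacts [monR_comm c₁ c₂ c₃ _ _, monL_comm c₁ c₂ c₃ _ _, monR_comm c₁ c₂ c₃ _ _,
      monL_comm c₁ c₂ c₃ _ _, monR_comm c₁ c₂ c₃ _ _, monL_comm c₁ c₂ c₃ _ _]
  -- Commutation with the parity operator is what makes conjugation by `R` preserve parity.
  have hRP : ↑R * P = P * ↑R := by
    have e : α + β + (α + γ) = β + γ := by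
      rw [add_add_add_comm, CharTwo.add_self_eq_zero, zero_add]
    have H₁ : Quad.IsHomog (C := Module.End ℂ ((M₁ ⊗[ℂ] M₂) ⊗[ℂ] M₃)) (endGrading P) (α + β)
        (L₁.quad.map T.i₁) :=
      ⟨T.map_mem₁ _ _ L₁.a_mem, T.map_mem₁ _ _ L₁.b_mem, T.map_mem₁ _ _ L₁.c_mem,
        T.map_mem₁ _ _ L₁.d_mem⟩
    have H₂ : Quad.IsHomog (C := Module.End ℂ ((M₁ ⊗[ℂ] M₂) ⊗[ℂ] M₃)) (endGrading P) (α + γ)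
        (L₂.quad.map T.i₂) :=
      ⟨T.map_mem₂ _ _ L₂.a_mem, T.map_mem₂ _ _ L₂.b_mem, T.map_mem₂ _ _ L₂.c_mem,
        T.map_mem₂ _ _ L₂.d_mem⟩
    have H₃ : Quad.IsHomog (C := Module.End ℂ ((M₁ ⊗[ℂ] M₂) ⊗[ℂ] M₃)) (endGrading P) (β + γ)
        (L₃.quad.map T.i₃) :=
      ⟨T.map_mem₃ _ _ L₃.a_mem, T.map_mem₃ _ _ L₃.b_mem, T.map_mem₃ _ _ L₃.c_mem,
        T.map_mem₃ _ _ L₃.d_mem⟩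
    obtain ⟨⟨e₁, e₂⟩, ⟨e₃, e₄⟩, e₅, e₆⟩ := endGrading_pow H₁ H₂ (by rw [e]; exact H₃)
    have flip {f : Module.End ℂ ((M₁ ⊗[ℂ] M₂) ⊗[ℂ] M₃)} {s : ZMod 2} (hf : f ∈ endGrading P s) :
        f * P = sg s • (P * f) := by
      rw [mem_endGrading.1 hf, smul_smul, sg_mul_self, one_smul]
    exact hRG P _ _ _ (vac_map_mem (flip H₁.c) (flip H₂.c) (flip H₃.c)) e₁ e₂ e₃ e₄ e₅ e₆
  refine ⟨Module.End ℂ ((M₁ ⊗[ℂ] M₂) ⊗[ℂ] M₃), inferInstance, inferInstance, endGrading P,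
    endGradedAlgebra hP, T, conjUnit R, ⟨?_, ?_⟩, ?_, ?_, ?_⟩
  · intro s x hx
    have hPR : P * (↑R⁻¹ : Module.End ℂ ((M₁ ⊗[ℂ] M₂) ⊗[ℂ] M₃)) =
        (↑R⁻¹ : Module.End ℂ ((M₁ ⊗[ℂ] M₂) ⊗[ℂ] M₃)) * P :=
      ((show Commute (R : Module.End ℂ ((M₁ ⊗[ℂ] M₂) ⊗[ℂ] M₃)) P from hRP).units_inv_left.eq).symm
    rw [mem_endGrading] at hx ⊢
    rw [conjUnit_apply, ← mul_assoc, ← mul_assoc, ← hRP, mul_assoc _ P, hx, mul_assoc _ _ P, ← hPR,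
      mul_smul_comm, smul_mul_assoc]
    simp only [mul_assoc]
  · exact T.zeroCurvature_conjUnit L₁ L₂ L₃ hR
  · intro z hz
    -- Being even, a central element of one local algebra commutes with the other two factors as
    -- well, not just up to sign.
    have hz0 := L₁.mem_of_mem_center hq hroot h₁ hz
    refine conjUnit_of_comm (comm ?_ ?_ ?_)
    · obtain ⟨k₁, k₂, k₃, k₄⟩ := L₁.comm_of_mem_center hz
      exact ⟨by simpa using congrArg T.i₁ k₁, by simpa using congrArg T.i₁ k₂,
        by simpa using congrArg T.i₁ k₃, by simpa using congrArg T.i₁ k₄⟩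
    · constructor <;> exact T.comm₁₂.commute_left hz0 _
    · constructor <;> exact T.comm₁₃.commute_left hz0 _
  · intro z hz
    have hz0 := L₂.mem_of_mem_center hq hroot h₂ hz
    refine conjUnit_of_comm (comm ?_ ?_ ?_)
    · constructor <;> exact T.comm₁₂.commute_right hz0 _
    · obtain ⟨k₁, k₂, k₃, k₄⟩ := L₂.comm_of_mem_center hz
      exact ⟨by simpa using congrArg T.i₂ k₁, by simpa using congrArg T.i₂ k₂,
        by simpa using congrArg T.i₂ k₃, by simpa using congrArg T.i₂ k₄⟩
    · constructor <;> exact T.comm₂₃.commute_left hz0 _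
  · intro z hz
    have hz0 := L₃.mem_of_mem_center hq hroot h₃ hz
    refine conjUnit_of_comm (comm ?_ ?_ ?_)
    · constructor <;> exact T.comm₁₃.commute_right hz0 _
    · constructor <;> exact T.comm₂₃.commute_right hz0 _
    · obtain ⟨k₁, k₂, k₃, k₄⟩ := L₃.comm_of_mem_center hz
      exact ⟨by simpa using congrArg T.i₃ k₁, by simpa using congrArg T.i₃ k₂,
        by simpa using congrArg T.i₃ k₃, by simpa using congrArg T.i₃ k₄⟩

end

/-! ### Uniqueness: the subalgebra on which two solutions agree. -/

section FixedSubalgebra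

variable {C : Type u} [Ring C] [Algebra ℂ C] {𝒢 : ZMod 2 → Submodule ℂ C}
  {B : Type u} [Ring B] [Algebra ℂ B] {q : ℂ} {s t : ZMod 2}

/-- The elements on which two homomorphisms agree are closed under inverses. -/
theorem inv_mem_equalizer {f g : B →ₐ[ℂ] B} {u : Bˣ} (h : (u : B) ∈ AlgHom.equalizer f g) :
    (↑u⁻¹ : B) ∈ AlgHom.equalizer f g := by
  rw [AlgHom.mem_equalizer] at h ⊢
  refine left_inv_eq_right_inv (a := f u) ?_ ?_
  · rw [← map_mul, Units.inv_mul, map_one]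
  · rw [h, ← map_mul, Units.mul_inv, map_one]

theorem mem_equalizer_of_mul {f g : B →ₐ[ℂ] B} {u v : B} (hu : IsUnit u)
    (h : u ∈ AlgHom.equalizer f g) (huv : u * v ∈ AlgHom.equalizer f g) :
    v ∈ AlgHom.equalizer f g := by
  obtain ⟨u, rfl⟩ := hu
  have := mul_mem (inv_mem_equalizer h) huv
  rwa [Units.inv_mul_cancel_left] at this

theorem mem_equalizer_of_mul' {f g : B →ₐ[ℂ] B} {u v : B} (hu : IsUnit u)
    (h : u ∈ AlgHom.equalizer f g) (hvu : v * u ∈ AlgHom.equalizer f g) :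
    v ∈ AlgHom.equalizer f g := by
  obtain ⟨u, rfl⟩ := hu
  have := mul_mem hvu (inv_mem_equalizer h)
  rwa [Units.mul_inv_cancel_right] at this

/-- The central units of an odd problem and its off-diagonal coefficients determine the diagonal
coefficients. -/
theorem LinearProblem.mem_equalizer_of_odd (L : LinearProblem 𝒢 (s + t)) (hq : q ≠ 0)
    (hroot : ∀ n : ℕ, 0 < n → q ^ n ≠ 1) (hst : s ≠ t) (h : LocalRel q s t L.quad)
    {i : C →ₐ[ℂ] B} {f g : B →ₐ[ℂ] B}
    (hc : ∀ z ∈ Subalgebra.center ℂ C, i z ∈ AlgHom.equalizer f g)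
    (hbc : i (L.b * L.c) ∈ AlgHom.equalizer f g) :
    (i L.a ∈ AlgHom.equalizer f g ∧ i L.d ∈ AlgHom.equalizer f g) ∧
      i L.inv.a ∈ AlgHom.equalizer f g ∧ i L.inv.d ∈ AlgHom.equalizer f g := by
  obtain ⟨l, m, e, H, hinv⟩ := L.inv_of_odd hq hroot hst h
  have hl := hc _ (L.mem_center H.comm_l)
  have hm := hc _ (L.mem_center H.comm_m)
  have hl' := hc _ (L.mem_center H.comm_l.inv)
  have hm' := hc _ (L.mem_center H.comm_m.inv)
  -- The idempotent is recovered from `bc` by dividing by the central unit `l m` and the scalar `Q -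
  -- Q⁻¹`.
  have he : i e ∈ AlgHom.equalizer f g := by
    have hk := qp_sub_inv_ne_zero hq hroot s
    have h₁ : i (l * m * e) ∈ AlgHom.equalizer f g := by
      have : L.b * L.c = _ := H.bc_eq
      rw [this, map_smul] at hbc
      have := Subalgebra.smul_mem _ hbc (qp q s - (qp q s)⁻¹)⁻¹
      rwa [smul_smul, inv_mul_cancel₀ hk, one_smul] at this
    rw [map_mul, map_mul] at h₁
    exact mem_equalizer_of_mul ((l.isUnit.map i).mul (m.isUnit.map i)) (mul_mem hl hm) h₁
  have h1e (k : ℂ) : i (1 + k • e) ∈ AlgHom.equalizer f g := by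
    rw [map_add, map_one, map_smul]
    exact add_mem (one_mem _) (Subalgebra.smul_mem _ he k)
  refine ⟨⟨?_, ?_⟩, ?_, ?_⟩
  · rw [show L.a = _ from H.a_eq, map_mul]; exact mul_mem hl (h1e _)
  · rw [show L.d = _ from H.d_eq, map_mul]; exact mul_mem hm (h1e _)
  · rw [hinv, fermiInv, map_mul]; exact mul_mem hl' (h1e _)
  · rw [hinv, fermiInv, map_smul, map_mul]
    exact Subalgebra.smul_mem _ (mul_mem hm' (h1e _)) _

/-- The diagonal coefficients of the inverse of an even problem are proportional to the diagonal
coefficients, with central factors. -/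
theorem LinearProblem.inv_diag_of_even (L : LinearProblem 𝒢 (s + s)) (hq : q ≠ 0)
    (h : LocalRel q s s L.quad) : ∃ v w : Cˣ, L.quad.Comm v ∧ L.quad.Comm w ∧
      L.inv.a = v * L.d ∧ L.inv.d = w * L.a := by
  have hs := qp_ne_zero hq s
  obtain ⟨D, -, hc, e⟩ := L.inv_of_even hq h
  obtain ⟨v, hv⟩ := isUnit_smul' (D⁻¹).isUnit (neg_ne_zero.2 (inv_ne_zero hs))
  obtain ⟨w, hw⟩ := isUnit_smul' (D⁻¹).isUnit (neg_ne_zero.2 hs)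
  refine ⟨v, w, ?_, ?_, ?_, ?_⟩
  · rw [hv]; exact hc.smul _
  · rw [hw]; exact hc.smul _
  · rw [e, hv, smul_mul_assoc]; rfl
  · rw [e, hw, smul_mul_assoc]; rfl

end FixedSubalgebra

section Uniqueness

variable {C₁ C₂ C₃ : Type u} [Ring C₁] [Algebra ℂ C₁] [Ring C₂] [Algebra ℂ C₂]
  [Ring C₃] [Algebra ℂ C₃]
  {𝒢₁ : ZMod 2 → Submodule ℂ C₁} {𝒢₂ : ZMod 2 → Submodule ℂ C₂} {𝒢₃ : ZMod 2 → Submodule ℂ C₃}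
  [GradedAlgebra 𝒢₁] [GradedAlgebra 𝒢₂] [GradedAlgebra 𝒢₃] {q : ℂ} {α β γ : ZMod 2}
  {B : Type u} [Ring B] [Algebra ℂ B] {ℬ : ZMod 2 → Submodule ℂ B}
  {T : TensorEmbedding 𝒢₁ 𝒢₂ 𝒢₃ ℬ} {Φ Ψ : B ≃ₐ[ℂ] B}

/-- Both solutions send `monR` to the left-hand side of the zero curvature equation, which does not
involve the automorphism. -/
theorem SolvesZeroCurvature.monR_mem {s₁ s₂ s₃ : ZMod 2} {L₁ : LinearProblem 𝒢₁ s₁}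
    {L₂ : LinearProblem 𝒢₂ s₂} {L₃ : LinearProblem 𝒢₃ s₃} (hΦ : SolvesZeroCurvature L₁ L₂ L₃ T Φ)
    (hΨ : SolvesZeroCurvature L₁ L₂ L₃ T Ψ) (i j : Fin 3) :
    monR (L₁.quad.map T.i₁) (L₂.quad.map T.i₂) (L₃.quad.map T.i₃) i j
      ∈ AlgHom.equalizer Φ.toAlgHom Ψ.toAlgHom := by
  have key : ∀ {Θ : B ≃ₐ[ℂ] B}, SolvesZeroCurvature L₁ L₂ L₃ T Θ → Θ.toAlgHom (monR
      (L₁.quad.map T.i₁) (L₂.quad.map T.i₂) (L₃.quad.map T.i₃) i j)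
      = (L₁.Xαβ T.i₁ * L₂.Xαγ T.i₂ * L₃.Xβγ T.i₃) i j := by
    intro Θ hΘ
    rw [hΘ.eqn, LinearProblem.mul_X_eq_monR]
    exact (map_monR Θ.toAlgHom _ _ _ i j).symm
  rw [AlgHom.mem_equalizer, key hΦ, key hΨ]

/-- These are the entries of the inverse matrix of `monR`, and homomorphisms that agree on an
invertible matrix agree on its inverse. They give access to the lower triangular coefficients. -/
theorem SolvesZeroCurvature.monL_inv_mem {s₁ s₂ s₃ : ZMod 2} {L₁ : LinearProblem 𝒢₁ s₁}
    {L₂ : LinearProblem 𝒢₂ s₂} {L₃ : LinearProblem 𝒢₃ s₃} (hΦ : SolvesZeroCurvature L₁ L₂ L₃ T Φ)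
    (hΨ : SolvesZeroCurvature L₁ L₂ L₃ T Ψ) (i j : Fin 3) :
    monL (L₁.inv.map T.i₁) (L₂.inv.map T.i₂) (L₃.inv.map T.i₃) i j
      ∈ AlgHom.equalizer Φ.toAlgHom Ψ.toAlgHom := by
  have e : Φ.toAlgHom.mapMatrix (monR (L₁.quad.map T.i₁) (L₂.quad.map T.i₂) (L₃.quad.map T.i₃))
      = Ψ.toAlgHom.mapMatrix (monR (L₁.quad.map T.i₁) (L₂.quad.map T.i₂)
        (L₃.quad.map T.i₃)) := by
    ext1 i j
    exact hΦ.monR_mem hΨ i j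
  have m₁ := monR_mul_monL (L₁.isInv.map T.i₁) (L₂.isInv.map T.i₂) (L₃.isInv.map T.i₃)
  have m₂ := monL_mul_monR (L₁.isInv.map T.i₁).symm (L₂.isInv.map T.i₂).symm
    (L₃.isInv.map T.i₃).symm
  have p₁ := congrArg Φ.toAlgHom.mapMatrix m₂
  have p₂ := congrArg Ψ.toAlgHom.mapMatrix m₁
  rw [map_mul, map_one] at p₁ p₂
  rw [← e] at p₂
  have := left_inv_eq_right_inv p₁ p₂
  exact congrFun (congrFun this i) j

variable {L₁ : LinearProblem 𝒢₁ (α + β)} {L₂ : LinearProblem 𝒢₂ (α + γ)}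
  {L₃ : LinearProblem 𝒢₃ (β + γ)}

theorem agreeOn_of_mem {s₁ s₂ s₃ : ZMod 2} {L₁ : LinearProblem 𝒢₁ s₁}
    {L₂ : LinearProblem 𝒢₂ s₂} {L₃ : LinearProblem 𝒢₃ s₃}
    (h : (T.i₁ L₁.a ∈ AlgHom.equalizer Φ.toAlgHom Ψ.toAlgHom ∧
        T.i₁ L₁.b ∈ AlgHom.equalizer Φ.toAlgHom Ψ.toAlgHom ∧
        T.i₁ L₁.c ∈ AlgHom.equalizer Φ.toAlgHom Ψ.toAlgHom ∧
        T.i₁ L₁.d ∈ AlgHom.equalizer Φ.toAlgHom Ψ.toAlgHom) ∧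
      (T.i₂ L₂.a ∈ AlgHom.equalizer Φ.toAlgHom Ψ.toAlgHom ∧
        T.i₂ L₂.b ∈ AlgHom.equalizer Φ.toAlgHom Ψ.toAlgHom ∧
        T.i₂ L₂.c ∈ AlgHom.equalizer Φ.toAlgHom Ψ.toAlgHom ∧
        T.i₂ L₂.d ∈ AlgHom.equalizer Φ.toAlgHom Ψ.toAlgHom) ∧
      (T.i₃ L₃.a ∈ AlgHom.equalizer Φ.toAlgHom Ψ.toAlgHom ∧
        T.i₃ L₃.b ∈ AlgHom.equalizer Φ.toAlgHom Ψ.toAlgHom ∧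
        T.i₃ L₃.c ∈ AlgHom.equalizer Φ.toAlgHom Ψ.toAlgHom ∧
        T.i₃ L₃.d ∈ AlgHom.equalizer Φ.toAlgHom Ψ.toAlgHom)) : AgreeOn T Φ Ψ := by
  obtain ⟨⟨a₁, b₁, c₁, d₁⟩, ⟨a₂, b₂, c₂, d₂⟩, a₃, b₃, c₃, d₃⟩ := h
  refine ⟨fun x => ?_, fun x => ?_, fun x => ?_⟩
  · exact DFunLike.congr_fun (L₁.hom_ext (f := Φ.toAlgHom.comp T.i₁) (g := Ψ.toAlgHom.comp T.i₁)
      a₁ b₁ c₁ d₁) x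
  · exact DFunLike.congr_fun (L₂.hom_ext (f := Φ.toAlgHom.comp T.i₂) (g := Ψ.toAlgHom.comp T.i₂)
      a₂ b₂ c₂ d₂) x
  · exact DFunLike.congr_fun (L₃.hom_ext (f := Φ.toAlgHom.comp T.i₃) (g := Ψ.toAlgHom.comp T.i₃)
      a₃ b₃ c₃ d₃) x

/-- The corner entries of `monR` and of its inverse yield `b₂` and `c₂`, the latter up to a central
unit. The remaining entries in use are products with `a₂`, `d₂` or the diagonal of the second
inverse problem, so everything depends on how far the second diagonal is known. -/
theorem agree_of_solves (hq : q ≠ 0) (hroot : ∀ n : ℕ, 0 < n → q ^ n ≠ 1)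
    (h₁ : LocalRel q α β L₁.quad) (h₂ : LocalRel q α γ L₂.quad)
    (h₃ : LocalRel q β γ L₃.quad) (hΦ : SolvesZeroCurvature L₁ L₂ L₃ T Φ) (fΦ : FixesCenters T Φ)
    (hΨ : SolvesZeroCurvature L₁ L₂ L₃ T Ψ) (fΨ : FixesCenters T Ψ) :
    AgreeUpToSign L₁ L₂ L₃ T Φ Ψ ∧ (¬(α = β ∧ β = γ) → AgreeOn T Φ Ψ) := by
  set F := AlgHom.equalizer Φ.toAlgHom Ψ.toAlgHom with hF
  have agree {x : B} (hx : x ∈ F) : Φ x = Ψ x := hx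
  -- what is fixed in all cases
  have ct₁ : ∀ z ∈ Subalgebra.center ℂ C₁, T.i₁ z ∈ F :=
    fun z hz => (fΦ.1 z hz).trans (fΨ.1 z hz).symm
  have ct₂ : ∀ z ∈ Subalgebra.center ℂ C₂, T.i₂ z ∈ F :=
    fun z hz => (fΦ.2.1 z hz).trans (fΨ.2.1 z hz).symm
  have ct₃ : ∀ z ∈ Subalgebra.center ℂ C₃, T.i₃ z ∈ F :=
    fun z hz => (fΦ.2.2 z hz).trans (fΨ.2.2 z hz).symm
  have m₁₁ : T.i₂ L₂.a * T.i₁ L₁.a ∈ F := hΦ.monR_mem hΨ 0 0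
  have m₁₂ : T.i₂ L₂.a * T.i₁ L₁.b ∈ F := hΦ.monR_mem hΨ 0 1
  have hb₂ : T.i₂ L₂.b ∈ F := hΦ.monR_mem hΨ 0 2
  have m₂₃ : T.i₃ L₃.b * T.i₂ L₂.d ∈ F := hΦ.monR_mem hΨ 1 2
  have m₃₃ : T.i₃ L₃.d * T.i₂ L₂.d ∈ F := hΦ.monR_mem hΨ 2 2
  have n₁₁ : T.i₁ L₁.inv.a * T.i₂ L₂.inv.a ∈ F := hΦ.monL_inv_mem hΨ 0 0
  have n₂₁ : T.i₁ L₁.inv.c * T.i₂ L₂.inv.a ∈ F := hΦ.monL_inv_mem hΨ 1 0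
  have n₃₁ : T.i₂ L₂.inv.c ∈ F := hΦ.monL_inv_mem hΨ 2 0
  have n₃₂ : T.i₂ L₂.inv.d * T.i₃ L₃.inv.c ∈ F := hΦ.monL_inv_mem hΨ 2 1
  have n₃₃ : T.i₂ L₂.inv.d * T.i₃ L₃.inv.d ∈ F := hΦ.monL_inv_mem hΨ 2 2
  obtain ⟨-, -, -, z₁, hz₁, -, hc₁⟩ := L₁.inv_spec hq hroot h₁
  obtain ⟨-, ia₂, id₂, z₂, hz₂, -, hc₂⟩ := L₂.inv_spec hq hroot h₂
  obtain ⟨-, -, -, z₃, hz₃, -, hc₃⟩ := L₃.inv_spec hq hroot h₃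
  have fz₁ := ct₁ _ (L₁.mem_center hz₁)
  have fz₂ := ct₂ _ (L₂.mem_center hz₂)
  have fz₃ := ct₃ _ (L₃.mem_center hz₃)
  have uz₁ : IsUnit (T.i₁ z₁) := z₁.isUnit.map T.i₁
  have uz₂ : IsUnit (T.i₂ z₂) := z₂.isUnit.map T.i₂
  have uz₃ : IsUnit (T.i₃ z₃) := z₃.isUnit.map T.i₃
  have hc₂ : T.i₂ L₂.c ∈ F := by
    rw [hc₂, map_mul] at n₃₁
    exact mem_equalizer_of_mul uz₂ fz₂ n₃₁
  have hbc₂ : T.i₂ (L₂.b * L₂.c) ∈ F := by rw [map_mul]; exact mul_mem hb₂ hc₂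
  have ua₂ : IsUnit (T.i₂ L₂.a) := L₂.isUnit_a.map T.i₂
  have ud₂ : IsUnit (T.i₂ L₂.d) := L₂.isUnit_d.map T.i₂
  have uia₂ : IsUnit (T.i₂ L₂.inv.a) := ia₂.map T.i₂
  have uid₂ : IsUnit (T.i₂ L₂.inv.d) := id₂.map T.i₂
  suffices AgreeOn T Φ Ψ ∨ (α = β ∧ β = γ) ∧ AgreeUpToSign L₁ L₂ L₃ T Φ Ψ by
    rcases this with h | ⟨h, h'⟩
    · refine ⟨⟨h.2.1 _, h.2.1 _, fun x hx y hy => ?_⟩, fun _ => h⟩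
      have key : ∀ x ∈ signCoefficients L₁ L₂ L₃ T, Φ x = Ψ x := by
        rintro x (rfl | rfl | rfl | rfl | rfl | rfl | rfl | rfl | rfl | rfl)
        exacts [h.1 _, h.1 _, h.1 _, h.1 _, h.2.1 _, h.2.1 _, h.2.2 _, h.2.2 _, h.2.2 _, h.2.2 _]
      rw [map_mul, map_mul, key x hx, key y hy]
    · exact ⟨h', fun hn => (hn h).elim⟩
  by_cases hαγ : α = γ
  · subst hαγ
    -- the diagonal coefficients of the second problem are fixed up to a common factor
    obtain ⟨v, w, hv, hw, ev, ew⟩ := L₂.inv_diag_of_even hq h₂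
    obtain ⟨r, hr, er⟩ := L₂.exists_central_ratio hq h₂
    have fv := ct₂ _ (L₂.mem_center hv)
    have fw := ct₂ _ (L₂.mem_center hw)
    have fr := ct₂ _ (L₂.mem_center hr)
    have ur : IsUnit (T.i₂ r) := r.isUnit.map T.i₂
    have uv : IsUnit (T.i₂ v) := v.isUnit.map T.i₂
    have uw : IsUnit (T.i₂ w) := w.isUnit.map T.i₂
    have ev' : T.i₂ L₂.inv.a = T.i₂ v * T.i₂ r * T.i₂ L₂.a := by
      rw [ev, er, map_mul, map_mul, mul_assoc]
    have er' : T.i₂ L₂.d = T.i₂ r * T.i₂ L₂.a := by rw [er, map_mul]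
    have ew' : T.i₂ L₂.inv.d = T.i₂ w * T.i₂ L₂.a := by rw [ew, map_mul]
    have a₂1 : ∀ x, T.i₂ L₂.a * T.i₁ x = T.i₁ x * T.i₂ L₂.a := T.comm₁₂.commute_right L₂.a_mem
    have a₂3 : ∀ x, T.i₂ L₂.a * T.i₃ x = T.i₃ x * T.i₂ L₂.a := T.comm₂₃.commute_left L₂.a_mem
    -- With `d₂ = r a₂`, the commutator of `c₂` and `b₂` is a nonzero multiple of `r a₂²`, and the
    -- central unit `r` can be cancelled.
    have sa₂ : T.i₂ L₂.a * T.i₂ L₂.a ∈ F := by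
      have hk := qp_sub_inv_ne_zero hq hroot α
      have e : T.i₂ r * (T.i₂ L₂.a * T.i₂ L₂.a) = (qp q α - (qp q α)⁻¹)⁻¹ •
          (T.i₂ L₂.c * T.i₂ L₂.b - T.i₂ L₂.b * T.i₂ L₂.c) := by
        have := h₂.cb_self
        simp only [LinearProblem.quad] at this
        rw [← map_mul T.i₂ L₂.c, this, map_add, map_mul T.i₂ L₂.b, add_sub_cancel_left, map_smul,
          smul_smul, inv_mul_cancel₀ hk, one_smul, ← mul_assoc, ← er', ← map_mul,
          show L₂.a * L₂.d = _ from h₂.da.symm]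
        rfl
      refine mem_equalizer_of_mul ur fr ?_
      rw [e]
      exact Subalgebra.smul_mem _ (sub_mem (mul_mem hc₂ hb₂) (mul_mem hb₂ hc₂)) _
    have pc₁ : T.i₂ L₂.a * T.i₁ L₁.c ∈ F := by
      have uvr := uv.mul ur
      have fvr := mul_mem fv fr
      have cz : T.i₁ z₁ * (T.i₂ v * T.i₂ r) = (T.i₂ v * T.i₂ r) * T.i₁ z₁ := by
        rw [← map_mul]
        exact T.comm₁₂.commute_left (L₁.mem_of_mem_center hq hroot h₁ (L₁.mem_center hz₁)) _
      have hvr : T.i₁ L₁.c * (T.i₂ v * T.i₂ r) = (T.i₂ v * T.i₂ r) * T.i₁ L₁.c := by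
        rw [← map_mul]
        exact (T.comm₁₂.commute_right (L₂.mem_of_mem_center hq hroot h₂
          (mul_mem (L₂.mem_center hv) (L₂.mem_center hr))) _).symm
      rw [ev', hc₁, map_mul, mul_assoc, ← mul_assoc (T.i₁ L₁.c), hvr, mul_assoc _ (T.i₁ L₁.c),
        ← a₂1] at n₂₁
      exact mem_equalizer_of_mul uvr fvr (mem_equalizer_of_mul uz₁ fz₁ n₂₁)
    have pb₃ : T.i₂ L₂.a * T.i₃ L₃.b ∈ F := by
      have hr3 : T.i₂ r * T.i₃ L₃.b = T.i₃ L₃.b * T.i₂ r :=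
        T.comm₂₃.commute_left (L₂.mem_of_mem_center hq hroot h₂ (L₂.mem_center hr)) _
      rw [er', ← mul_assoc, ← hr3, mul_assoc, ← a₂3] at m₂₃
      exact mem_equalizer_of_mul ur fr m₂₃
    have pd₃ : T.i₂ L₂.a * T.i₃ L₃.d ∈ F := by
      have hr3 : T.i₂ r * T.i₃ L₃.d = T.i₃ L₃.d * T.i₂ r :=
        T.comm₂₃.commute_left (L₂.mem_of_mem_center hq hroot h₂ (L₂.mem_center hr)) _
      rw [er', ← mul_assoc, ← hr3, mul_assoc, ← a₂3] at m₃₃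
      exact mem_equalizer_of_mul ur fr m₃₃
    have pc₃ : T.i₂ L₂.a * T.i₃ L₃.c ∈ F := by
      rw [ew', hc₃, map_mul, mul_assoc, ← mul_assoc (T.i₂ L₂.a), a₂3, mul_assoc] at n₃₂
      exact mem_equalizer_of_mul uz₃ fz₃ (mem_equalizer_of_mul uw fw n₃₂)
    by_cases hαβ : α = β
    · subst hαβ
      -- all problems are even
      refine Or.inr ⟨⟨rfl, rfl⟩, agree hb₂, agree hc₂, ?_⟩
      obtain ⟨v₁, w₁, hv₁, hw₁, ev₁, ew₁⟩ := L₁.inv_diag_of_even hq h₁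
      obtain ⟨v₃, w₃, hv₃, hw₃, ev₃, ew₃⟩ := L₃.inv_diag_of_even hq h₃
      have pd₁ : T.i₂ L₂.a * T.i₁ L₁.d ∈ F := by
        have hvr : T.i₁ L₁.d * (T.i₂ v * T.i₂ r) = (T.i₂ v * T.i₂ r) * T.i₁ L₁.d := by
          rw [← map_mul]
          exact (T.comm₁₂.commute_right (L₂.mem_of_mem_center hq hroot h₂
            (mul_mem (L₂.mem_center hv) (L₂.mem_center hr))) _).symm
        rw [ev', ev₁, map_mul, mul_assoc, ← mul_assoc (T.i₁ L₁.d), hvr, mul_assoc _ (T.i₁ L₁.d),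
          ← a₂1] at n₁₁
        exact mem_equalizer_of_mul (uv.mul ur) (mul_mem fv fr) (mem_equalizer_of_mul
          (v₁.isUnit.map T.i₁) (ct₁ _ (L₁.mem_center hv₁)) n₁₁)
      have pa₃ : T.i₂ L₂.a * T.i₃ L₃.a ∈ F := by
        rw [ew', ew₃, map_mul, mul_assoc, ← mul_assoc (T.i₂ L₂.a), a₂3, mul_assoc] at n₃₃
        exact mem_equalizer_of_mul (w₃.isUnit.map T.i₃) (ct₃ _ (L₃.mem_center hw₃))
          (mem_equalizer_of_mul uw fw n₃₃)
      have pd₂ : T.i₂ L₂.a * T.i₂ L₂.d ∈ F := by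
        have : T.i₂ L₂.a * T.i₂ r = T.i₂ r * T.i₂ L₂.a := by
          rw [← map_mul, ← map_mul, show L₂.a * r = r * L₂.a from hr.a.symm]
        rw [er', ← mul_assoc, this, mul_assoc]
        exact mul_mem fr sa₂
      -- Every sign coefficient commutes with `a₂`, and its product with `a₂` is determined. A
      -- product of two such coefficients is therefore determined after division by `a₂²`.
      have key : ∀ x ∈ signCoefficients L₁ L₂ L₃ T,
          T.i₂ L₂.a * x ∈ F ∧ T.i₂ L₂.a * x = x * T.i₂ L₂.a := by
        rintro x (rfl | rfl | rfl | rfl | rfl | rfl | rfl | rfl | rfl | rfl)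
        · exact ⟨m₁₁, a₂1 _⟩
        · exact ⟨m₁₂, a₂1 _⟩
        · exact ⟨pc₁, a₂1 _⟩
        · exact ⟨pd₁, a₂1 _⟩
        · exact ⟨sa₂, rfl⟩
        · refine ⟨pd₂, ?_⟩
          rw [← map_mul, ← map_mul, show L₂.a * L₂.d = L₂.d * L₂.a from h₂.da.symm]
        · exact ⟨pa₃, a₂3 _⟩
        · exact ⟨pb₃, a₂3 _⟩
        · exact ⟨pc₃, a₂3 _⟩
        · exact ⟨pd₃, a₂3 _⟩
      intro x hx y hy
      refine agree (mem_equalizer_of_mul (ua₂.mul ua₂) sa₂ ?_)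
      have := mul_mem (key x hx).1 (key y hy).1
      rwa [mul_assoc, ← mul_assoc x, ← (key x hx).2, mul_assoc, ← mul_assoc] at this
    · -- the first and the third problem are odd
      left
      -- The product of `a₂ b₁` and `a₂ c₁` is `a₂² b₁ c₁`. In an odd problem `b₁ c₁` and the center
      -- determine `a₁`, and then `a₂ a₁` determines `a₂` itself, with its sign.
      have hbc₁ : T.i₁ (L₁.b * L₁.c) ∈ F := by
        have := mul_mem m₁₂ pc₁
        rw [mul_assoc, ← mul_assoc (T.i₁ L₁.b), ← a₂1, mul_assoc, ← mul_assoc, ← map_mul T.i₁] at this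
        exact mem_equalizer_of_mul (ua₂.mul ua₂) sa₂ this
      obtain ⟨⟨ha₁, hd₁⟩, -⟩ := L₁.mem_equalizer_of_odd hq hroot hαβ h₁ ct₁ hbc₁
      have ha₂ : T.i₂ L₂.a ∈ F := mem_equalizer_of_mul' (L₁.isUnit_a.map T.i₁) ha₁ m₁₁
      have hb₃ := mem_equalizer_of_mul ua₂ ha₂ pb₃
      have hc₃ := mem_equalizer_of_mul ua₂ ha₂ pc₃
      obtain ⟨⟨ha₃, hd₃⟩, -⟩ := L₃.mem_equalizer_of_odd hq hroot (Ne.symm hαβ) h₃ ct₃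
        (by rw [map_mul]; exact mul_mem hb₃ hc₃)
      exact agreeOn_of_mem ⟨⟨ha₁, mem_equalizer_of_mul ua₂ ha₂ m₁₂,
        mem_equalizer_of_mul ua₂ ha₂ pc₁, hd₁⟩, ⟨ha₂, hb₂, hc₂, er' ▸ mul_mem fr ha₂⟩, ha₃, hb₃,
        hc₃, hd₃⟩
  · -- the second problem is odd
    left
    obtain ⟨⟨ha₂, hd₂⟩, hia₂, hid₂⟩ := L₂.mem_equalizer_of_odd hq hroot hαγ h₂ ct₂ hbc₂
    have ha₁ := mem_equalizer_of_mul ua₂ ha₂ m₁₁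
    have hb₁ := mem_equalizer_of_mul ua₂ ha₂ m₁₂
    have hb₃ := mem_equalizer_of_mul' ud₂ hd₂ m₂₃
    have hd₃ := mem_equalizer_of_mul' ud₂ hd₂ m₃₃
    have hia₁ := mem_equalizer_of_mul' uia₂ hia₂ n₁₁
    have hic₁ := mem_equalizer_of_mul' uia₂ hia₂ n₂₁
    have hic₃ := mem_equalizer_of_mul uid₂ hid₂ n₃₂
    have hid₃ := mem_equalizer_of_mul uid₂ hid₂ n₃₃
    rw [hc₁, map_mul] at hic₁
    rw [hc₃, map_mul] at hic₃
    have hc₁ := mem_equalizer_of_mul uz₁ fz₁ hic₁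
    have hc₃ := mem_equalizer_of_mul uz₃ fz₃ hic₃
    have hd₁ : T.i₁ L₁.d ∈ F := by
      by_cases hαβ : α = β
      · subst hαβ
        obtain ⟨v, w, hv, -, ev, -⟩ := L₁.inv_diag_of_even hq h₁
        rw [ev, map_mul] at hia₁
        exact mem_equalizer_of_mul (v.isUnit.map T.i₁) (ct₁ _ (L₁.mem_center hv)) hia₁
      · exact (L₁.mem_equalizer_of_odd hq hroot hαβ h₁ ct₁
          (by rw [map_mul]; exact mul_mem hb₁ hc₁)).1.2
    have ha₃ : T.i₃ L₃.a ∈ F := by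
      by_cases hβγ : β = γ
      · subst hβγ
        obtain ⟨v, w, -, hw, -, ew⟩ := L₃.inv_diag_of_even hq h₃
        rw [ew, map_mul] at hid₃
        exact mem_equalizer_of_mul (w.isUnit.map T.i₃) (ct₃ _ (L₃.mem_center hw)) hid₃
      · exact (L₃.mem_equalizer_of_odd hq hroot hβγ h₃ ct₃
          (by rw [map_mul]; exact mul_mem hb₃ hc₃)).1.1
    exact agreeOn_of_mem ⟨⟨ha₁, hb₁, hc₁, hd₁⟩, ⟨ha₂, hb₂, hc₂, hd₂⟩, ha₃, hb₃, hc₃, hd₃⟩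

end Uniqueness

/-! ### Necessity: defects of exchange relations. -/

section Expansions

variable {E : Type*} [Ring E] [Algebra ℂ E] {q : ℂ} {x y z : Quad E}

theorem mul_mul_of_eq_zero {x y : E} (h : x * y = 0) (w : E) : x * (y * w) = 0 := by
  rw [← mul_assoc, h, zero_mul]

/-- Of each pair of statements, the first is a relation satisfied by one monodromy matrix because of
the relations of `x` alone. The second computes the defect of the same relation for the other
matrix, which isolates an unknown relation of `y`. -/
theorem expand_even_odd_odd (c₁₂ : CrossRel 1 x y) (c₁₃ : CrossRel 1 x z)
    (c₂₃ : CrossRel (-1) y z) (xab : x.a * x.b = q • (x.b * x.a))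
    (xca : x.c * x.a = q • (x.a * x.c)) :
    monR x y z 0 0 * monR x y z 0 1 = q • (monR x y z 0 1 * monR x y z 0 0) ∧
    monL x y z 0 0 * monL x y z 0 1 - q • (monL x y z 0 1 * monL x y z 0 0)
      = x.a * x.a * (y.a * y.b - q • (y.b * y.a)) * z.c ∧
    monL x y z 1 0 * monL x y z 0 0 = q • (monL x y z 0 0 * monL x y z 1 0) ∧
    monR x y z 1 0 * monR x y z 0 0 - q • (monR x y z 0 0 * monR x y z 1 0)
      = x.a * x.a * (q • (y.a * y.c) - y.c * y.a) * z.b := by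
  have x₁ := mul_mul_of_eq_smul xab
  have x₂ := mul_mul_of_eq_smul xca
  refine ⟨?_, ?_, ?_, ?_⟩ <;>
    simp only [monL, monR, Matrix.of_apply, Matrix.cons_val', Matrix.cons_val_zero,
      Matrix.cons_val_one, Matrix.cons_val, Matrix.cons_val_fin_one, mul_assoc, mul_add, add_mul,
      mul_sub, sub_mul, smul_mul_assoc, mul_smul_comm, smul_add, smul_sub, smul_smul, xab, xca,
      x₁, x₂, c₁₂.aa, c₁₂.ab, c₁₂.ac, c₁₂.ad, c₁₂.ba, c₁₂.bb, c₁₂.bc, c₁₂.bd, c₁₂.ca, c₁₂.cb,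
      c₁₂.cc, c₁₂.cd, c₁₂.da, c₁₂.db, c₁₂.dc, c₁₂.dd, c₁₃.aa, c₁₃.ab, c₁₃.ac, c₁₃.ad, c₁₃.ba,
      c₁₃.bb, c₁₃.bc, c₁₃.bd, c₁₃.ca, c₁₃.cb, c₁₃.cc, c₁₃.cd, c₁₃.da, c₁₃.db, c₁₃.dc, c₁₃.dd,
      c₂₃.aa, c₂₃.ab, c₂₃.ac, c₂₃.ad, c₂₃.ba, c₂₃.bb, c₂₃.bc, c₂₃.bd, c₂₃.ca, c₂₃.cb, c₂₃.cc,
      c₂₃.cd, c₂₃.da, c₂₃.db, c₂₃.dc, c₂₃.dd, c₁₂.assoc, c₁₃.assoc, c₂₃.assoc] <;>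
    module

/-- Once the exchange of `a` with `b` and `c` is known, the defects isolate two combinations of
`ad`, `da` and `bc + cb` in `z`, which differ by the interchange of `ad` and `da`. -/
theorem expand_even_odd_odd' (c₁₂ : CrossRel 1 x y) (c₁₃ : CrossRel 1 x z)
    (c₂₃ : CrossRel (-1) y z) (xab : x.a * x.b = q • (x.b * x.a))
    (xca : x.c * x.a = q • (x.a * x.c)) (yab : y.a * y.b = q • (y.b * y.a))
    (yca : y.c * y.a = q • (y.a * y.c)) (zab : z.a * z.b = q • (z.b * z.a))
    (zca : z.c * z.a = q • (z.a * z.c)) (ybb : y.b * y.b = 0) (ycc : y.c * y.c = 0) :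
    monR x y z 0 1 * monR x y z 0 2 = q • (monR x y z 0 2 * monR x y z 0 1) ∧
    monL x y z 0 1 * monL x y z 0 2 - q • (monL x y z 0 2 * monL x y z 0 1)
      = x.b * x.a * y.b * (z.a * z.d + q • (z.c * z.b + z.b * z.c) - (q * q) • (z.d * z.a)) ∧
    monL x y z 2 0 * monL x y z 1 0 = q • (monL x y z 1 0 * monL x y z 2 0) ∧
    monR x y z 2 0 * monR x y z 1 0 - q • (monR x y z 1 0 * monR x y z 2 0)
      = x.a * x.c * y.c * (z.d * z.a + q • (z.c * z.b + z.b * z.c) - (q * q) • (z.a * z.d)) := by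
  have x₁ := mul_mul_of_eq_smul xab
  have x₂ := mul_mul_of_eq_smul xca
  have y₁ := mul_mul_of_eq_smul yab
  have y₂ := mul_mul_of_eq_smul yca
  have y₃ := mul_mul_of_eq_zero ybb
  have y₄ := mul_mul_of_eq_zero ycc
  refine ⟨?_, ?_, ?_, ?_⟩ <;>
    simp only [monL, monR, Matrix.of_apply, Matrix.cons_val', Matrix.cons_val_zero,
      Matrix.cons_val_one, Matrix.cons_val, Matrix.cons_val_fin_one, mul_assoc, mul_add, add_mul,
      mul_sub, sub_mul, smul_mul_assoc, mul_smul_comm, smul_add, smul_sub, smul_smul, xab, xca,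
      x₁, x₂, yab, yca, y₁, y₂, zab, zca, ybb, ycc, y₃, y₄, mul_zero, smul_zero, add_zero, zero_add,
      c₁₂.aa, c₁₂.ab, c₁₂.ac, c₁₂.ad, c₁₂.ba, c₁₂.bb, c₁₂.bc, c₁₂.bd, c₁₂.ca, c₁₂.cb,
      c₁₂.cc, c₁₂.cd, c₁₂.da, c₁₂.db, c₁₂.dc, c₁₂.dd, c₁₃.aa, c₁₃.ab, c₁₃.ac, c₁₃.ad, c₁₃.ba,
      c₁₃.bb, c₁₃.bc, c₁₃.bd, c₁₃.ca, c₁₃.cb, c₁₃.cc, c₁₃.cd, c₁₃.da, c₁₃.db, c₁₃.dc, c₁₃.dd,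
      c₂₃.aa, c₂₃.ab, c₂₃.ac, c₂₃.ad, c₂₃.ba, c₂₃.bb, c₂₃.bc, c₂₃.bd, c₂₃.ca, c₂₃.cb, c₂₃.cc,
      c₂₃.cd, c₂₃.da, c₂₃.db, c₂₃.dc, c₂₃.dd, c₁₂.assoc, c₁₃.assoc, c₂₃.assoc] <;>
    module

theorem expand_odd_odd_even (c₁₂ : CrossRel (-1) x y) (c₁₃ : CrossRel 1 x z)
    (c₂₃ : CrossRel 1 y z) (zdb : z.d * z.b = q • (z.b * z.d))
    (zcd : z.c * z.d = q • (z.d * z.c)) :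
    monR x y z 2 2 * monR x y z 1 2 = q • (monR x y z 1 2 * monR x y z 2 2) ∧
    monL x y z 2 2 * monL x y z 1 2 - q • (monL x y z 1 2 * monL x y z 2 2)
      = x.c * (y.d * y.b - q • (y.b * y.d)) * (z.d * z.d) ∧
    monL x y z 2 1 * monL x y z 2 2 = q • (monL x y z 2 2 * monL x y z 2 1) ∧
    monR x y z 2 1 * monR x y z 2 2 - q • (monR x y z 2 2 * monR x y z 2 1)
      = x.b * (q • (y.d * y.c) - y.c * y.d) * (z.d * z.d) := by
  have z₁ := mul_mul_of_eq_smul zdb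
  have z₂ := mul_mul_of_eq_smul zcd
  refine ⟨?_, ?_, ?_, ?_⟩ <;>
    simp only [monL, monR, Matrix.of_apply, Matrix.cons_val', Matrix.cons_val_zero,
      Matrix.cons_val_one, Matrix.cons_val, Matrix.cons_val_fin_one, mul_assoc, mul_add, add_mul,
      mul_sub, sub_mul, smul_mul_assoc, mul_smul_comm, smul_add, smul_sub, smul_smul, zdb, zcd,
      z₁, z₂, c₁₂.aa, c₁₂.ab, c₁₂.ac, c₁₂.ad, c₁₂.ba, c₁₂.bb, c₁₂.bc, c₁₂.bd, c₁₂.ca, c₁₂.cb,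
      c₁₂.cc, c₁₂.cd, c₁₂.da, c₁₂.db, c₁₂.dc, c₁₂.dd, c₁₃.aa, c₁₃.ab, c₁₃.ac, c₁₃.ad, c₁₃.ba,
      c₁₃.bb, c₁₃.bc, c₁₃.bd, c₁₃.ca, c₁₃.cb, c₁₃.cc, c₁₃.cd, c₁₃.da, c₁₃.db, c₁₃.dc, c₁₃.dd,
      c₂₃.aa, c₂₃.ab, c₂₃.ac, c₂₃.ad, c₂₃.ba, c₂₃.bb, c₂₃.bc, c₂₃.bd, c₂₃.ca, c₂₃.cb, c₂₃.cc,
      c₂₃.cd, c₂₃.da, c₂₃.db, c₂₃.dc, c₂₃.dd, c₁₂.assoc, c₁₃.assoc, c₂₃.assoc] <;>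
    module

theorem expand_odd_odd_even' (c₁₂ : CrossRel (-1) x y) (c₁₃ : CrossRel 1 x z)
    (c₂₃ : CrossRel 1 y z) (xdb : x.d * x.b = q • (x.b * x.d))
    (xcd : x.c * x.d = q • (x.d * x.c)) (ydb : y.d * y.b = q • (y.b * y.d))
    (ycd : y.c * y.d = q • (y.d * y.c)) (zdb : z.d * z.b = q • (z.b * z.d))
    (zcd : z.c * z.d = q • (z.d * z.c)) (ybb : y.b * y.b = 0) (ycc : y.c * y.c = 0) :
    monR x y z 1 2 * monR x y z 0 2 = q • (monR x y z 0 2 * monR x y z 1 2) ∧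
    monL x y z 1 2 * monL x y z 0 2 - q • (monL x y z 0 2 * monL x y z 1 2)
      = (x.d * x.a - q • (x.c * x.b + x.b * x.c) - (q * q) • (x.a * x.d)) * y.b * (z.b * z.d) ∧
    monL x y z 2 0 * monL x y z 2 1 = q • (monL x y z 2 1 * monL x y z 2 0) ∧
    monR x y z 2 0 * monR x y z 2 1 - q • (monR x y z 2 1 * monR x y z 2 0)
      = (x.a * x.d - q • (x.c * x.b + x.b * x.c) - (q * q) • (x.d * x.a)) * y.c * (z.d * z.c) := by
  have x₁ := mul_mul_of_eq_smul xdb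
  have x₂ := mul_mul_of_eq_smul xcd
  have y₁ := mul_mul_of_eq_smul ydb
  have y₂ := mul_mul_of_eq_smul ycd
  have y₃ := mul_mul_of_eq_zero ybb
  have y₄ := mul_mul_of_eq_zero ycc
  refine ⟨?_, ?_, ?_, ?_⟩ <;>
    simp only [monL, monR, Matrix.of_apply, Matrix.cons_val', Matrix.cons_val_zero,
      Matrix.cons_val_one, Matrix.cons_val, Matrix.cons_val_fin_one, mul_assoc, mul_add, add_mul,
      mul_sub, sub_mul, smul_mul_assoc, mul_smul_comm, smul_add, smul_sub, smul_smul, xdb, xcd,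
      x₁, x₂, ydb, ycd, y₁, y₂, zdb, zcd, ybb, ycc, y₃, y₄, mul_zero, smul_zero, add_zero, zero_add,
      c₁₂.aa, c₁₂.ab, c₁₂.ac, c₁₂.ad, c₁₂.ba, c₁₂.bb, c₁₂.bc, c₁₂.bd, c₁₂.ca, c₁₂.cb,
      c₁₂.cc, c₁₂.cd, c₁₂.da, c₁₂.db, c₁₂.dc, c₁₂.dd, c₁₃.aa, c₁₃.ab, c₁₃.ac, c₁₃.ad, c₁₃.ba,
      c₁₃.bb, c₁₃.bc, c₁₃.bd, c₁₃.ca, c₁₃.cb, c₁₃.cc, c₁₃.cd, c₁₃.da, c₁₃.db, c₁₃.dc, c₁₃.dd,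
      c₂₃.aa, c₂₃.ab, c₂₃.ac, c₂₃.ad, c₂₃.ba, c₂₃.bb, c₂₃.bc, c₂₃.bd, c₂₃.ca, c₂₃.cb, c₂₃.cc,
      c₂₃.cd, c₂₃.da, c₂₃.db, c₂₃.dc, c₂₃.dd, c₁₂.assoc, c₁₃.assoc, c₂₃.assoc] <;>
    module

/-- The odd problems `x` and `y` are known and `z` is not. The three groups isolate the exchange of
`d` with `b` and `c`, the relations between `ad`, `da` and `bc - cb`, and the exchange of `a` with
`b` and `c`. The factor `-q` in the second group combines `q` with the sign of exchanging two odd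
entries. -/
theorem expand_fermi_fermi_even (c₁₂ : CrossRel (-1) x y) (c₁₃ : CrossRel 1 x z)
    (c₂₃ : CrossRel 1 y z) (hq : q ≠ 0)
    (xab : x.a * x.b = q • (x.b * x.a)) (xca : x.c * x.a = q • (x.a * x.c))
    (xbd : x.b * x.d = q • (x.d * x.b)) (xdc : x.d * x.c = q • (x.c * x.d))
    (xda : x.d * x.a = x.a * x.d) (xcb : x.c * x.b = (q - q⁻¹) • (x.a * x.d) - x.b * x.c)
    (xbb : x.b * x.b = 0) (xcc : x.c * x.c = 0)
    (yab : y.a * y.b = q • (y.b * y.a)) (yca : y.c * y.a = q • (y.a * y.c))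
    (ybd : y.b * y.d = q • (y.d * y.b)) (ydc : y.d * y.c = q • (y.c * y.d))
    (ybb : y.b * y.b = 0) (ycc : y.c * y.c = 0) :
    (monR x y z 0 2 * monR x y z 2 2 = q • (monR x y z 2 2 * monR x y z 0 2) ∧
    monL x y z 0 2 * monL x y z 2 2 - q • (monL x y z 2 2 * monL x y z 0 2)
      = x.b * y.d * (z.b * z.d - q • (z.d * z.b)) ∧
    monL x y z 2 2 * monL x y z 2 0 = q • (monL x y z 2 0 * monL x y z 2 2) ∧
    monR x y z 2 2 * monR x y z 2 0 - q • (monR x y z 2 0 * monR x y z 2 2)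
      = x.c * y.d * (z.d * z.c - q • (z.c * z.d))) ∧
    (monR x y z 0 1 * monR x y z 0 2 = (-q) • (monR x y z 0 2 * monR x y z 0 1) ∧
    monL x y z 0 1 * monL x y z 0 2 - (-q) • (monL x y z 0 2 * monL x y z 0 1)
      = x.b * x.a * y.b * (z.a * z.d - q • (z.c * z.b) + q • (z.b * z.c)
        - (q * q) • (z.d * z.a)) ∧
    monL x y z 2 0 * monL x y z 1 0 = (-q) • (monL x y z 1 0 * monL x y z 2 0) ∧
    monR x y z 2 0 * monR x y z 1 0 - (-q) • (monR x y z 1 0 * monR x y z 2 0)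
      = -(x.a * x.c * y.c * (z.d * z.a - q • (z.c * z.b) + q • (z.b * z.c)
        - (q * q) • (z.a * z.d)))) ∧
    (monR x y z 0 1 * monR x y z 1 1 = q • (monR x y z 1 1 * monR x y z 0 1) ∧
    monL x y z 0 1 * monL x y z 1 1 - q • (monL x y z 1 1 * monL x y z 0 1)
      = (x.b * x.c - q • (x.a * x.d)) * y.b * (z.a * z.c - q • (z.c * z.a)) ∧
    monL x y z 1 1 * monL x y z 1 0 = q • (monL x y z 1 0 * monL x y z 1 1) ∧
    monR x y z 1 1 * monR x y z 1 0 - q • (monR x y z 1 0 * monR x y z 1 1)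
      = (x.b * x.c - q • (x.a * x.d)) * y.c * (z.b * z.a - q • (z.a * z.b))) := by
  have x₁ := mul_mul_of_eq_smul xab
  have x₂ := mul_mul_of_eq_smul xca
  have x₃ := mul_mul_of_eq_smul xbd
  have x₄ := mul_mul_of_eq_smul xdc
  have x₅ := mul_mul_of_eq_zero xbb
  have x₆ := mul_mul_of_eq_zero xcc
  have x₇ : ∀ w, x.d * (x.a * w) = x.a * (x.d * w) := fun w => by rw [← mul_assoc, xda, mul_assoc]
  have x₈ : ∀ w, x.c * (x.b * w) = (q - q⁻¹) • (x.a * (x.d * w)) - x.b * (x.c * w) := fun w => by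
    rw [← mul_assoc, xcb, sub_mul, smul_mul_assoc, mul_assoc, mul_assoc]
  have y₁ := mul_mul_of_eq_smul yab
  have y₂ := mul_mul_of_eq_smul yca
  have y₃ := mul_mul_of_eq_smul ybd
  have y₄ := mul_mul_of_eq_smul ydc
  have y₅ := mul_mul_of_eq_zero ybb
  have y₆ := mul_mul_of_eq_zero ycc
  refine ⟨⟨?_, ?_, ?_, ?_⟩, ⟨?_, ?_, ?_, ?_⟩, ⟨?_, ?_, ?_, ?_⟩⟩ <;>
    simp only [monL, monR, Matrix.of_apply, Matrix.cons_val', Matrix.cons_val_zero,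
      Matrix.cons_val_one, Matrix.cons_val, Matrix.cons_val_fin_one, mul_assoc, mul_add, add_mul,
      mul_sub, sub_mul, smul_mul_assoc, mul_smul_comm, smul_add, smul_sub, smul_smul, xab, xca,
      xbd, xdc, xda, xcb, xbb, xcc, x₁, x₂, x₃, x₄, x₅, x₆, x₇, x₈, yab, yca, ybd, ydc, ybb, ycc,
      y₁, y₂, y₃, y₄, y₅, y₆, mul_zero, smul_zero, add_zero, zero_add,
      c₁₂.aa, c₁₂.ab, c₁₂.ac, c₁₂.ad, c₁₂.ba, c₁₂.bb, c₁₂.bc, c₁₂.bd, c₁₂.ca, c₁₂.cb,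
      c₁₂.cc, c₁₂.cd, c₁₂.da, c₁₂.db, c₁₂.dc, c₁₂.dd, c₁₃.aa, c₁₃.ab, c₁₃.ac, c₁₃.ad, c₁₃.ba,
      c₁₃.bb, c₁₃.bc, c₁₃.bd, c₁₃.ca, c₁₃.cb, c₁₃.cc, c₁₃.cd, c₁₃.da, c₁₃.db, c₁₃.dc, c₁₃.dd,
      c₂₃.aa, c₂₃.ab, c₂₃.ac, c₂₃.ad, c₂₃.ba, c₂₃.bb, c₂₃.bc, c₂₃.bd, c₂₃.ca, c₂₃.cb, c₂₃.cc,
      c₂₃.cd, c₂₃.da, c₂₃.db, c₂₃.dc, c₂₃.dd, c₁₂.assoc, c₁₃.assoc, c₂₃.assoc] <;>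
    first | module | (match_scalars <;> field_simp <;> ring)

end Expansions

theorem tmul_eq_zero {V W : Type*} [AddCommGroup V] [Module ℂ V] [AddCommGroup W] [Module ℂ W]
    {v : V} {w : W} (h : v ⊗ₜ[ℂ] w = 0) : v = 0 ∨ w = 0 := by
  by_contra! hvw
  refine hvw.2 ((Module.forall_dual_apply_eq_zero_iff ℂ w).1 fun f => ?_)
  have := congrArg (fun z => TensorProduct.rid ℂ V (f.lTensor V z)) h
  simpa [hvw.1] using this

/-! ### Necessity: from vanishing defects to local relations. -/

section Transfer

variable {C₁ C₂ C₃ B : Type u} [Ring C₁] [Algebra ℂ C₁] [Ring C₂] [Algebra ℂ C₂]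
  [Ring C₃] [Algebra ℂ C₃] [Ring B] [Algebra ℂ B]
  {𝒢₁ : ZMod 2 → Submodule ℂ C₁} {𝒢₂ : ZMod 2 → Submodule ℂ C₂} {𝒢₃ : ZMod 2 → Submodule ℂ C₃}
  {ℬ : ZMod 2 → Submodule ℂ B} {s₁ s₂ s₃ : ZMod 2}
  {L₁ : LinearProblem 𝒢₁ s₁} {L₂ : LinearProblem 𝒢₂ s₂} {L₃ : LinearProblem 𝒢₃ s₃}
  {T : TensorEmbedding 𝒢₁ 𝒢₂ 𝒢₃ ℬ} {Φ : B ≃ₐ[ℂ] B}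

theorem TensorEmbedding.eq_zero_of_mul_mul (T : TensorEmbedding 𝒢₁ 𝒢₂ 𝒢₃ ℬ) {u : C₁} {v : C₂}
    {w : C₃} (h : T.i₁ u * T.i₂ v * T.i₃ w = 0) : u = 0 ∨ v = 0 ∨ w = 0 := by
  have h0 : (u ⊗ₜ[ℂ] v) ⊗ₜ[ℂ] w = 0 := T.injective (by simpa using h)
  rcases tmul_eq_zero h0 with h1 | h1
  · rcases tmul_eq_zero h1 with h2 | h2
    · exact .inl h2
    · exact .inr (.inl h2)
  · exact .inr (.inr h1)

/-- The entries of the two monodromy matrices satisfy the same exchange relations. -/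
theorem SolvesZeroCurvature.exchange_iff (h : SolvesZeroCurvature L₁ L₂ L₃ T Φ)
    {i j k l : Fin 3} {r : ℂ} :
    monR (L₁.quad.map T.i₁) (L₂.quad.map T.i₂) (L₃.quad.map T.i₃) i j
        * monR (L₁.quad.map T.i₁) (L₂.quad.map T.i₂) (L₃.quad.map T.i₃) k l
      = r • (monR (L₁.quad.map T.i₁) (L₂.quad.map T.i₂) (L₃.quad.map T.i₃) k l
        * monR (L₁.quad.map T.i₁) (L₂.quad.map T.i₂) (L₃.quad.map T.i₃) i j) ↔
    monL (L₁.quad.map T.i₁) (L₂.quad.map T.i₂) (L₃.quad.map T.i₃) i j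
        * monL (L₁.quad.map T.i₁) (L₂.quad.map T.i₂) (L₃.quad.map T.i₃) k l
      = r • (monL (L₁.quad.map T.i₁) (L₂.quad.map T.i₂) (L₃.quad.map T.i₃) k l
        * monL (L₁.quad.map T.i₁) (L₂.quad.map T.i₂) (L₃.quad.map T.i₃) i j) := by
  have key (i j : Fin 3) : monL (L₁.quad.map T.i₁) (L₂.quad.map T.i₂) (L₃.quad.map T.i₃) i j
      = Φ (monR (L₁.quad.map T.i₁) (L₂.quad.map T.i₂) (L₃.quad.map T.i₃) i j) := by
    rw [← LinearProblem.mul_X_eq_monL, h.eqn, LinearProblem.mul_X_eq_monR]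
    exact map_monR Φ.toAlgHom (L₁.quad.map T.i₁) (L₂.quad.map T.i₂) (L₃.quad.map T.i₃) i j
  rw [key, key, ← map_mul, ← map_mul, ← map_smul, Φ.injective.eq_iff]

end Transfer

/-- Since `b² = 0`, `b` commutes with `bc + cb` and hence with `ad`; its exchange with `d` is then
inverse to its exchange with `a`. -/
theorem mul_eq_smul_of_anticomm {E : Type*} [Ring E] [Algebra ℂ E] {a b c d : E} {q k : ℂ}
    (hq : q ≠ 0) (hk : k ≠ 0) (ha : IsUnit a) (bb : b * b = 0)
    (h : b * c + c * b = k • (a * d)) (hab : a * b = q • (b * a)) : b * d = q • (d * b) := by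
  have h1 : b * (a * d) = a * d * b := by
    have e : b * (b * c + c * b) = (b * c + c * b) * b := by
      simp [mul_add, add_mul, ← mul_assoc, bb, mul_assoc _ b b]
    rw [h, mul_smul_comm, smul_mul_assoc] at e
    exact (smul_right_injective E hk) e
  have hba : b * a = q⁻¹ • (a * b) := by rw [hab, smul_smul, inv_mul_cancel₀ hq, one_smul]
  rw [← mul_assoc, hba, smul_mul_assoc, mul_assoc, mul_assoc] at h1
  refine ha.mul_left_cancel ?_
  rw [mul_smul_comm, ← h1, smul_smul, mul_inv_cancel₀ hq, one_smul]

/-- Two relations which differ by the exchange of `p` and `r` force `p = r`. -/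
theorem eq_and_eq_of_swap {E : Type*} [AddCommGroup E] [Module ℂ E] {q : ℂ} (hq : q ≠ 0)
    (hq2 : 1 + q * q ≠ 0) {p r w : E} (h₁ : p + q • w - (q * q) • r = 0)
    (h₂ : r + q • w - (q * q) • p = 0) : p = r ∧ w = (q - q⁻¹) • p := by
  have e : p = r := by
    have h3 : (1 + q * q) • (p - r) = 0 := by
      have := congrArg₂ (· - ·) h₁ h₂
      simp only [sub_zero] at this
      rw [← this]; module
    exact sub_eq_zero.1 ((smul_eq_zero.1 h3).resolve_left hq2)
  subst e
  refine ⟨rfl, smul_right_injective E hq ?_⟩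
  have h4 : q • w = (q * q) • p - p := by rw [← sub_eq_zero, ← h₁]; module
  show q • w = q • ((q - q⁻¹) • p)
  rw [h4, smul_smul, mul_sub, mul_inv_cancel₀ hq, sub_smul, one_smul]

theorem one_add_sq_ne_zero {q : ℂ} (hroot : ∀ n : ℕ, 0 < n → q ^ n ≠ 1) : 1 + q * q ≠ 0 := by
  intro h
  -- If `q² = -1`, then `q⁴ = 1`.
  refine hroot 4 (by norm_num) ?_
  linear_combination (q * q - 1) * h

section Necessity

variable {C D : Type u} [Ring C] [Algebra ℂ C] [Ring D] [Algebra ℂ D]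
  {𝒢 : ZMod 2 → Submodule ℂ C} {𝒟 : ZMod 2 → Submodule ℂ D} {q : ℂ} {s t : ZMod 2}

theorem LinearProblem.IsBose.map {L : LinearProblem 𝒢 s} (h : L.IsBose q) (f : C →ₐ[ℂ] D) :
    ((f L.a * f L.d = f L.d * f L.a ∧ f L.a * f L.b = q • (f L.b * f L.a)) ∧
      f L.c * f L.a = q • (f L.a * f L.c)) ∧ f L.d * f L.b = q • (f L.b * f L.d) ∧
      f L.c * f L.d = q • (f L.d * f L.c) :=
  ⟨⟨⟨by simpa using congrArg f h.ad, by simpa using congrArg f h.ab⟩,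
    by simpa using congrArg f h.ca⟩, by simpa using congrArg f h.db,
    by simpa using congrArg f h.cd⟩

/-- The defects give the exchange of `a` with `b` and `c`, then `ad = da` and the anticommutator `bc
+ cb`. The exchange of `d` is not read off from an entry but follows from these and `b² = c² = 0`.
-/
theorem ProvidesAutomorphism.isFermi {L₁ : LinearProblem 𝒟 t} {L : LinearProblem 𝒢 s}
    (hq : q ≠ 0) (hroot : ∀ n : ℕ, 0 < n → q ^ n ≠ 1) (ht : t = 0) (hs : s = 1)
    (h₁ : L₁.IsBose q) (h : ProvidesAutomorphism L₁ L L) : L.IsFermi q := by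
  obtain ⟨B, _, _, ℬ, _, T, Φ, hΦ⟩ := h
  have : Nontrivial C := ⟨L.b, 0, L.b_ne_zero⟩
  have : Nontrivial D := ⟨L₁.b, 0, L₁.b_ne_zero⟩
  have c₁₂ := T.comm₁₂.crossRel L₁.isHomog L.isHomog
  have c₁₃ := T.comm₁₃.crossRel L₁.isHomog L.isHomog
  have c₂₃ := T.comm₂₃.crossRel L.isHomog L.isHomog
  obtain ⟨bb, cc⟩ := L.odd_sq hs
  subst ht hs
  rw [show sg (0 * 1) = 1 by simp [sg]] at c₁₂ c₁₃
  rw [show sg (1 * 1) = -1 by simp [sg]] at c₂₃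
  obtain ⟨⟨⟨-, xab⟩, xca⟩, -, -⟩ := h₁.map T.i₁
  have ne_b : L₁.b * L₁.a ≠ 0 := fun e => L₁.b_ne_zero ((L₁.isUnit_a.mul_left_eq_zero).1 e)
  have ne_c : L₁.a * L₁.c ≠ 0 := fun e => L₁.c_ne_zero ((L₁.isUnit_a.mul_right_eq_zero).1 e)
  have ne_a : L₁.a * L₁.a ≠ 0 := (L₁.isUnit_a.mul L₁.isUnit_a).ne_zero
  obtain ⟨e₁, e₂, e₃, e₄⟩ := expand_even_odd_odd c₁₂ c₁₃ c₂₃ xab xca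
  rw [hΦ.exchange_iff.1 e₁, sub_self] at e₂
  rw [hΦ.exchange_iff.2 e₃, sub_self] at e₄
  have ab : L.a * L.b = q • (L.b * L.a) := by
    refine sub_eq_zero.1 (((T.eq_zero_of_mul_mul (u := L₁.a * L₁.a) (w := L.c) ?_).resolve_left
      ne_a).resolve_right L.c_ne_zero)
    simpa using e₂.symm
  have ca : L.c * L.a = q • (L.a * L.c) := by
    refine (sub_eq_zero.1 (((T.eq_zero_of_mul_mul (u := L₁.a * L₁.a) (w := L.b)
      ?_).resolve_left ne_a).resolve_right L.b_ne_zero)).symm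
    simpa using e₄.symm
  have tr {x y x' y' : C} (f : C →ₐ[ℂ] B) (h : x * y = q • (x' * y')) :
      f x * f y = q • (f x' * f y') := by simpa using congrArg f h
  obtain ⟨e₁, e₂, e₃, e₄⟩ := expand_even_odd_odd' c₁₂ c₁₃ c₂₃ xab xca (tr T.i₂ ab) (tr T.i₂ ca)
    (tr T.i₃ ab) (tr T.i₃ ca) (by simpa using congrArg T.i₂ bb) (by simpa using congrArg T.i₂ cc)
  rw [hΦ.exchange_iff.1 e₁, sub_self] at e₂
  rw [hΦ.exchange_iff.2 e₃, sub_self] at e₄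
  have f₂ : L.a * L.d + q • (L.c * L.b + L.b * L.c) - (q * q) • (L.d * L.a) = 0 := by
    refine ((T.eq_zero_of_mul_mul (u := L₁.b * L₁.a) (v := L.b) ?_).resolve_left
      ne_b).resolve_left L.b_ne_zero
    simpa using e₂.symm
  have f₄ : L.d * L.a + q • (L.c * L.b + L.b * L.c) - (q * q) • (L.a * L.d) = 0 := by
    refine ((T.eq_zero_of_mul_mul (u := L₁.a * L₁.c) (v := L.c) ?_).resolve_left
      ne_c).resolve_left L.c_ne_zero
    simpa using e₄.symm
  obtain ⟨ad, cb⟩ := eq_and_eq_of_swap hq (one_add_sq_ne_zero hroot) f₂ f₄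
  have hk : q - q⁻¹ ≠ 0 := qp_sub_inv_ne_zero hq hroot 0
  refine ⟨ad, ab, ca, mul_eq_smul_of_anticomm hq hk L.isUnit_a bb ((add_comm _ _).trans cb) ab,
    ?_, (add_comm _ _).trans cb⟩
  have := mul_eq_smul_of_anticomm (inv_ne_zero hq) hk L.isUnit_a cc cb
    (by rw [ca, smul_smul, inv_mul_cancel₀ hq, one_smul])
  rw [this, smul_smul, mul_inv_cancel₀ hq, one_smul]

/-- The mirror image of `isFermi`: the known even problem stands last, and the entries in the last
row and column give the exchange of `d` first. -/
theorem ProvidesAutomorphism.isFermi_inv {L₃ : LinearProblem 𝒟 t} {L : LinearProblem 𝒢 s}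
    (hq : q ≠ 0) (hroot : ∀ n : ℕ, 0 < n → q ^ n ≠ 1) (ht : t = 0) (hs : s = 1)
    (h₃ : L₃.IsBose q) (h : ProvidesAutomorphism L L L₃) : L.IsFermi q⁻¹ := by
  obtain ⟨B, _, _, ℬ, _, T, Φ, hΦ⟩ := h
  have : Nontrivial C := ⟨L.b, 0, L.b_ne_zero⟩
  have : Nontrivial D := ⟨L₃.b, 0, L₃.b_ne_zero⟩
  have c₁₂ := T.comm₁₂.crossRel L.isHomog L.isHomog
  have c₁₃ := T.comm₁₃.crossRel L.isHomog L₃.isHomog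
  have c₂₃ := T.comm₂₃.crossRel L.isHomog L₃.isHomog
  obtain ⟨bb, cc⟩ := L.odd_sq hs
  subst ht hs
  rw [show sg (1 * 0) = 1 by simp [sg]] at c₁₃ c₂₃
  rw [show sg (1 * 1) = -1 by simp [sg]] at c₁₂
  obtain ⟨-, zdb, zcd⟩ := h₃.map T.i₃
  have ne_b : L₃.b * L₃.d ≠ 0 := fun e => L₃.b_ne_zero ((L₃.isUnit_d.mul_left_eq_zero).1 e)
  have ne_c : L₃.d * L₃.c ≠ 0 := fun e => L₃.c_ne_zero ((L₃.isUnit_d.mul_right_eq_zero).1 e)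
  have ne_d : L₃.d * L₃.d ≠ 0 := (L₃.isUnit_d.mul L₃.isUnit_d).ne_zero
  obtain ⟨e₁, e₂, e₃, e₄⟩ := expand_odd_odd_even c₁₂ c₁₃ c₂₃ zdb zcd
  rw [hΦ.exchange_iff.1 e₁, sub_self] at e₂
  rw [hΦ.exchange_iff.2 e₃, sub_self] at e₄
  have db : L.d * L.b = q • (L.b * L.d) := by
    refine sub_eq_zero.1 (((T.eq_zero_of_mul_mul (u := L.c) (w := L₃.d * L₃.d) ?_).resolve_left
      L.c_ne_zero).resolve_right ne_d)
    simpa using e₂.symm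
  have cd : L.c * L.d = q • (L.d * L.c) := by
    refine (sub_eq_zero.1 (((T.eq_zero_of_mul_mul (u := L.b) (w := L₃.d * L₃.d)
      ?_).resolve_left L.b_ne_zero).resolve_right ne_d)).symm
    simpa using e₄.symm
  have tr {x y x' y' : C} (f : C →ₐ[ℂ] B) (h : x * y = q • (x' * y')) :
      f x * f y = q • (f x' * f y') := by simpa using congrArg f h
  obtain ⟨e₁, e₂, e₃, e₄⟩ := expand_odd_odd_even' c₁₂ c₁₃ c₂₃ (tr T.i₁ db) (tr T.i₁ cd)
    (tr T.i₂ db) (tr T.i₂ cd) zdb zcd (by simpa using congrArg T.i₂ bb)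
    (by simpa using congrArg T.i₂ cc)
  rw [hΦ.exchange_iff.1 e₁, sub_self] at e₂
  rw [hΦ.exchange_iff.2 e₃, sub_self] at e₄
  have f₂ : L.d * L.a - q • (L.c * L.b + L.b * L.c) - (q * q) • (L.a * L.d) = 0 := by
    refine (T.eq_zero_of_mul_mul (v := L.b) (w := L₃.b * L₃.d) ?_).resolve_right
      (not_or.2 ⟨L.b_ne_zero, ne_b⟩)
    simpa using e₂.symm
  have f₄ : L.a * L.d - q • (L.c * L.b + L.b * L.c) - (q * q) • (L.d * L.a) = 0 := by
    refine (T.eq_zero_of_mul_mul (v := L.c) (w := L₃.d * L₃.c) ?_).resolve_right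
      (not_or.2 ⟨L.c_ne_zero, ne_c⟩)
    simpa using e₄.symm
  obtain ⟨da, cb⟩ := eq_and_eq_of_swap (p := L.d * L.a) (r := L.a * L.d)
    (w := -(L.c * L.b + L.b * L.c)) hq (one_add_sq_ne_zero hroot) (by rw [← f₂]; module) (by rw [← f₄]; module)
  replace cb : L.c * L.b + L.b * L.c = (q⁻¹ - q) • (L.d * L.a) := by
    rw [neg_eq_iff_eq_neg.1 cb]; module
  have hk : q⁻¹ - q ≠ 0 := by
    rw [← neg_sub]; exact neg_ne_zero.2 (qp_sub_inv_ne_zero hq hroot 0)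
  have inv {x y : C} (h : x = q • y) : y = q⁻¹ • x := by
    rw [h, smul_smul, inv_mul_cancel₀ hq, one_smul]
  refine ⟨da.symm, inv (mul_eq_smul_of_anticomm hq hk L.isUnit_d bb ((add_comm _ _).trans cb) db),
    ?_, inv db, inv cd, ?_⟩
  · exact mul_eq_smul_of_anticomm (inv_ne_zero hq) hk L.isUnit_d cc cb (inv cd)
  · rw [add_comm, cb, da, inv_inv]

theorem ProvidesAutomorphism.isBose_inv {L₃ : LinearProblem 𝒟 t} {L : LinearProblem 𝒢 s}
    (hq : q ≠ 0) (hroot : ∀ n : ℕ, 0 < n → q ^ n ≠ 1) (ht : t = 0) (hs : s = 1)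
    (hL : L.IsFermi q) (h : ProvidesAutomorphism L L L₃) : L₃.IsBose q⁻¹ := by
  obtain ⟨B, _, _, ℬ, _, T, Φ, hΦ⟩ := h
  have : Nontrivial C := ⟨L.b, 0, L.b_ne_zero⟩
  have c₁₂ := T.comm₁₂.crossRel L.isHomog L.isHomog
  have c₁₃ := T.comm₁₃.crossRel L.isHomog L₃.isHomog
  have c₂₃ := T.comm₂₃.crossRel L.isHomog L₃.isHomog
  obtain ⟨bb, cc⟩ := L.odd_sq hs
  subst ht hs
  rw [show sg (1 * 0) = 1 by simp [sg]] at c₁₃ c₂₃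
  rw [show sg (1 * 1) = -1 by simp [sg]] at c₁₂
  have tr {x y x' y' : C} (f : C →ₐ[ℂ] B) (h : x * y = q • (x' * y')) :
      f x * f y = q • (f x' * f y') := by simpa using congrArg f h
  have cb : L.c * L.b = (q - q⁻¹) • (L.a * L.d) - L.b * L.c := by rw [← hL.bc]; abel
  obtain ⟨⟨e₁, e₂, e₃, e₄⟩, ⟨e₅, e₆, e₇, e₈⟩, e₉, e₁₀, e₁₁, e₁₂⟩ := expand_fermi_fermi_even
    c₁₂ c₁₃ c₂₃ hq (tr T.i₁ hL.ab) (tr T.i₁ hL.ca) (tr T.i₁ hL.bd) (tr T.i₁ hL.dc)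
    (by simpa using congrArg T.i₁ hL.ad.symm)
    (by simpa only [map_mul, map_sub, map_smul, Quad.map, LinearProblem.quad] using congrArg T.i₁ cb)
    (by simpa using congrArg T.i₁ bb)
    (by simpa using congrArg T.i₁ cc) (tr T.i₂ hL.ab) (tr T.i₂ hL.ca) (tr T.i₂ hL.bd)
    (tr T.i₂ hL.dc) (by simpa using congrArg T.i₂ bb) (by simpa using congrArg T.i₂ cc)
  rw [hΦ.exchange_iff.1 e₁, sub_self] at e₂
  rw [hΦ.exchange_iff.2 e₃, sub_self] at e₄
  rw [hΦ.exchange_iff.1 e₅, sub_self] at e₆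
  rw [hΦ.exchange_iff.2 e₇, sub_self, zero_eq_neg] at e₈
  rw [hΦ.exchange_iff.1 e₉, sub_self] at e₁₀
  rw [hΦ.exchange_iff.2 e₁₁, sub_self] at e₁₂
  have ne_ba : L.b * L.a ≠ 0 := fun e => L.b_ne_zero ((L.isUnit_a.mul_left_eq_zero).1 e)
  have ne_ac : L.a * L.c ≠ 0 := fun e => L.c_ne_zero ((L.isUnit_a.mul_right_eq_zero).1 e)
  -- Multiplying by `b` on the right turns `bc` into `(q - q⁻¹) ad`, so the expression times `b` is
  -- `-q⁻¹ a d b`, which is nonzero.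
  have ne_bc : L.b * L.c - q • (L.a * L.d) ≠ 0 := by
    intro e
    have bcb : L.b * L.c * L.b = (q - q⁻¹) • (L.a * L.d * L.b) := by
      rw [mul_assoc, cb, mul_sub, ← mul_assoc L.b L.b, bb, zero_mul, sub_zero, mul_smul_comm]
      congr 1
      rw [mul_assoc, eq_inv_smul_iff₀ hq |>.2 hL.bd.symm, mul_smul_comm, ← mul_assoc, ← mul_assoc,
        hL.ab, smul_mul_assoc, smul_smul, inv_mul_cancel₀ hq, one_smul]
    have e' : (-q⁻¹) • (L.a * L.d * L.b) = 0 := by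
      have := congrArg (· * L.b) e
      simp only [sub_mul, smul_mul_assoc, bcb, zero_mul] at this
      rw [← this]; module
    exact L.b_ne_zero (((L.isUnit_a.mul L.isUnit_d).mul_right_eq_zero).1
      ((smul_eq_zero.1 e').resolve_left (neg_ne_zero.2 (inv_ne_zero hq))))
  have bd : L₃.b * L₃.d = q • (L₃.d * L₃.b) := by
    refine sub_eq_zero.1 (((T.eq_zero_of_mul_mul (u := L.b) (v := L.d) ?_).resolve_left
      L.b_ne_zero).resolve_left L.isUnit_d.ne_zero)
    simpa using e₂.symm
  have dc : L₃.d * L₃.c = q • (L₃.c * L₃.d) := by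
    refine sub_eq_zero.1 (((T.eq_zero_of_mul_mul (u := L.c) (v := L.d) ?_).resolve_left
      L.c_ne_zero).resolve_left L.isUnit_d.ne_zero)
    simpa using e₄.symm
  have ac : L₃.a * L₃.c = q • (L₃.c * L₃.a) := by
    refine sub_eq_zero.1 (((T.eq_zero_of_mul_mul (u := L.b * L.c - q • (L.a * L.d)) (v := L.b)
      ?_).resolve_left ne_bc).resolve_left L.b_ne_zero)
    simpa using e₁₀.symm
  have ba : L₃.b * L₃.a = q • (L₃.a * L₃.b) := by
    refine sub_eq_zero.1 (((T.eq_zero_of_mul_mul (u := L.b * L.c - q • (L.a * L.d)) (v := L.c)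
      ?_).resolve_left ne_bc).resolve_left L.c_ne_zero)
    simpa using e₁₂.symm
  have f₆ : L₃.a * L₃.d - q • (L₃.c * L₃.b) + q • (L₃.b * L₃.c) - (q * q) • (L₃.d * L₃.a) = 0 := by
    refine ((T.eq_zero_of_mul_mul (u := L.b * L.a) (v := L.b) ?_).resolve_left
      ne_ba).resolve_left L.b_ne_zero
    simpa using e₆.symm
  have f₈ : L₃.d * L₃.a - q • (L₃.c * L₃.b) + q • (L₃.b * L₃.c) - (q * q) • (L₃.a * L₃.d) = 0 := by
    refine ((T.eq_zero_of_mul_mul (u := L.a * L.c) (v := L.c) ?_).resolve_left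
      ne_ac).resolve_left L.c_ne_zero
    simpa using e₈
  obtain ⟨ad, bc⟩ := eq_and_eq_of_swap (p := L₃.a * L₃.d) (r := L₃.d * L₃.a)
    (w := L₃.b * L₃.c - L₃.c * L₃.b) hq
    (one_add_sq_ne_zero hroot) (by rw [← f₆]; module) (by rw [← f₈]; module)
  have inv {x y : D} (h : x = q • y) : y = q⁻¹ • x := by
    rw [h, smul_smul, inv_mul_cancel₀ hq, one_smul]
  exact ⟨ad, inv ba, inv ac, inv bd, inv dc, by rw [bc, inv_inv]⟩

end Necessity

/-! ### Assembly of the theorem. -/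

section LocalRelations

variable {C : Type u} [Ring C] [Algebra ℂ C] {𝒢 : ZMod 2 → Submodule ℂ C} {q : ℂ} {r s t : ZMod 2}

theorem LinearProblem.IsBose.localRel {L : LinearProblem 𝒢 r} (h : L.IsBose (qp q s)) :
    LocalRel q s s L.quad where
  da := h.ad.symm
  ab := h.ab
  ca := h.ca
  db := h.db
  cd := h.cd
  cb := by
    have : L.b * L.c = _ := sub_eq_iff_eq_add.1 h.bc
    rw [sg_add_self, LinearProblem.quad]
    simp only [this]
    module
  bb e := (e rfl).elim
  cc e := (e rfl).elim

theorem LinearProblem.IsFermi.localRel {L : LinearProblem 𝒢 r} (hq : q ≠ 0) (hr : r = 1)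
    (hst : s ≠ t) (h : L.IsFermi (qp q s)) : LocalRel q s t L.quad := by
  have hs := qp_ne_zero hq s
  have inv {x y : C} (h : x = qp q s • y) : y = qp q t • x := by
    rw [h, smul_smul, qp_of_ne q hst, inv_mul_cancel₀ hs, one_smul]
  refine ⟨h.ad.symm, h.ab, h.ca, inv h.bd, inv h.dc, ?_, fun _ => (L.odd_sq hr).1,
    fun _ => (L.odd_sq hr).2⟩
  have : L.c * L.b = _ := eq_sub_of_add_eq' h.bc
  rw [sg_of_ne hst, qp_of_ne q hst, inv_inv, LinearProblem.quad]
  simp only [this]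
  module

end LocalRelations

end SuperTetra

theorem theorem2 (q : ℂ) (hq : q ≠ 0) (hq_root : ∀ n : ℕ, 0 < n → q ^ n ≠ 1)
    (C : ZMod 2 → ZMod 2 → Type u) [∀ s t, Ring (C s t)] [∀ s t, Algebra ℂ (C s t)]
    (𝒢 : ∀ s t, ZMod 2 → Submodule ℂ (C s t)) [∀ s t, GradedAlgebra (𝒢 s t)]
    (L : ∀ s t, SuperTetra.LinearProblem (𝒢 s t) (s + t)) (hA : (L 0 0).IsBose q) :
    ((∀ α β γ : ZMod 2, SuperTetra.ProvidesAutomorphism (L α β) (L α γ) (L β γ)) ↔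
      ((L 0 1).IsFermi q ∧ (L 1 0).IsFermi q⁻¹ ∧ (L 1 1).IsBose q⁻¹)) ∧
    (((L 0 1).IsFermi q ∧ (L 1 0).IsFermi q⁻¹ ∧ (L 1 1).IsBose q⁻¹) →
      ∀ α β γ : ZMod 2,
        SuperTetra.ProvidesCentralAutomorphism (L α β) (L α γ) (L β γ) ∧
        SuperTetra.DeterminesAutomorphismUpToSign (L α β) (L α γ) (L β γ) ∧
        (¬ (α = β ∧ β = γ) → SuperTetra.DeterminesAutomorphism (L α β) (L α γ) (L β γ))) := by
  have q0 : SuperTetra.qp q 0 = q := rfl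
  have q1 : SuperTetra.qp q 1 = q⁻¹ := rfl
  have local_rel (h : (L 0 1).IsFermi q ∧ (L 1 0).IsFermi q⁻¹ ∧ (L 1 1).IsBose q⁻¹)
      (s t : ZMod 2) : SuperTetra.LocalRel q s t (L s t).quad := by
    obtain ⟨h₁, h₂, h₃⟩ := h
    rcases SuperTetra.zmod_two_cases s with rfl | rfl <;>
      rcases SuperTetra.zmod_two_cases t with rfl | rfl
    · exact SuperTetra.LinearProblem.IsBose.localRel hA
    · exact SuperTetra.LinearProblem.IsFermi.localRel hq rfl (by decide) h₁
    · exact SuperTetra.LinearProblem.IsFermi.localRel hq rfl (by decide) h₂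
    · exact SuperTetra.LinearProblem.IsBose.localRel h₃
  have central (h) (α β γ : ZMod 2) :
      SuperTetra.ProvidesCentralAutomorphism (L α β) (L α γ) (L β γ) :=
    SuperTetra.providesCentralAutomorphism hq hq_root _ _ _ (local_rel h α β) (local_rel h α γ)
      (local_rel h β γ)
  refine ⟨⟨fun h => ?_, fun h α β γ => ?_⟩, fun h α β γ => ⟨central h α β γ, ?_, ?_⟩⟩
  -- In the pattern `0 0 1` the known algebra meets two copies of `C 0 1`, and in `1 0 0` it meets
  -- two copies of `C 1 0`. In `0 1 1` two copies of `C 0 1`, known by then, meet `C 1 1`.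
  · have h₁ := (h 0 0 1).isFermi hq hq_root rfl rfl hA
    exact ⟨h₁, (h 1 0 0).isFermi_inv hq hq_root rfl rfl hA,
      (h 0 1 1).isBose_inv hq hq_root rfl rfl h₁⟩
  · obtain ⟨B, i₁, i₂, ℬ, i₃, T, Φ, hΦ, -⟩ := central h α β γ
    exact ⟨B, i₁, i₂, ℬ, i₃, T, Φ, hΦ⟩
  · intro B _ _ ℬ _ T Φ Ψ hΦ fΦ hΨ fΨ
    exact (SuperTetra.agree_of_solves hq hq_root (local_rel h α β) (local_rel h α γ)
      (local_rel h β γ) hΦ fΦ hΨ fΨ).1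
  · intro hne B _ _ ℬ _ T Φ Ψ hΦ fΦ hΨ fΨ
    exact (SuperTetra.agree_of_solves hq hq_root (local_rel h α β) (local_rel h α γ)
      (local_rel h β γ) hΦ fΦ hΨ fΨ).2 hne
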